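/- **Setting.** The finite types are $0$ (natural numbers) and, with $\sigma,\tau$, also $\sigma\to\tau$; write $1=0\to0$ and $2=1\to0$. The language $\mathsf L_\omega$ has variables of all finite types, the constants $0,1,+,\times$, the combinators $\Pi_{\rho,\sigma}$, $\Sigma_{\rho,\sigma,\tau}$ and recursors $\mathbf R_\sigma$, and the relations $=_0$, $<_0$ on type $0$; equality at higher types is defined pointwise, by $x=_\tau y:\equiv(\forall z_1\dots z_k)(xz_1\cdots z_k=_0yz_1\cdots z_k)$. The system $\mathsf{RCA}_0^\omega$ consists, over classical many-sorted predicate logic, of the basic axioms on $0,1,+,\times,<$; the axioms $\Pi xy=x$ and $\Sigma xyz=xz(yz)$ at all types; $\mathbf R_0(f,m,0)=m$ and $\mathbf R_0(f,m,n+1)=f(\mathbf R_0(f,m,n))$; extensionality $x=_\rho y\to\varphi(x)=_\tau\varphi(y)$ for all types $\rho,\tau$; induction for quantifier-free formulas; and $(\forall x^1)(\exists y^0)A(x,y)\to(\exists Y^{2})(\forall x^1)A(x,Y(x))$ for quantifier-free $A$ (parameters of all types allowed). $\mathsf{ACA}_0^\omega$ is $\mathsf{RCA}_0^\omega$ together with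 $$(\exists\mu^2)(\forall f^1)\big[(\exists n)(f(n)=0)\to f(\mu(f))=0\big].$$ In this language a real is a sequence $(q_n)$ of (codes of) rationals with $|q_n-q_{n+i}|<2^{-n}$ for all $n,i$; two reals $(q_n)$, $(r_n)$ are equal if $|q_n-r_n|\le 2^{1-n}$ for all $n$; functions on reals are functionals of type $1\to1$ (for $\mathbb R\to(\mathbb R\to\mathbb R^+)$: of type $1\to(1\to 1)$) that respect this equality; finite sequences are given by a length and a sequence. Let $I=[0,1]$. * $\mathsf{HBU}$: for every $\Psi:\mathbb R\to\mathbb R^+$ there are finitely many reals $y_1,\dots,y_k$ such that every $x\in I$ lies in some $(y_i-\Psi(y_i),\,y_i+\Psi(y_i))$. * A tagged partition $P$ of $[a,b]$ consists of points $a=p_0<p_1<\dots<p_k=b$ and tags $t_i\in[p_i,p_{i+1}]$ ($i<k$); its Riemann sum is $S(f,P)=\sum_{i<k}f(t_i)(p_{i+1}-p_i)$ and its mesh is $\max_{i<k}(p_{i+1}-p_i)$. For $\delta:\mathbb R\to\mathbb R^+$ (a gauge), $P$ is $\delta$-fine if $[p_i,p_{i+1}]\subseteq[t_i-\delta(t_i),t_i+\delta(t_i)]$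 for all $i<k$. * A real $B$ is a Riemann integral of $f$ on $[a,b]$ if for every $\varepsilon>0$ there is a real $\delta>0$ such that $|S(f,P)-B|<\varepsilon$ for all tagged partitions $P$ of $[a,b]$ of mesh at most $\delta$. * A real $A$ is a gauge integral of $f$ (on $I$) if for every $\varepsilon>0$ there is a gauge $\delta$ such that $|S(f,P)-A|<\varepsilon$ for all $\delta$-fine tagged partitions $P$ of $I$. The function $f$ is gauge integrable with a modulus if there are a real $A$ and $\Phi:\mathbb R\to(\mathbb R\to\mathbb R^+)$ such that for every $\varepsilon>0$ the gauge $\Phi(\varepsilon)$ has this property. **Theorem.** $\mathsf{ACA}_0^\omega$ proves that $\mathsf{HBU}$ is equivalent to each of the following statements. 1. There is a function $f:I\to\mathbb R$ that is not gauge integrable with a modulus. 2. (Hake) If $f:I\to\mathbb R$ is gauge integrable with a modulus, and Riemann integrable on $[x,1]$ for every $x\in(0,1]$, then for every gauge integral $A$ of $f$, the Riemann integrals satisfy $\lim_{x\to0+}\int_x^1f=A$. 3. (weak Hake) If $f:I\to\mathbb R$ is gauge integrable with a modulus, and Riemann integrable on $[x,1]$ for every $x\in(0,1]$, then the limit of Riemann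 integrals $\lim_{x\to0+}\int_x^1f$ exists. Here $\lim_{x\to0+}\int_x^1f=L$ means: for every $\varepsilon>0$ there is $\eta>0$ such that for all $x\in(0,1]$ with $x<\eta$, every Riemann integral $B$ of $f$ on $[x,1]$ satisfies $|B-L|<\varepsilon$. -/

import Mathlib

/-! Higher-order arithmetic in all finite types, the system `ACA₀^ω` as a formal deductive
system, and the gauge integral formulated inside its language. -/

namespace HigherOrderArithmetic

/-! ### The language of all finite types -/

/-- The finite types: `nat` is the type `0` of natural numbers. -/
inductive Ty : Type
  | nat : Ty
  | arr : Ty → Ty → Ty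
  deriving DecidableEq

local infixr:60 " ⇒ " => Ty.arr

/-- The type `1 = 0 → 0`. -/
abbrev Ty.one : Ty := Ty.nat ⇒ Ty.nat

/-- The type `2 = 1 → 0`. -/
abbrev Ty.two : Ty := Ty.one ⇒ Ty.nat

/-- The constants: `0`, `1`, `+`, `×`, the combinators `Π` and `Σ` for all types, and the
recursors `R_σ` for all types `σ`. -/
inductive Con : Ty → Type
  | zero : Con Ty.nat
  | one : Con Ty.nat
  | add : Con (Ty.nat ⇒ Ty.nat ⇒ Ty.nat)
  | mul : Con (Ty.nat ⇒ Ty.nat ⇒ Ty.nat)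
  | combPi (ρ σ : Ty) : Con (ρ ⇒ σ ⇒ ρ)
  | combSigma (ρ σ τ : Ty) : Con ((ρ ⇒ σ ⇒ τ) ⇒ (ρ ⇒ σ) ⇒ ρ ⇒ τ)
  | recursor (σ : Ty) : Con ((σ ⇒ σ) ⇒ σ ⇒ Ty.nat ⇒ σ)

/-- Typed terms. Variables are de Bruijn indices, counted separately for each type:
`var σ n` is the `n`-th variable of type `σ`. -/
inductive Tm : Ty → Type
  | var (σ : Ty) (n : ℕ) : Tm σ
  | con {σ : Ty} (c : Con σ) : Tm σ
  | app {σ τ : Ty} (f : Tm (σ ⇒ τ)) (x : Tm σ) : Tm τ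

/-- Formulas. The only primitive relations are `=₀` and `<₀`. The quantifier `all σ φ` binds
the variable of type `σ` with index `0` in `φ` and leaves the variables of other types alone. -/
inductive Fm : Type
  | eq (s t : Tm Ty.nat) : Fm
  | lt (s t : Tm Ty.nat) : Fm
  | bot : Fm
  | imp (φ ψ : Fm) : Fm
  | all (σ : Ty) (φ : Fm) : Fm

/-- Simultaneous substitutions. -/
abbrev Subst : Type := ∀ τ : Ty, ℕ → Tm τ

/-- Apply a substitution to a term. -/
def Tm.subst (s : Subst) : {τ : Ty} → Tm τ → Tm τ
  | _, .var τ n => s τ n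
  | _, .con c => .con c
  | _, .app f x => .app (f.subst s) (x.subst s)

/-- The substitution that raises every variable of type `σ` by one. -/
def Subst.raise (σ : Ty) : Subst := fun τ n => .var τ (if τ = σ then n + 1 else n)

/-- The substitution that replaces the variable of type `σ` with index `0` by `t`, and lowers
the other variables of type `σ` by one. -/
def Subst.single {σ : Ty} (t : Tm σ) : Subst := fun τ n =>
  if h : τ = σ then
    match n with
    | 0 => h ▸ t
    | m + 1 => .var τ m
  else .var τ n

/-- The lift of a substitution under a quantifier of type `σ`. -/
def Subst.lift (σ : Ty) (s : Subst) : Subst := fun τ n =>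
  if τ = σ then
    match n with
    | 0 => .var τ 0
    | m + 1 => (s τ m).subst (Subst.raise σ)
  else (s τ n).subst (Subst.raise σ)

namespace Fm

/-- Apply a substitution to a formula (bound variables are not captured). -/
def subst (s : Subst) : Fm → Fm
  | eq a b => eq (a.subst s) (b.subst s)
  | lt a b => lt (a.subst s) (b.subst s)
  | bot => bot
  | imp φ ψ => imp (subst s φ) (subst s ψ)
  | all σ φ => all σ (subst (s.lift σ) φ)

/-- Weakening by one fresh variable of type `σ`. -/
def shift (σ : Ty) (φ : Fm) : Fm := φ.subst (Subst.raise σ)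

/-- The instance `φ(t)` of `φ` for its variable of type `σ` with index `0`. -/
def inst {σ : Ty} (φ : Fm) (t : Tm σ) : Fm := φ.subst (Subst.single t)

/-- Classically defined connectives. -/
def neg (φ : Fm) : Fm := imp φ bot
def and (φ ψ : Fm) : Fm := neg (imp φ (neg ψ))
def or (φ ψ : Fm) : Fm := imp (neg φ) ψ
def iff (φ ψ : Fm) : Fm := and (imp φ ψ) (imp ψ φ)
def ex (σ : Ty) (φ : Fm) : Fm := neg (all σ (neg φ))

/-- Quantifier-free formulas (variables of all types are allowed). -/
def IsQF : Fm → Prop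
  | eq _ _ => True
  | lt _ _ => True
  | bot => True
  | imp φ ψ => IsQF φ ∧ IsQF ψ
  | all _ _ => False

end Fm

/-! ### Classical many-sorted predicate logic -/

/-- `Prf T Γ φ`: the formula `φ` has a natural deduction from the hypotheses `Γ` and the
axioms `T` in classical many-sorted predicate logic with equality `=₀`. Axioms with free
variables count as universally closed. -/
inductive Prf (T : Set Fm) : List Fm → Fm → Prop
  | ax {Γ : List Fm} {φ : Fm} : φ ∈ T → Prf T Γ φ
  | hyp {Γ : List Fm} {φ : Fm} : φ ∈ Γ → Prf T Γ φ
  | impI {Γ : List Fm} {φ ψ : Fm} : Prf T (φ :: Γ) ψ → Prf T Γ (.imp φ ψ)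
  | impE {Γ : List Fm} {φ ψ : Fm} : Prf T Γ (.imp φ ψ) → Prf T Γ φ → Prf T Γ ψ
  | raa {Γ : List Fm} {φ : Fm} : Prf T (φ.neg :: Γ) .bot → Prf T Γ φ
  | allI {Γ : List Fm} {σ : Ty} {φ : Fm} :
      Prf T (Γ.map (Fm.shift σ)) φ → Prf T Γ (.all σ φ)
  | allE {Γ : List Fm} {σ : Ty} {φ : Fm} (t : Tm σ) :
      Prf T Γ (.all σ φ) → Prf T Γ (φ.inst t)
  | eqRefl {Γ : List Fm} (t : Tm Ty.nat) : Prf T Γ (.eq t t)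
  | eqSubst {Γ : List Fm} (φ : Fm) (s t : Tm Ty.nat) :
      Prf T Γ (.eq s t) → Prf T Γ (φ.inst s) → Prf T Γ (φ.inst t)

/-! ### Writing formulas with binders

An `Exp σ` (a `Form`) is a term (a formula) that still has to be told, for each type, how many
quantifiers of that type it stands under. The variable bound by a quantifier at depth `d` has
at depth `e` the de Bruijn index `e - (d + 1)`. A `Form` that mentions no variable but those
bound in it is a sentence, read off at depth `0`. -/

def Exp (σ : Ty) : Type := (Ty → ℕ) → Tm σ

def Form : Type := (Ty → ℕ) → Fm

def app {σ τ : Ty} (f : Exp (σ ⇒ τ)) (x : Exp σ) : Exp τ := fun d => .app (f d) (x d)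

def con {σ : Ty} (c : Con σ) : Exp σ := fun _ => .con c

local infixl:100 " ⬝ " => app

instance : Zero (Exp Ty.nat) := ⟨con .zero⟩
instance : One (Exp Ty.nat) := ⟨con .one⟩
instance : Add (Exp Ty.nat) := ⟨fun a b => con .add ⬝ a ⬝ b⟩
instance : Mul (Exp Ty.nat) := ⟨fun a b => con .mul ⬝ a ⬝ b⟩

/-- `s =₀ t` and `s <₀ t`. -/
def eqN (s t : Exp Ty.nat) : Form := fun d => .eq (s d) (t d)
def ltN (s t : Exp Ty.nat) : Form := fun d => .lt (s d) (t d)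

def bot : Form := fun _ => .bot
def imp (A B : Form) : Form := fun d => .imp (A d) (B d)
def neg (A : Form) : Form := fun d => (A d).neg
def and (A B : Form) : Form := fun d => (A d).and (B d)
def or (A B : Form) : Form := fun d => (A d).or (B d)
def iff (A B : Form) : Form := fun d => (A d).iff (B d)

def all (σ : Ty) (A : Exp σ → Form) : Form := fun d =>
  .all σ (A (fun e => .var σ (e σ - (d σ + 1))) (Function.update d σ (d σ + 1)))

def ex (σ : Ty) (A : Exp σ → Form) : Form := fun d =>
  .ex σ (A (fun e => .var σ (e σ - (d σ + 1))) (Function.update d σ (d σ + 1)))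

local infix:50 " ≐ " => eqN
local infix:50 " ≺ " => ltN
local infixr:35 " ⋏ " => and
local infixr:30 " ⋎ " => or
local infixr:25 " ⇛ " => imp

/-- The sentence denoted by a closed `Form`. -/
def Form.toFm (A : Form) : Fm := A (fun _ => 0)

/-- Equality at all types: `s =_τ t` is `∀ z₁ … z_k, s z₁ … z_k =₀ t z₁ … z_k`. -/
def eqAt : (τ : Ty) → Exp τ → Exp τ → Form
  | .nat, s, t => s ≐ t
  | .arr σ τ, s, t => all σ fun z => eqAt τ (s ⬝ z) (t ⬝ z)

/-! ### The systems `RCA₀^ω` and `ACA₀^ω` -/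

/-- The basic axioms on `0, 1, +, ×, <`. -/
inductive BasicAx : Form → Prop
  | succ_ne_zero : BasicAx (all .nat fun n => neg (n + 1 ≐ 0))
  | succ_inj : BasicAx (all .nat fun m => all .nat fun n => m + 1 ≐ n + 1 ⇛ m ≐ n)
  | add_zero : BasicAx (all .nat fun m => m + 0 ≐ m)
  | add_succ : BasicAx (all .nat fun m => all .nat fun n => m + (n + 1) ≐ (m + n) + 1)
  | mul_zero : BasicAx (all .nat fun m => m * 0 ≐ 0)
  | mul_succ : BasicAx (all .nat fun m => all .nat fun n => m * (n + 1) ≐ m * n + m)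
  | not_lt_zero : BasicAx (all .nat fun m => neg (m ≺ 0))
  | lt_succ : BasicAx (all .nat fun m => all .nat fun n =>
      iff (m ≺ n + 1) (m ≺ n ⋎ m ≐ n))

/-- The substitution `n ↦ n + 1` for the variable `n` of type `0` with index `0`. -/
def Subst.succ : Subst
  | .nat, 0 => .app (.app (.con .add) (.var .nat 0)) (.con .one)
  | τ, n => .var τ n

/-- Induction for the formula `A(n)`, where `n` is the variable of type `0` with index `0`;
the other free variables of `A` are parameters. -/
def inductionFm (A : Fm) : Fm :=
  .imp (A.inst (Tm.con Con.zero))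
    (.imp (.all .nat (.imp A (A.subst Subst.succ))) (.all .nat A))

/-- `(∀ x¹)(∃ y⁰) A(x, y) → (∃ Y²)(∀ x¹) A(x, Y(x))`, where `x` and `y` are the variables of
types `1` and `0` with index `0`; the other free variables of `A` are parameters. -/
def choiceFm (A : Fm) : Fm :=
  .imp (.all Ty.one (.ex Ty.nat A))
    (.ex Ty.two (.all Ty.one
      ((A.shift Ty.two).inst (.app (.var Ty.two 0) (.var Ty.one 0)))))

/-- The axioms of `RCA₀^ω`. -/
inductive RCA : Fm → Prop
  | basic {A : Form} : BasicAx A → RCA A.toFm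
  | combPi (ρ σ : Ty) : RCA (Form.toFm
      (all ρ fun x => all σ fun y => eqAt ρ (con (.combPi ρ σ) ⬝ x ⬝ y) x))
  | combSigma (ρ σ τ : Ty) : RCA (Form.toFm
      (all (ρ ⇒ σ ⇒ τ) fun x => all (ρ ⇒ σ) fun y => all ρ fun z =>
        eqAt τ (con (.combSigma ρ σ τ) ⬝ x ⬝ y ⬝ z) (x ⬝ z ⬝ (y ⬝ z))))
  | rec_zero : RCA (Form.toFm (all .one fun f => all .nat fun m =>
      con (.recursor .nat) ⬝ f ⬝ m ⬝ 0 ≐ m))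
  | rec_succ : RCA (Form.toFm (all .one fun f => all .nat fun m => all .nat fun n =>
      con (.recursor .nat) ⬝ f ⬝ m ⬝ (n + 1) ≐ f ⬝ (con (.recursor .nat) ⬝ f ⬝ m ⬝ n)))
  | ext (ρ τ : Ty) : RCA (Form.toFm
      (all ρ fun x => all ρ fun y => all (ρ ⇒ τ) fun φ =>
        eqAt ρ x y ⇛ eqAt τ (φ ⬝ x) (φ ⬝ y)))
  | induction {A : Fm} : A.IsQF → RCA (inductionFm A)
  | choice {A : Fm} : A.IsQF → RCA (choiceFm A)

/-- `(μ²)`: Feferman's search functional exists. -/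
def muAx : Form :=
  ex .two fun μ => all .one fun f => (ex .nat fun n => f ⬝ n ≐ 0) ⇛ f ⬝ (μ ⬝ f) ≐ 0

/-- The axioms of `ACA₀^ω`, that is `RCA₀^ω` with `(μ²)`. -/
def ACA : Set Fm := {φ | RCA φ ∨ φ = muAx.toFm}

/-- `ACA₀^ω` proves the sentence `A`. -/
def ACAProves (A : Form) : Prop := Prf ACA [] A.toFm

/-! ### Rational numbers -/

abbrev NatE : Type := Exp Ty.nat

def exN (A : NatE → Form) : Form := ex .nat A
def allN (A : NatE → Form) : Form := all .nat A
/-- `i ≤ k`. -/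
def leN (i k : NatE) : Form := neg (k ≺ i)
def allLt (k : NatE) (A : NatE → Form) : Form := allN fun i => i ≺ k ⇛ A i
def allLe (k : NatE) (A : NatE → Form) : Form := allN fun i => leN i k ⇛ A i

/-- The term `2 ^ n`, which is `R₀(x ↦ x + x, 1, n)`; the doubling map is `Σ (+) (Σ Π Π)`. -/
def pow2 (n : NatE) : NatE :=
  con (.recursor .nat) ⬝
    (con (.combSigma .nat .nat .nat) ⬝ con .add ⬝
      (con (.combSigma .nat .one .nat) ⬝ con (.combPi .nat .one) ⬝ con (.combPi .nat .nat))) ⬝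
    1 ⬝ n

/-- The number `q` codes the rational `(a - b) / c`: with the Cantor pairing
`q = (n + m)(n + m + 1) / 2 + n`, the number `q` codes `(n / 2) / (m + 1)` for even `n` and
`- ((n + 1) / 2) / (m + 1)` for odd `n`. Every number codes exactly one rational. -/
def codesRat (q a b c : NatE) : Form :=
  exN fun n => exN fun m =>
    q + q ≐ (n + m) * (n + m + 1) + (n + n) ⋏ c ≐ m + 1 ⋏
      ((n ≐ a + a ⋏ b ≐ 0) ⋎ (n + 1 ≐ b + b ⋏ a ≐ 0))

/-- `A(a, b, c)` for the rational `(a - b) / c` that `q` codes. -/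
def withRat (q : NatE) (A : NatE → NatE → NatE → Form) : Form :=
  exN fun a => exN fun b => exN fun c => codesRat q a b c ⋏ A a b c

/-- `p < q + u / v` for rationals `p`, `q` and numbers `u`, `v > 0`. -/
def ratLtAdd (p q u v : NatE) : Form :=
  withRat p fun a b c => withRat q fun a' b' c' =>
    v * (a * c' + b' * c) ≺ v * (a' * c + b * c') + u * (c * c')

/-- `p ≤ q + u / v` for rationals `p`, `q` and numbers `u`, `v > 0`. -/
def ratLeAdd (p q u v : NatE) : Form :=
  withRat p fun a b c => withRat q fun a' b' c' =>
    leN (v * (a * c' + b' * c)) (v * (a' * c + b * c') + u * (c * c'))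

/-- `|p - q| < 1 / 2 ^ n`. -/
def ratNear (p q n : NatE) : Form := ratLtAdd p q 1 (pow2 n) ⋏ ratLtAdd q p 1 (pow2 n)

/-- `p + q = r` for rationals. -/
def ratAdd (p q r : NatE) : Form :=
  withRat p fun a b c => withRat q fun a' b' c' => withRat r fun a'' b'' c'' =>
    (a * c' + a' * c) * c'' + b'' * (c * c') ≐ (b * c' + b' * c) * c'' + a'' * (c * c')

/-- `p q = r` for rationals. -/
def ratMul (p q r : NatE) : Form :=
  withRat p fun a b c => withRat q fun a' b' c' => withRat r fun a'' b'' c'' =>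
    (a * a' + b * b') * c'' + b'' * (c * c') ≐ (a * b' + b * a') * c'' + a'' * (c * c')

/-! ### Real numbers -/

/-- Type of codes of real numbers: sequences of (codes of) rationals. -/
abbrev Re : Type := Exp Ty.one

/-- Type of sequences of codes of real numbers. -/
abbrev ReSeq : Type := Exp (Ty.nat ⇒ Ty.one)

/-- Type of (representations of) functions from reals to reals. -/
abbrev ReFun : Type := Exp (Ty.one ⇒ Ty.one)

/-- `x ∈ ℝ`: `|x_n - x_{n+i}| < 1 / 2 ^ n` for all `n`, `i`. -/
def isReal (x : Re) : Form := allN fun n => allN fun i => ratNear (x ⬝ n) (x ⬝ (n + i)) n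

def exR (A : Re → Form) : Form := ex .one fun x => isReal x ⋏ A x
def allR (A : Re → Form) : Form := all .one fun x => isReal x ⇛ A x

/-- `x =_ℝ y`: `|x_n - y_n| ≤ 2 / 2 ^ n` for all `n`. -/
def eqR (x y : Re) : Form := allN fun n =>
  ratLeAdd (x ⬝ n) (y ⬝ n) (1 + 1) (pow2 n) ⋏ ratLeAdd (y ⬝ n) (x ⬝ n) (1 + 1) (pow2 n)

/-- `x ≤_ℝ y`: `x_n ≤ y_n + 2 / 2 ^ n` for all `n`. -/
def leR (x y : Re) : Form := allN fun n => ratLeAdd (x ⬝ n) (y ⬝ n) (1 + 1) (pow2 n)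

def ltR (x y : Re) : Form := neg (leR y x)

/-- The reals `0` and `1`, as constant sequences: `0` codes the rational `0`, and `5` codes the
rational `1`. -/
def zeroR : Re := con (.combPi .nat .nat) ⬝ 0
def oneR : Re := con (.combPi .nat .nat) ⬝ (1 + 1 + 1 + 1 + 1)

/-- `z =_ℝ x + y`: the rationals `x_n + y_n - z_n` tend to `0`. -/
def addR (x y z : Re) : Form := allN fun k => exN fun N => allN fun n => leN N n ⇛
  exN fun r => ratAdd (x ⬝ n) (y ⬝ n) r ⋏ ratNear r (z ⬝ n) k

/-- `z =_ℝ x y`: the rationals `x_n y_n - z_n` tend to `0`. -/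
def mulR (x y z : Re) : Form := allN fun k => exN fun N => allN fun n => leN N n ⇛
  exN fun r => ratMul (x ⬝ n) (y ⬝ n) r ⋏ ratNear r (z ⬝ n) k

/-- `x < y + e` and `x ≤ y + e`. -/
def ltAdd (x y e : Re) : Form := exR fun u => addR y e u ⋏ ltR x u
def leAdd (x y e : Re) : Form := exR fun u => addR y e u ⋏ leR x u

/-- `|x - y| < e`. -/
def near (x y e : Re) : Form := ltAdd x y e ⋏ ltAdd y x e

/-- `x ∈ [a, b]` for a real `x`. -/
def between (a x b : Re) : Form := leR a x ⋏ leR x b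

/-- `f : I → ℝ`, where `I = [0, 1]`: real values on `I`, equal at equal reals. -/
def isFunOnI (f : ReFun) : Form :=
  (allR fun x => between zeroR x oneR ⇛ isReal (f ⬝ x)) ⋏
  (allR fun x => allR fun y => between zeroR x oneR ⇛ between zeroR y oneR ⇛
    eqR x y ⇛ eqR (f ⬝ x) (f ⬝ y))

/-- `δ : ℝ → ℝ⁺`: positive real values on all reals, equal at equal reals. -/
def isGauge (δ : ReFun) : Form :=
  (allR fun x => isReal (δ ⬝ x) ⋏ ltR zeroR (δ ⬝ x)) ⋏
  (allR fun x => allR fun y => eqR x y ⇛ eqR (δ ⬝ x) (δ ⬝ y))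

/-! ### The Cousin lemma -/

/-- `HBU`: for every `Ψ : ℝ → ℝ⁺` there are finitely many reals `y_i`, `i < k`, such that every
`x ∈ I` lies in some `(y_i - Ψ(y_i), y_i + Ψ(y_i))`. -/
def HBU : Form :=
  all (.one ⇒ .one) fun Ψ => isGauge Ψ ⇛
    exN fun k => ex (.nat ⇒ .one) fun y => (allLt k fun i => isReal (y ⬝ i)) ⋏
      allR fun x => between zeroR x oneR ⇛
        exN fun i => i ≺ k ⋏ near x (y ⬝ i) (Ψ ⬝ (y ⬝ i))

/-! ### Riemann and gauge integrals -/

/-- `k`, `p`, `t` form a tagged partition of `[a, b]`: the intervals are `[p_i, p_{i+1}]` with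
tags `t_i`, for `i < k`, and `a = p_0 < p_1 < ⋯ < p_k = b`. -/
def isTaggedPartition (a b : Re) (k : NatE) (p t : ReSeq) : Form :=
  (allLe k fun i => isReal (p ⬝ i)) ⋏ (allLt k fun i => isReal (t ⬝ i)) ⋏
  eqR (p ⬝ 0) a ⋏ eqR (p ⬝ k) b ⋏
  (allLt k fun i => ltR (p ⬝ i) (p ⬝ (i + 1)) ⋏ between (p ⬝ i) (t ⬝ i) (p ⬝ (i + 1)))

/-- For all tagged partitions of `[a, b]`. -/
def allTP (a b : Re) (A : NatE → ReSeq → ReSeq → Form) : Form :=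
  allN fun k => all (.nat ⇒ .one) fun p => all (.nat ⇒ .one) fun t =>
    isTaggedPartition a b k p t ⇛ A k p t

/-- The partition is `δ`-fine: `[p_i, p_{i+1}] ⊆ [t_i - δ(t_i), t_i + δ(t_i)]` for `i < k`. -/
def isFine (δ : ReFun) (k : NatE) (p t : ReSeq) : Form :=
  allLt k fun i => allR fun y => between (p ⬝ i) y (p ⬝ (i + 1)) ⇛
    leAdd (t ⬝ i) y (δ ⬝ (t ⬝ i)) ⋏ leAdd y (t ⬝ i) (δ ⬝ (t ⬝ i))

/-- The mesh of the partition is at most `d`. -/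
def meshLe (d : Re) (k : NatE) (p : ReSeq) : Form :=
  allLt k fun i => leAdd (p ⬝ (i + 1)) (p ⬝ i) d

/-- `s` is the Riemann sum `∑_{i < k} f(t_i) (p_{i+1} - p_i)`, through the sequence `S` of its
partial sums. -/
def isRiemannSum (f : ReFun) (k : NatE) (p t : ReSeq) (s : Re) : Form :=
  ex (.nat ⇒ .one) fun S =>
    (allLe k fun i => isReal (S ⬝ i)) ⋏ eqR (S ⬝ 0) zeroR ⋏
    (allLt k fun i => exR fun l => exR fun m =>
      addR (p ⬝ i) l (p ⬝ (i + 1)) ⋏ mulR (f ⬝ (t ⬝ i)) l m ⋏ addR (S ⬝ i) m (S ⬝ (i + 1))) ⋏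
    eqR s (S ⬝ k)

/-- `|S(f, P) - A| < ε`. -/
def sumNear (f : ReFun) (k : NatE) (p t : ReSeq) (A ε : Re) : Form :=
  exR fun s => isRiemannSum f k p t s ⋏ near s A ε

/-- The real `A` is a Riemann integral of `f` on `[a, b]`. -/
def isRiemannIntegral (f : ReFun) (a b A : Re) : Form :=
  allR fun ε => ltR zeroR ε ⇛ exR fun δ => ltR zeroR δ ⋏
    allTP a b fun k p t => meshLe δ k p ⇛ sumNear f k p t A ε

/-- The real `A` is a gauge integral of `f` on `I`. -/
def isGaugeIntegral (f : ReFun) (A : Re) : Form :=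
  allR fun ε => ltR zeroR ε ⇛ ex (.one ⇒ .one) fun δ => isGauge δ ⋏
    allTP zeroR oneR fun k p t => isFine δ k p t ⇛ sumNear f k p t A ε

/-- `Φ : ℝ → (ℝ → ℝ⁺)` is a gauge modulus for `f` and the gauge integral `A`. -/
def isGaugeModulus (f : ReFun) (A : Re) (Φ : Exp (.one ⇒ .one ⇒ .one)) : Form :=
  (allR fun ε => isGauge (Φ ⬝ ε)) ⋏
  (allR fun ε => allR fun ε' => eqR ε ε' ⇛ allR fun x => eqR (Φ ⬝ ε ⬝ x) (Φ ⬝ ε' ⬝ x)) ⋏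
  (allR fun ε => ltR zeroR ε ⇛
    allTP zeroR oneR fun k p t => isFine (Φ ⬝ ε) k p t ⇛ sumNear f k p t A ε)

/-- `f` is gauge integrable on `I` with a modulus. -/
def gaugeIntegrableWithModulus (f : ReFun) : Form :=
  exR fun A => ex (.one ⇒ .one ⇒ .one) fun Φ => isGaugeModulus f A Φ

/-- `f` is Riemann integrable on `[x, 1]` for all `x ∈ (0, 1]`. -/
def riemannIntegrableOffZero (f : ReFun) : Form :=
  allR fun x => ltR zeroR x ⇛ leR x oneR ⇛ exR fun B => isRiemannIntegral f x oneR B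

/-- The Riemann integrals of `f` on `[x, 1]` tend to `L` as `x → 0+`. -/
def tendsToAtZero (f : ReFun) (L : Re) : Form :=
  allR fun ε => ltR zeroR ε ⇛ exR fun η => ltR zeroR η ⋏
    allR fun x => ltR zeroR x ⇛ ltR x η ⇛ leR x oneR ⇛
      allR fun B => isRiemannIntegral f x oneR B ⇛ near B L ε

/-- There is a function `f : I → ℝ` which is not gauge integrable with a modulus. -/
def notAllGaugeIntegrable : Form :=
  ex (.one ⇒ .one) fun f => isFunOnI f ⋏ neg (gaugeIntegrableWithModulus f)

/-- Hake's theorem: the limit of the Riemann integrals is the gauge integral. -/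
def hake : Form :=
  all (.one ⇒ .one) fun f => isFunOnI f ⇛ gaugeIntegrableWithModulus f ⇛
    riemannIntegrableOffZero f ⇛ allR fun A => isGaugeIntegral f A ⇛ tendsToAtZero f A

/-- The weak Hake theorem: the limit of the Riemann integrals exists. -/
def weakHake : Form :=
  all (.one ⇒ .one) fun f => isFunOnI f ⇛ gaugeIntegrableWithModulus f ⇛
    riemannIntegrableOffZero f ⇛ exR fun L => tendsToAtZero f L

end HigherOrderArithmetic

/-! Provability is replaced by truth in models. By the completeness theorem a sentence is provable
once it holds in every structure for the axioms (`completeness`), and dividing such a structure by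
extensional equality leaves only extensional models in which `=₀` is genuine equality
(`ACAProves_of_model`). So the three equivalences have to be shown in an arbitrary, possibly
non-standard, model `M`.

Inside `M`, induction is available only for predicates that have a characteristic function in `M`.
The functional `μ` makes these predicates closed under number quantifiers (`dec_exists`), so
arithmetical reasoning with parameters is at hand: search, least elements, primitive recursion,
limits, finite sums. To calculate with the reals of `M` as field elements, they are given values in
an ordered field built outside `M`: the fractions over the numbers of `M`, completed modulo
infinitesimals. The classes `Dec`, `Rep`, `RatRep` and `RealRep` record what remains definable
inside `M`, and the `Den` instances turn the formal sentences into statements about values.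

The analysis is then short. Suppose HBU holds. A finite subcover can be thinned out to a chain of
overlapping intervals (`exists_chain`), and cutting the overlaps gives fine tagged partitions of
`[a, 1]` of any prescribed mesh (`exists_fine`). Let `A` be a gauge integral of `f` with gauge `δ`.
For small `x` the interval `[0, x]` with tag `0` is `δ`-fine and contributes almost nothing. A
`δ`-fine partition of `[x, 1]` of small mesh has a sum near the Riemann integral `B`; with `[0, x]`
put in front, the sum is near `A`. Hence `B` is near `A`, which is Hake's theorem
(`hake_of_cousin`). The weak form follows because the integral is itself the limit.

Suppose HBU fails for `Ψ`. Then the gauge `Ψ / 2` has no fine partition at all, since the tags of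
one would give a finite subcover. So every function is vacuously gauge integrable with a modulus
(`gIntegrable_of_not_cousin`). The function `1 / x²`, with value `0` at `0`, has Riemann integrals
`1 / x - 1` on `[x, 1]`, which have no limit (`exists_not_tends`). So weak Hake fails without HBU.
With HBU, weak Hake shows that this same function is not gauge integrable with a modulus, which
gives the first equivalence. -/

namespace HigherOrderArithmetic

-- Syntax: substitution calculus, derivations, countability.

local infixr:60 " ⇒ " => Ty.arr

/-! ### Substitution -/

namespace Subst

/-- The identity substitution. -/
def ids : Subst := fun τ n => .var τ n

/-- First `s`, then `s'`. -/
def comp (s s' : Subst) : Subst := fun τ n => (s τ n).subst s'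

/-- `t` for the variable of type `σ` with index `0`, and `s` for the others. -/
def cons {σ : Ty} (t : Tm σ) (s : Subst) : Subst := fun τ n =>
  if h : τ = σ then
    match n with
    | 0 => h ▸ t
    | m + 1 => s τ m
  else s τ n

variable {σ τ : Ty}

@[simp] theorem cons_zero (t : Tm σ) (s : Subst) : cons t s σ 0 = t := by simp [cons]

@[simp] theorem cons_succ (t : Tm σ) (s : Subst) (m : ℕ) : cons t s σ (m + 1) = s σ m := by
  simp [cons]

theorem cons_ne (t : Tm σ) (s : Subst) (h : τ ≠ σ) (n : ℕ) : cons t s τ n = s τ n := by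
  simp [cons, h]

theorem single_eq_cons (t : Tm σ) : single t = cons t ids := by
  funext τ n
  by_cases h : τ = σ
  · subst h; cases n <;> simp [single, cons, ids]
  · simp [single, cons, ids, h]

@[simp] theorem lift_zero (s : Subst) : lift σ s σ 0 = .var σ 0 := by simp [lift]

@[simp] theorem lift_succ (s : Subst) (m : ℕ) :
    lift σ s σ (m + 1) = (s σ m).subst (raise σ) := by simp [lift]

theorem lift_ne (s : Subst) (h : τ ≠ σ) (n : ℕ) :
    lift σ s τ n = (s τ n).subst (raise σ) := by simp [lift, h]

@[simp] theorem raise_self (n : ℕ) : raise σ σ n = .var σ (n + 1) := by simp [raise]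

theorem raise_ne (h : τ ≠ σ) (n : ℕ) : raise σ τ n = .var τ n := by simp [raise, h]

end Subst

open Subst

theorem Tm.subst_subst {τ : Ty} (t : Tm τ) (s s' : Subst) :
    (t.subst s).subst s' = t.subst (s.comp s') := by
  induction t with
  | var => rfl
  | con => rfl
  | app f x hf hx => simp [Tm.subst, hf, hx]

@[simp] theorem Tm.subst_ids {τ : Ty} (t : Tm τ) : t.subst ids = t := by
  induction t with
  | var => rfl
  | con => rfl
  | app f x hf hx => simp [Tm.subst, hf, hx]

theorem Subst.ext_cases {σ : Ty} {s s' : Subst} (h0 : s σ 0 = s' σ 0)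
    (hs : ∀ n, s σ (n + 1) = s' σ (n + 1)) (hne : ∀ τ, τ ≠ σ → ∀ n, s τ n = s' τ n) :
    s = s' := by
  funext τ n
  by_cases h : τ = σ
  · subst h; cases n; exacts [h0, hs _]
  · exact hne τ h n

theorem Subst.raise_comp_lift (σ : Ty) (s : Subst) :
    (raise σ).comp (lift σ s) = s.comp (raise σ) := by
  funext τ n
  by_cases h : τ = σ
  · subst h; simp [comp, Tm.subst]
  · simp [comp, raise_ne h, Tm.subst, lift_ne s h]

theorem Subst.raise_comp_cons {σ : Ty} (t : Tm σ) (s : Subst) : (raise σ).comp (cons t s) = s := by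
  funext τ n
  by_cases h : τ = σ
  · subst h; simp [comp, Tm.subst]
  · simp [comp, raise_ne h, Tm.subst, cons_ne t s h]

@[simp] theorem Subst.comp_ids (s : Subst) : s.comp ids = s := by funext τ n; simp [comp]

@[simp] theorem Subst.ids_comp (s : Subst) : ids.comp s = s := rfl

theorem Subst.lift_comp (σ : Ty) (s s' : Subst) :
    lift σ (s.comp s') = (lift σ s).comp (lift σ s') := by
  refine ext_cases (σ := σ) ?_ (fun n => ?_) fun τ h n => ?_
  · simp [comp, Tm.subst]
  · simp only [lift_succ, comp, Tm.subst_subst, raise_comp_lift]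
  · simp only [lift_ne _ h, comp, Tm.subst_subst, raise_comp_lift]

@[simp] theorem Subst.lift_ids (σ : Ty) : lift σ ids = ids := by
  refine ext_cases (σ := σ) ?_ (fun n => ?_) fun τ h n => ?_
  · simp [ids]
  · simp [ids, Tm.subst]
  · simp [lift_ne _ h, ids, Tm.subst, raise_ne h]

theorem Subst.lift_comp_cons {σ : Ty} (s s' : Subst) (t : Tm σ) :
    (lift σ s).comp (cons t s') = cons t (s.comp s') := by
  refine ext_cases (σ := σ) ?_ (fun n => ?_) fun τ h n => ?_
  · simp [comp, Tm.subst]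
  · simp only [lift_succ, comp, Tm.subst_subst, raise_comp_cons, cons_succ]
  · simp only [lift_ne _ h, comp, Tm.subst_subst, raise_comp_cons, cons_ne _ _ h]

theorem Subst.cons_comp {σ : Ty} (s s' : Subst) (t : Tm σ) :
    (cons t s).comp s' = cons (t.subst s') (s.comp s') := by
  refine ext_cases (σ := σ) ?_ (fun n => ?_) fun τ h n => ?_
  · simp [comp]
  · simp [comp]
  · simp [comp, cons_ne _ _ h]

namespace Fm

theorem subst_subst (φ : Fm) (s s' : Subst) : (φ.subst s).subst s' = φ.subst (s.comp s') := by
  induction φ generalizing s s' with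
  | eq | lt => simp [subst, Tm.subst_subst]
  | bot => rfl
  | imp φ ψ hφ hψ => simp [subst, hφ, hψ]
  | all σ φ ih => simp [subst, ih, lift_comp]

@[simp] theorem subst_ids (φ : Fm) : φ.subst ids = φ := by
  induction φ with
  | eq | lt => simp [subst]
  | bot => rfl
  | imp φ ψ hφ hψ => simp [subst, hφ, hψ]
  | all σ φ ih => simp [subst, ih]

variable {σ : Ty}

theorem subst_lift_inst (φ : Fm) (s : Subst) (t : Tm σ) :
    (φ.subst (lift σ s)).inst t = φ.subst (cons t s) := by
  rw [inst, subst_subst, single_eq_cons, lift_comp_cons, comp_ids]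

theorem inst_subst (φ : Fm) (s : Subst) (t : Tm σ) :
    (φ.inst t).subst s = (φ.subst (lift σ s)).inst (t.subst s) := by
  rw [subst_lift_inst, inst, subst_subst, single_eq_cons, cons_comp, ids_comp]

theorem shift_subst_lift (φ : Fm) (s : Subst) :
    (φ.shift σ).subst (lift σ s) = (φ.subst s).shift σ := by
  simp only [shift, subst_subst, raise_comp_lift]

/-- A formula contains finitely many variables. -/
theorem exists_bound (φ : Fm) : ∃ N, ∀ s s' : Subst,
    (∀ τ, ∀ n < N, s τ n = s' τ n) → φ.subst s = φ.subst s' := by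
  have tm : ∀ {τ : Ty} (t : Tm τ), ∃ N, ∀ s s' : Subst,
      (∀ τ, ∀ n < N, s τ n = s' τ n) → t.subst s = t.subst s' := by
    intro τ t
    induction t with
    | var σ n => exact ⟨n + 1, fun s s' h => h _ _ (Nat.lt_succ_self n)⟩
    | con c => exact ⟨0, fun s s' _ => rfl⟩
    | app f x hf hx =>
      obtain ⟨N, hN⟩ := hf
      obtain ⟨N', hN'⟩ := hx
      refine ⟨max N N', fun s s' h => ?_⟩
      simp only [Tm.subst]
      rw [hN s s' fun τ n hn => h τ n (lt_max_of_lt_left hn),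
        hN' s s' fun τ n hn => h τ n (lt_max_of_lt_right hn)]
  induction φ with
  | eq a b | lt a b =>
    obtain ⟨N, hN⟩ := tm a
    obtain ⟨N', hN'⟩ := tm b
    refine ⟨max N N', fun s s' h => ?_⟩
    simp only [subst]
    rw [hN s s' fun τ n hn => h τ n (lt_max_of_lt_left hn),
      hN' s s' fun τ n hn => h τ n (lt_max_of_lt_right hn)]
  | bot => exact ⟨0, fun _ _ _ => rfl⟩
  | imp φ ψ hφ hψ =>
    obtain ⟨N, hN⟩ := hφ
    obtain ⟨N', hN'⟩ := hψ
    refine ⟨max N N', fun s s' h => ?_⟩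
    simp only [subst]
    rw [hN s s' fun τ n hn => h τ n (lt_max_of_lt_left hn),
      hN' s s' fun τ n hn => h τ n (lt_max_of_lt_right hn)]
  | all σ φ ih =>
    obtain ⟨N, hN⟩ := ih
    refine ⟨N, fun s s' h => ?_⟩
    simp only [subst]
    rw [hN]
    intro τ n hn
    by_cases hτ : τ = σ
    · subst hτ
      cases n with
      | zero => simp
      | succ n => simp [h τ n (Nat.lt_of_succ_lt hn)]
    · simp [lift_ne _ hτ, h τ n hn]

/-- A single bound for a whole context supplies fresh variables for generalization. -/
theorem exists_bound_list (Γ : List Fm) : ∃ N, ∀ φ ∈ Γ, ∀ s s' : Subst,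
    (∀ τ, ∀ n < N, s τ n = s' τ n) → φ.subst s = φ.subst s' := by
  induction Γ with
  | nil => exact ⟨0, by simp⟩
  | cons φ Γ ih =>
    obtain ⟨N, hN⟩ := ih
    obtain ⟨N', hN'⟩ := φ.exists_bound
    refine ⟨max N N', fun ψ hψ s s' h => ?_⟩
    rcases List.mem_cons.1 hψ with rfl | hψ
    · exact hN' s s' fun τ n hn => h τ n (lt_max_of_lt_right hn)
    · exact hN ψ hψ s s' fun τ n hn => h τ n (lt_max_of_lt_left hn)

end Fm

/-! ### Derivations -/

namespace Prf

variable {T : Set Fm} {Γ Δ : List Fm} {φ ψ : Fm}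

theorem weaken (h : Prf T Γ φ) (hΓ : Γ ⊆ Δ) : Prf T Δ φ := by
  induction h generalizing Δ with
  | ax h => exact .ax h
  | hyp h => exact .hyp (hΓ h)
  | impI _ ih => exact .impI (ih (List.cons_subset_cons _ hΓ))
  | impE _ _ ih ih' => exact .impE (ih hΓ) (ih' hΓ)
  | raa _ ih => exact .raa (ih (List.cons_subset_cons _ hΓ))
  | allI _ ih => exact .allI (ih (List.map_subset _ hΓ))
  | allE t _ ih => exact .allE t (ih hΓ)
  | eqRefl t => exact .eqRefl t
  | eqSubst χ s t _ _ ih ih' => exact .eqSubst χ s t (ih hΓ) (ih' hΓ)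

/-- Derivations are closed under substitution by induction; at a universal introduction the
substitution is lifted, and lifting commutes with the shift of the context. The axioms must be
closed as well, because they may contain free variables. -/
theorem subst (hT : ∀ A ∈ T, ∀ s : Subst, A.subst s ∈ T) (h : Prf T Γ φ) (s : Subst) :
    Prf T (Γ.map (Fm.subst s)) (φ.subst s) := by
  induction h generalizing s with
  | ax h => exact .ax (hT _ h s)
  | hyp h => exact .hyp (List.mem_map_of_mem h)
  | impI _ ih => exact .impI (ih s)
  | impE _ _ ih ih' => exact .impE (ih s) (ih' s)
  | raa _ ih => exact .raa (ih s)
  | @allI Γ σ χ _ ih =>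
    refine .allI ?_
    have := ih (lift σ s)
    rw [List.map_map] at this ⊢
    convert this using 2
    funext A
    exact (Fm.shift_subst_lift A s).symm
  | allE t _ ih => rw [Fm.inst_subst]; exact .allE _ (ih s)
  | eqRefl t => exact .eqRefl _
  | eqSubst χ a b _ _ ih ih' =>
    rw [Fm.inst_subst]
    exact .eqSubst _ (a.subst s) _ (ih s) (by rw [← Fm.inst_subst]; exact ih' s)

/-- Generalization on a variable that does not occur. -/
theorem generalize (hT : ∀ A ∈ T, ∀ s : Subst, A.subst s ∈ T) (Γ : List Fm) (σ : Ty) (φ : Fm) :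
    ∃ k, Prf T Γ (φ.inst (.var σ k)) → Prf T Γ (.all σ φ) := by
  obtain ⟨k, hk⟩ := Fm.exists_bound_list (φ :: Γ)
  refine ⟨k, fun h => .allI ?_⟩
  -- The index `k` exceeds all indices in use. Sending `k` to `0` and raising the other variables of
  -- this type acts on the context as the shift, and on the instance at variable `k` it restores
  -- `φ`.
  let s : Subst := fun τ n =>
    .var τ (if τ = σ then if n = k then 0 else n + 1 else n)
  have h1 := h.subst hT s
  have e1 : Γ.map (Fm.subst s) = Γ.map (Fm.shift σ) := by
    refine List.map_congr_left fun A hA => hk A (List.mem_cons_of_mem _ hA) _ _ fun τ n hn => ?_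
    simp only [s, raise]
    rw [if_neg hn.ne]
  have e2 : (φ.inst (.var σ k)).subst s = φ := by
    conv_rhs => rw [← φ.subst_ids]
    rw [Fm.inst, Fm.subst_subst]
    refine hk φ List.mem_cons_self _ _ fun τ n hn => ?_
    rw [single_eq_cons]
    by_cases h : τ = σ
    · subst h
      cases n with
      | zero => simp [comp, Tm.subst, s, ids]
      | succ n =>
        have : n ≠ k := by omega
        simp [comp, Tm.subst, s, ids, this]
    · simp [comp, cons_ne _ _ h, Tm.subst, s, ids, h]
  rwa [e1, e2] at h1

theorem cut (h : Prf T (φ :: Γ) ψ) (h' : Prf T Γ φ) : Prf T Γ ψ := .impE (.impI h) h'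

theorem exfalso (h : Prf T Γ .bot) : Prf T Γ φ := .raa (h.weaken (List.subset_cons_self _ _))

end Prf

/-! ### Countability of the language -/

/-- An injective numbering of the types. -/
def Ty.code : Ty → ℕ
  | .nat => 0
  | .arr σ τ => Nat.pair σ.code τ.code + 1

theorem Ty.code_injective : Function.Injective Ty.code := by
  intro σ
  induction σ with
  | nat => intro τ h; cases τ <;> simp_all [Ty.code]
  | arr σ σ' h1 h2 =>
    intro τ h
    cases τ with
    | nat => simp [Ty.code] at h
    | arr τ τ' =>
      simp only [Ty.code, Nat.add_right_cancel_iff, Nat.pair_eq_pair] at h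
      rw [h1 h.1, h2 h.2]

instance : Countable Ty := Ty.code_injective.countable

instance (σ : Ty) : Countable (Con σ) := by
  let f : Con σ → ℕ × List Ty := fun c => match c with
    | .zero => (0, [])
    | .one => (1, [])
    | .add => (2, [])
    | .mul => (3, [])
    | .combPi ρ σ => (4, [ρ, σ])
    | .combSigma ρ σ τ => (5, [ρ, σ, τ])
    | .recursor σ => (6, [σ])
  refine (?_ : Function.Injective f).countable
  intro a b h
  cases a <;> cases b <;> simp_all [f]

/-- Terms of all types are counted together, since the argument type of an application is not
visible in its own type. The stages bound the depth of the terms. -/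
theorem countable_setOf_tm :
    Countable (Σ σ, Tm σ) := by
  let S : ℕ → Set (Σ σ, Tm σ) := fun n => n.rec
    (Set.range (fun p : Ty × ℕ => ⟨p.1, .var p.1 p.2⟩) ∪
      Set.range (fun p : Σ σ, Con σ => ⟨p.1, .con p.2⟩))
    (fun _ A => A ∪ {x | ∃ (σ τ : Ty) (f : Tm (σ ⇒ τ)) (y : Tm σ),
      (⟨_, f⟩ : Σ σ, Tm σ) ∈ A ∧ (⟨_, y⟩ : Σ σ, Tm σ) ∈ A ∧ x = ⟨τ, .app f y⟩})
  have hS : ∀ n, (S n).Countable := by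
    intro n
    induction n with
    | zero => exact (Set.countable_range _).union (Set.countable_range _)
    | succ n ih =>
      refine ih.union ?_
      classical
      -- Application as a total map on pairs; ill-typed pairs get an irrelevant value.
      let g : (Σ σ, Tm σ) × (Σ σ, Tm σ) → Σ σ, Tm σ := fun p =>
        match p with
        | (⟨.arr σ τ, f⟩, ⟨σ', y⟩) => if h : σ' = σ then ⟨τ, .app f (h ▸ y)⟩ else ⟨σ', y⟩
        | (_, x) => x
      refine ((ih.prod ih).image g).mono ?_
      rintro _ ⟨σ, τ, f, y, hf, hy, rfl⟩
      exact ⟨(⟨_, f⟩, ⟨_, y⟩), ⟨hf, hy⟩, by simp [g]⟩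
  have mono : ∀ m n, m ≤ n → S m ⊆ S n := fun m n h =>
    monotone_nat_of_le_succ (f := S) (fun n => Set.subset_union_left) h
  have all : ∀ {σ} (t : Tm σ), ∃ n, (⟨σ, t⟩ : Σ σ, Tm σ) ∈ S n := by
    intro σ t
    induction t with
    | var σ n => exact ⟨0, .inl ⟨(σ, n), rfl⟩⟩
    | con c => exact ⟨0, .inr ⟨⟨_, c⟩, rfl⟩⟩
    | app f x hf hx =>
      obtain ⟨m, hm⟩ := hf
      obtain ⟨n, hn⟩ := hx
      exact ⟨max m n + 1, .inr ⟨_, _, f, x, mono _ _ (le_max_left _ _) hm,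
        mono _ _ (le_max_right _ _) hn, rfl⟩⟩
  rw [← Set.countable_univ_iff]
  refine (Set.countable_iUnion hS).mono fun x _ => ?_
  exact Set.mem_iUnion.2 (all x.2)

instance (σ : Ty) : Countable (Tm σ) :=
  have := countable_setOf_tm
  (sigma_mk_injective (β := Tm) (i := σ)).countable

instance : Countable Fm := by
  let S : ℕ → Set Fm := fun n => n.rec
    (insert .bot (Set.range (fun p : Tm .nat × Tm .nat => .eq p.1 p.2) ∪
      Set.range (fun p : Tm .nat × Tm .nat => .lt p.1 p.2)))
    (fun _ A => A ∪ ((fun p : Fm × Fm => .imp p.1 p.2) '' A ×ˢ A ∪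
      (fun p : Ty × Fm => .all p.1 p.2) '' Set.univ ×ˢ A))
  have hS : ∀ n, (S n).Countable := by
    intro n
    induction n with
    | zero => exact ((Set.countable_range _).union (Set.countable_range _)).insert _
    | succ n ih =>
      exact ih.union (((ih.prod ih).image _).union ((Set.countable_univ.prod ih).image _))
  have mono : ∀ m n, m ≤ n → S m ⊆ S n := fun m n h =>
    monotone_nat_of_le_succ (f := S) (fun n => Set.subset_union_left) h
  have all : ∀ φ : Fm, ∃ n, φ ∈ S n := by
    intro φ
    induction φ with
    | eq a b => exact ⟨0, .inr (.inl ⟨(a, b), rfl⟩)⟩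
    | lt a b => exact ⟨0, .inr (.inr ⟨(a, b), rfl⟩)⟩
    | bot => exact ⟨0, .inl rfl⟩
    | imp φ ψ hφ hψ =>
      obtain ⟨m, hm⟩ := hφ
      obtain ⟨n, hn⟩ := hψ
      exact ⟨max m n + 1, .inr (.inl ⟨(φ, ψ), ⟨mono _ _ (le_max_left _ _) hm,
        mono _ _ (le_max_right _ _) hn⟩, rfl⟩)⟩
    | all σ φ ih =>
      obtain ⟨n, hn⟩ := ih
      exact ⟨n + 1, .inr (.inr ⟨(σ, φ), ⟨trivial, hn⟩, rfl⟩)⟩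
  rw [← Set.countable_univ_iff]
  refine (Set.countable_iUnion hS).mono fun x _ => ?_
  exact Set.mem_iUnion.2 (all x)

end HigherOrderArithmetic

/-! ### Completeness, and closure of the axioms under substitution. -/

namespace HigherOrderArithmetic

local infixr:60 " ⇒ " => Ty.arr

open Subst

/-! ### Structures and the completeness theorem -/

/-- A structure for the language of all finite types, with an interpretation `eqv` of `=₀`. -/
structure PreStr where
  D : Ty → Type
  app : ∀ {σ τ : Ty}, D (σ ⇒ τ) → D σ → D τ
  con : ∀ {σ : Ty}, Con σ → D σ
  eqv : D .nat → D .nat → Prop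
  lt : D .nat → D .nat → Prop

namespace PreStr

variable (S : PreStr)

/-- Assignments of values to the variables. -/
abbrev Env : Type := ∀ σ : Ty, ℕ → S.D σ

variable {S}

/-- The assignment `v` with the new value `a` for the variable of type `σ` with index `0`. -/
def Env.cons (v : S.Env) (σ : Ty) (a : S.D σ) : S.Env := fun τ n =>
  if h : τ = σ then
    match n with
    | 0 => h ▸ a
    | m + 1 => v τ m
  else v τ n

/-- The value of a term. -/
def eval (v : S.Env) : {τ : Ty} → Tm τ → S.D τ
  | _, .var τ n => v τ n
  | _, .con c => S.con c
  | _, .app f x => S.app (eval v f) (eval v x)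

/-- Truth of a formula. -/
def Sat (v : S.Env) : Fm → Prop
  | .eq s t => S.eqv (eval v s) (eval v t)
  | .lt s t => S.lt (eval v s) (eval v t)
  | .bot => False
  | .imp φ ψ => Sat v φ → Sat v ψ
  | .all σ φ => ∀ a, Sat (v.cons σ a) φ

@[simp] theorem Env.cons_zero (v : S.Env) (σ : Ty) (a : S.D σ) : v.cons σ a σ 0 = a := by
  simp [Env.cons]

@[simp] theorem Env.cons_succ (v : S.Env) (σ : Ty) (a : S.D σ) (n : ℕ) :
    v.cons σ a σ (n + 1) = v σ n := by
  simp [Env.cons]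

theorem Env.cons_ne (v : S.Env) {σ τ : Ty} (a : S.D σ) (h : τ ≠ σ) (n : ℕ) :
    v.cons σ a τ n = v τ n := by
  simp [Env.cons, h]

theorem eval_subst (v : S.Env) (s : Subst) {τ : Ty} (t : Tm τ) :
    eval v (t.subst s) = eval (fun σ n => eval v (s σ n)) t := by
  induction t with
  | var => rfl
  | con => rfl
  | app f x hf hx => simp [Tm.subst, eval, hf, hx]

theorem Env.ext_cases {σ : Ty} {v w : S.Env} (h0 : v σ 0 = w σ 0)
    (hs : ∀ n, v σ (n + 1) = w σ (n + 1)) (hne : ∀ τ, τ ≠ σ → ∀ n, v τ n = w τ n) : v = w := by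
  funext τ n
  by_cases h : τ = σ
  · subst h; cases n; exacts [h0, hs _]
  · exact hne τ h n

theorem eval_raise (v : S.Env) {σ : Ty} (a : S.D σ) {τ : Ty} (t : Tm τ) :
    eval (v.cons σ a) (t.subst (raise σ)) = eval v t := by
  rw [eval_subst]
  congr 1
  funext τ n
  by_cases h : τ = σ
  · subst h; simp [eval]
  · simp [raise_ne h, eval, Env.cons_ne _ _ h]

theorem sat_subst (v : S.Env) (s : Subst) (φ : Fm) :
    Sat v (φ.subst s) ↔ Sat (fun σ n => eval v (s σ n)) φ := by
  induction φ generalizing v s with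
  | eq | lt => simp [Fm.subst, Sat, eval_subst]
  | bot => rfl
  | imp φ ψ hφ hψ => simp [Fm.subst, Sat, hφ, hψ]
  | all σ φ ih =>
    simp only [Fm.subst, Sat, ih]
    refine forall_congr' fun a => iff_of_eq (congrArg (fun w => Sat w φ) ?_)
    refine Env.ext_cases (σ := σ) ?_ (fun n => ?_) fun τ h n => ?_
    · simp [eval]
    · simp [eval_raise]
    · simp [lift_ne _ h, eval_raise, Env.cons_ne _ _ h]

theorem sat_inst (v : S.Env) {σ : Ty} (φ : Fm) (t : Tm σ) :
    Sat v (φ.inst t) ↔ Sat (v.cons σ (eval v t)) φ := by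
  rw [Fm.inst, sat_subst, single_eq_cons]
  refine iff_of_eq (congrArg (fun w => Sat w φ) ?_)
  refine Env.ext_cases (σ := σ) ?_ (fun n => ?_) fun τ h n => ?_
  · simp
  · simp [eval, ids]
  · simp [Subst.cons_ne _ _ h, eval, Env.cons_ne _ _ h, ids]

end PreStr

/-- A maximal consistent set of formulas with witnesses. -/
structure Henkin (T : Set Fm) (H : Set Fm) : Prop where
  closed : ∀ Γ φ, (∀ A ∈ Γ, A ∈ H) → Prf T Γ φ → φ ∈ H
  consistent : .bot ∉ H
  complete : ∀ A, A ∈ H ∨ A.neg ∈ H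
  witness : ∀ (σ : Ty) A, .all σ A ∈ H ∨ ∃ t : Tm σ, (A.inst t).neg ∈ H

/-- One Lindenbaum step, which decides `A`. When a universal formula is refuted, a counterexample is
named by a fresh variable: if the negated instance were inconsistent, `Prf.generalize` would prove
the universal formula. A context is finite at each stage, so fresh variables never run out and no
new constants are needed. -/
theorem exists_henkin_step {T : Set Fm} (hT : ∀ A ∈ T, ∀ s : Subst, A.subst s ∈ T)
    {Γ : List Fm} (hΓ : ¬ Prf T Γ .bot) (A : Fm) :
    ∃ Γ', Γ ⊆ Γ' ∧ ¬ Prf T Γ' .bot ∧ (A ∈ Γ' ∨ A.neg ∈ Γ') ∧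
      ∀ (σ : Ty) B, A = .all σ B → A ∈ Γ' ∨ ∃ t : Tm σ, (B.inst t).neg ∈ Γ' := by
  by_cases hA : Prf T (A :: Γ) .bot
  · have hn : ¬ Prf T (A.neg :: Γ) .bot := fun h => hΓ (hA.cut (.raa h))
    by_cases hall : ∃ (σ : Ty) (B : Fm), A = .all σ B
    · obtain ⟨σ, B, rfl⟩ := hall
      obtain ⟨k, hk⟩ := Prf.generalize hT ((Fm.all σ B).neg :: Γ) σ B
      refine ⟨(B.inst (.var σ k)).neg :: (Fm.all σ B).neg :: Γ, ?_, fun h => ?_, ?_, ?_⟩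
      · exact fun x hx => by simp [hx]
      · exact hn (.impE (.hyp List.mem_cons_self) (hk (.raa h)))
      · simp
      · intro σ' B' h
        cases h
        exact .inr ⟨_, List.mem_cons_self⟩
    · exact ⟨A.neg :: Γ, fun x hx => by simp [hx], hn, by simp,
        fun σ B h => (hall ⟨σ, B, h⟩).elim⟩
  · exact ⟨A :: Γ, fun x hx => by simp [hx], hA, by simp, by simp⟩

/-- The steps run through an enumeration of all formulas. Any finite set of hypotheses from the
union lies in one stage, so consistency passes to the limit. -/
theorem exists_henkin {T : Set Fm} (hT : ∀ A ∈ T, ∀ s : Subst, A.subst s ∈ T)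
    {Γ : List Fm} (hΓ : ¬ Prf T Γ .bot) : ∃ H, Henkin T H ∧ ∀ A ∈ Γ, A ∈ H := by
  have : Nonempty Fm := ⟨.bot⟩
  obtain ⟨e, he⟩ := exists_surjective_nat Fm
  choose f hf1 hf2 hf3 hf4 using
    fun (Γ : {Γ // ¬ Prf T Γ .bot}) (A : Fm) => exists_henkin_step hT Γ.2 A
  let G : ℕ → {Γ // ¬ Prf T Γ .bot} := fun n =>
    n.rec ⟨Γ, hΓ⟩ (fun n Δ => ⟨f Δ (e n), hf2 Δ (e n)⟩)
  have mono : ∀ m n, m ≤ n → (G m).1 ⊆ (G n).1 := fun m n h =>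
    Nat.le_induction (fun _ h => h) (fun n _ ih => List.Subset.trans ih (hf1 (G n) (e n))) n h
  have mem : ∀ Δ : List Fm, (∀ A ∈ Δ, ∃ n, A ∈ (G n).1) → ∃ n, Δ ⊆ (G n).1 := by
    intro Δ
    induction Δ with
    | nil => exact fun _ => ⟨0, by simp⟩
    | cons A Δ ih =>
      intro h
      obtain ⟨n, hn⟩ := ih fun A hA => h A (List.mem_cons_of_mem _ hA)
      obtain ⟨m, hm⟩ := h A List.mem_cons_self
      refine ⟨max m n, List.cons_subset.2
        ⟨mono _ _ (le_max_left _ _) hm, List.Subset.trans hn (mono _ _ (le_max_right _ _))⟩⟩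
  have cmp : ∀ A, A ∈ {A | ∃ n, A ∈ (G n).1} ∨ A.neg ∈ {A | ∃ n, A ∈ (G n).1} := fun A => by
    obtain ⟨n, rfl⟩ := he A
    exact (hf3 (G n) (e n)).imp (fun h => ⟨n + 1, h⟩) (fun h => ⟨n + 1, h⟩)
  have bot : .bot ∉ {A | ∃ n, A ∈ (G n).1} := fun ⟨n, h⟩ => (G n).2 (.hyp h)
  refine ⟨{A | ∃ n, A ∈ (G n).1}, ⟨fun Δ φ hΔ hφ => ?_, bot, cmp, fun σ A => ?_⟩,
    fun A hA => ⟨0, hA⟩⟩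
  · refine (cmp φ).resolve_right fun hn => ?_
    obtain ⟨n, h⟩ := mem (φ.neg :: Δ) (List.forall_mem_cons.2 ⟨hn, hΔ⟩)
    rw [List.cons_subset] at h
    exact (G n).2 (.impE (.hyp h.1) (hφ.weaken h.2))
  · obtain ⟨n, hn⟩ := he (.all σ A)
    exact (hf4 (G n) (e n) σ A hn).imp (fun h => ⟨n + 1, hn ▸ h⟩)
      fun ⟨t, h⟩ => ⟨t, n + 1, h⟩

namespace Henkin

variable {T H : Set Fm}

/-- The structure of terms. -/
def termStr (H : Set Fm) : PreStr where
  D := Tm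
  app := .app
  con := .con
  eqv s t := .eq s t ∈ H
  lt s t := .lt s t ∈ H

theorem eval_termStr (v : (termStr H).Env) {τ : Ty} (t : Tm τ) :
    PreStr.eval v t = t.subst v := by
  induction t with
  | var => rfl
  | con => rfl
  | app f x hf hx => simp only [PreStr.eval, hf, hx]; rfl

/-- The truth lemma. An assignment in the term structure is literally a substitution. Implication
uses that every formula is decided by `H`, and the universal quantifier uses the witnesses. -/
theorem sat_termStr (hH : Henkin T H) (φ : Fm) (v : (termStr H).Env) :
    PreStr.Sat v φ ↔ φ.subst v ∈ H := by
  induction φ generalizing v with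
  | eq | lt => simp only [PreStr.Sat, eval_termStr]; rfl
  | bot => exact ⟨False.elim, hH.consistent⟩
  | imp φ ψ hφ hψ =>
    simp only [PreStr.Sat, hφ, hψ, Fm.subst]
    constructor
    · intro h
      rcases hH.complete (φ.subst v) with h1 | h1
      · exact hH.closed [ψ.subst v] _ (by simpa using h h1) (.impI (.hyp (by simp)))
      · refine hH.closed [(φ.subst v).neg] _ (by simpa using h1) (.impI (.exfalso ?_))
        exact .impE (.hyp (φ := (φ.subst v).neg) (by simp)) (.hyp (by simp))
    · intro h h1
      refine hH.closed [φ.subst v, .imp (φ.subst v) (ψ.subst v)] _ ?_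
        (.impE (φ := φ.subst v) (.hyp (by simp)) (.hyp (by simp)))
      simp [h, h1]
  | all σ φ ih =>
    have key : ∀ t : Tm σ, PreStr.Sat (PreStr.Env.cons v σ t) φ ↔
        (φ.subst (lift σ v)).inst t ∈ H := fun t =>
      (ih _).trans (iff_of_eq (congrArg (· ∈ H) (Fm.subst_lift_inst φ v t).symm))
    simp only [PreStr.Sat, Fm.subst]
    constructor
    · intro h
      refine (hH.witness σ _).resolve_right ?_
      rintro ⟨t, ht⟩
      refine hH.consistent (hH.closed [(φ.subst (lift σ v)).inst t,
        ((φ.subst (lift σ v)).inst t).neg] _ ?_ (.impE (.hyp ?_) (.hyp List.mem_cons_self)))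
      · simp [ht, (key t).1 (h t)]
      · exact List.mem_cons_of_mem _ List.mem_cons_self
    · intro h t
      exact (key t).2 (hH.closed [.all σ (φ.subst (lift σ v))] _ (by simpa using h)
        (.allE t (.hyp (by simp))))

end Henkin

/-- The laws of equality, for the interpretation of `=₀`. -/
def PreStr.EqvSubst (S : PreStr) : Prop :=
  (∀ a, S.eqv a a) ∧
    ∀ (v : S.Env) (φ : Fm) (a b : S.D .nat), S.eqv a b → S.Sat (v.cons _ a) φ → S.Sat (v.cons _ b) φ

/-- The completeness theorem. -/
theorem completeness {T : Set Fm} (hT : ∀ A ∈ T, ∀ s : Subst, A.subst s ∈ T) (φ : Fm)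
    (h : ∀ S : PreStr, S.EqvSubst → (∀ A ∈ T, ∀ v, S.Sat v A) → ∀ v, S.Sat v φ) :
    Prf T [] φ := by
  by_contra hφ
  obtain ⟨H, hH, hmem⟩ := exists_henkin hT fun h : Prf T [φ.neg] .bot => hφ (.raa h)
  refine hH.consistent (hH.closed [φ, φ.neg] _ ?_
    (.impE (.hyp (List.mem_cons_of_mem _ List.mem_cons_self)) (.hyp List.mem_cons_self)))
  -- Truth of an axiom under `v` means membership of its substitution instance, so closure of the
  -- axioms under substitution is used here again.
  have hax : ∀ A ∈ T, ∀ v, (Henkin.termStr H).Sat v A := fun A hA v =>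
    (hH.sat_termStr A v).2 (hH.closed [] _ (by simp) (.ax (hT A hA v)))
  have heq : (Henkin.termStr H).EqvSubst := by
    refine ⟨fun a => hH.closed [] _ (by simp) (.eqRefl a), fun v ψ a b hab ha => ?_⟩
    have key : ∀ c : Tm .nat, (Henkin.termStr H).Sat (v.cons _ c) ψ ↔
        (ψ.subst (lift .nat v)).inst c ∈ H := fun c =>
      (hH.sat_termStr _ _).trans (iff_of_eq (congrArg (· ∈ H) (Fm.subst_lift_inst ψ v c).symm))
    refine (key b).2 (hH.closed [.eq a b, (ψ.subst (lift .nat v)).inst a] _ ?_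
      (.eqSubst _ a b (.hyp (by simp)) (.hyp (by simp))))
    have h1 : Fm.eq a b ∈ H := hab
    have h2 := (key a).1 ha
    simp [h1, h2]
  have := (hH.sat_termStr φ ids).1 (h _ heq hax ids)
  simp only [Fm.subst_ids] at this
  simp [this, hmem]

/-! ### The axioms are closed under substitution -/

/-- The substitution leaves the variables with indices below `d` alone. -/
def FixLt (d : Ty → ℕ) (s : Subst) : Prop := ∀ τ, ∀ n < d τ, s τ n = .var τ n

theorem FixLt.lift {d : Ty → ℕ} {s : Subst} (h : FixLt d s) (σ : Ty) :
    FixLt (Function.update d σ (d σ + 1)) (Subst.lift σ s) := by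
  intro τ n hn
  by_cases hτ : τ = σ
  · subst hτ
    cases n with
    | zero => simp
    | succ n =>
      simp only [Function.update_self] at hn
      simp [h τ n (by omega), Tm.subst]
  · rw [Function.update_of_ne hτ] at hn
    simp [lift_ne _ hτ, h τ n hn, Tm.subst, raise_ne hτ]

/-- The expression contains only variables that are bound at depth `d`. -/
def Exp.Stable {σ : Ty} (d : Ty → ℕ) (x : Exp σ) : Prop :=
  ∀ e, d ≤ e → ∀ s, FixLt e s → (x e).subst s = x e

/-- The formula contains only variables that are bound at depth `d`. -/
def Form.Stable (d : Ty → ℕ) (A : Form) : Prop :=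
  ∀ e, d ≤ e → ∀ s, FixLt e s → (A e).subst s = A e

section Stable

variable {d : Ty → ℕ} {σ τ : Ty}

theorem Exp.Stable.mono {d' : Ty → ℕ} {x : Exp σ} (h : x.Stable d) (hd : d ≤ d') : x.Stable d' :=
  fun e he => h e (hd.trans he)

theorem stable_con (c : Con σ) : (con c).Stable d := fun _ _ _ _ => rfl

theorem stable_app {f : Exp (σ ⇒ τ)} {x : Exp σ} (hf : f.Stable d) (hx : x.Stable d) :
    (app f x).Stable d := fun e he s hs => by
  simp [app, Tm.subst, hf e he s hs, hx e he s hs]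

theorem stable_zero : (0 : Exp .nat).Stable d := stable_con _
theorem stable_one : (1 : Exp .nat).Stable d := stable_con _

theorem stable_add {x y : Exp .nat} (hx : x.Stable d) (hy : y.Stable d) : (x + y).Stable d :=
  stable_app (stable_app (stable_con _) hx) hy

theorem stable_mul {x y : Exp .nat} (hx : x.Stable d) (hy : y.Stable d) : (x * y).Stable d :=
  stable_app (stable_app (stable_con _) hx) hy

theorem stable_eqN {x y : Exp .nat} (hx : x.Stable d) (hy : y.Stable d) :
    (eqN x y).Stable d := fun e he s hs => by
  simp [eqN, Fm.subst, hx e he s hs, hy e he s hs]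

theorem stable_ltN {x y : Exp .nat} (hx : x.Stable d) (hy : y.Stable d) :
    (ltN x y).Stable d := fun e he s hs => by
  simp [ltN, Fm.subst, hx e he s hs, hy e he s hs]

theorem stable_bot : bot.Stable d := fun _ _ _ _ => rfl

theorem stable_imp {A B : Form} (hA : A.Stable d) (hB : B.Stable d) : (imp A B).Stable d :=
  fun e he s hs => by simp [imp, Fm.subst, hA e he s hs, hB e he s hs]

theorem stable_neg {A : Form} (hA : A.Stable d) : (neg A).Stable d := stable_imp hA stable_bot

/-- The bound variable is stable only beneath its own quantifier, so the body is tested on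
expressions stable at greater depths. There its index lies below the depth, where the substitutions
in question act trivially. -/
theorem stable_all {A : Exp σ → Form}
    (hA : ∀ x d', d ≤ d' → x.Stable d' → (A x).Stable d') : (all σ A).Stable d := by
  intro e he s hs
  simp only [all, Fm.subst]
  congr 1
  have hx : Exp.Stable (Function.update e σ (e σ + 1))
      (fun e' => .var σ (e' σ - (e σ + 1)) : Exp σ) := fun e' he' s' hs' => by
    have := he' σ
    simp only [Function.update_self] at this
    exact hs' _ _ (by omega)
  refine hA _ _ (he.trans fun τ => ?_) hx _ le_rfl _ (hs.lift σ)
  by_cases h : τ = σ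
  · subst h; simp
  · simp [h]

theorem stable_ex {A : Exp σ → Form}
    (hA : ∀ x d', d ≤ d' → x.Stable d' → (A x).Stable d') : (ex σ A).Stable d :=
  stable_neg (stable_all fun x d' hd hx => stable_neg (hA x d' hd hx))

theorem stable_eqAt (τ : Ty) {d : Ty → ℕ} {x y : Exp τ} (hx : x.Stable d) (hy : y.Stable d) :
    (eqAt τ x y).Stable d := by
  induction τ generalizing d with
  | nat => exact stable_eqN hx hy
  | arr σ τ _ ih =>
    exact stable_all fun z d' hd hz =>
      ih (stable_app (hx.mono hd) hz) (stable_app (hy.mono hd) hz)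

theorem Form.Stable.subst {A : Form} (h : A.Stable fun _ => 0) (s : Subst) :
    A.toFm.subst s = A.toFm :=
  h _ le_rfl s fun _ _ hn => (Nat.not_lt_zero _ hn).elim

end Stable

theorem Fm.IsQF.subst {φ : Fm} (h : φ.IsQF) (s : Subst) : (φ.subst s).IsQF := by
  induction φ with
  | eq | lt | bot => trivial
  | imp φ ψ hφ hψ => exact ⟨hφ h.1, hψ h.2⟩
  | all => exact h.elim

/-- A schema is closed under substitution only as a family: substituting for the parameters gives
the induction axiom of another formula. The point is that the lifted substitution commutes with `n ↦
n + 1`. -/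
theorem inductionFm_subst (A : Fm) (s : Subst) :
    (inductionFm A).subst s = inductionFm (A.subst (lift .nat s)) := by
  have : (A.subst Subst.succ).subst (lift .nat s) =
      (A.subst (lift .nat s)).subst Subst.succ := by
    rw [Fm.subst_subst, Fm.subst_subst]
    congr 1
    have h1 : ∀ τ, τ ≠ .nat → ∀ n, Subst.succ τ n = .var τ n := fun τ h n => by
      cases τ <;> simp [Subst.succ] at h ⊢
    have h2 : (raise .nat).comp Subst.succ = raise .nat := by
      refine ext_cases (σ := .nat) ?_ (fun n => ?_) fun τ h n => ?_
      · simp [comp, Tm.subst, Subst.succ]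
      · simp [comp, Tm.subst, Subst.succ]
      · simp [comp, Tm.subst, h1 τ h, raise_ne h]
    refine ext_cases (σ := .nat) ?_ (fun n => ?_) fun τ h n => ?_
    · simp [comp, Tm.subst, Subst.succ]
    · simp only [comp, lift_succ, Tm.subst_subst, h2]
      simp [Subst.succ, Tm.subst]
    · simp only [comp, h1 τ h, Tm.subst, lift_ne _ h, Tm.subst_subst, h2]
  simp only [inductionFm, Fm.subst, Fm.inst_subst, this]
  rfl

theorem choiceFm_subst (A : Fm) (s : Subst) :
    (choiceFm A).subst s = choiceFm (A.subst (lift .nat (lift .one s))) := by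
  simp only [choiceFm, Fm.subst, Fm.ex, Fm.neg, Fm.inst_subst, Fm.shift, Fm.subst_subst]
  have e1 : Ty.one ≠ Ty.two := by decide
  have e2 : Ty.nat ≠ Ty.two := by decide
  have e3 : Ty.nat ≠ Ty.one := by decide
  -- The shift that makes room for the choice functional commutes with the lifts over `x` and `y`,
  -- because the three types are distinct.
  have key : (raise Ty.two).comp (lift .nat (lift .one (lift .two s))) =
      (lift .nat (lift .one s)).comp (raise .two) := by
    have hr : ∀ t : Subst, ∀ τ n, (if τ = Ty.two then n + 1 else n) = n ∨ τ = Ty.two := by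
      intro _ τ n; by_cases h : τ = Ty.two <;> simp [h]
    funext τ n
    by_cases h0 : τ = .nat
    · subst h0
      cases n with
      | zero => simp [comp, Tm.subst, raise_ne e2]
      | succ n =>
        simp only [comp, Tm.subst, raise_ne e2, lift_succ, lift_ne _ e3, lift_ne _ e2,
          Tm.subst_subst]
        congr 1
        funext τ n
        simp only [comp, Tm.subst, raise]
        split_ifs <;> simp_all
    by_cases h1 : τ = .one
    · subst h1
      cases n with
      | zero =>
        simp [comp, Tm.subst, raise_ne e1, lift_ne _ e3.symm, raise_ne e3.symm]
      | succ n =>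
        simp only [comp, Tm.subst, raise_ne e1, lift_succ, lift_ne _ e3.symm, lift_ne _ e1,
          Tm.subst_subst]
        congr 1
        funext τ n
        simp only [comp, Tm.subst, raise]
        split_ifs <;> simp_all
    have : ∀ n, lift .nat (lift .one s) τ n = ((s τ n).subst (raise .one)).subst (raise .nat) :=
      fun n => by rw [lift_ne _ h0, lift_ne _ h1]
    have h' : ∀ n, lift .nat (lift .one (lift .two s)) τ n =
        ((lift .two s τ n).subst (raise .one)).subst (raise .nat) :=
      fun n => by rw [lift_ne _ h0, lift_ne _ h1]
    by_cases h2 : τ = .two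
    · subst h2
      simp only [comp, Tm.subst, raise_self, h', this, lift_succ, Tm.subst_subst]
      congr 1
      funext τ n
      simp only [comp, Tm.subst, raise]
      split_ifs <;> simp_all
    · simp only [comp, Tm.subst, raise_ne h2, h', this, lift_ne _ h2, Tm.subst_subst]
      congr 1
      funext τ n
      simp only [comp, Tm.subst, raise]
      split_ifs <;> simp_all
  have e4 : (Tm.app (.var .two 0) (.var .one 0) : Tm .nat).subst (lift .one (lift .two s)) =
      .app (.var .two 0) (.var .one 0) := by
    simp [Tm.subst, lift_ne _ e1.symm, raise_ne e1.symm]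
  rw [key, e4]

/-- The single axioms are sentences and do not change; induction and choice go to other instances
for quantifier-free formulas. -/
theorem ACA_subst (A : Fm) (hA : A ∈ ACA) (s : Subst) : A.subst s ∈ ACA := by
  rcases hA with hA | rfl
  · left
    cases hA with
    | basic h =>
      rw [Form.Stable.subst]
      · exact .basic h
      · cases h <;>
        · repeat first
            | assumption
            | exact stable_zero
            | exact stable_one
            | refine stable_all fun _ _ _ _ => ?_
            | apply stable_neg
            | apply stable_eqN
            | apply stable_ltN
            | apply stable_imp
            | apply stable_iff
            | apply stable_or
            | apply stable_add
            | apply stable_mul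
            | (refine Exp.Stable.mono (by assumption) ?_; assumption)
    | combPi ρ σ =>
      rw [Form.Stable.subst]
      · exact .combPi ρ σ
      · exact stable_all fun x d _ hx => stable_all fun y d' h hy =>
          stable_eqAt _ (stable_app (stable_app (stable_con _) (hx.mono h)) hy) (hx.mono h)
    | combSigma ρ σ τ =>
      rw [Form.Stable.subst]
      · exact .combSigma ρ σ τ
      · refine stable_all fun x d _ hx => stable_all fun y d' h hy =>
          stable_all fun z d'' h' hz => stable_eqAt _ (stable_app (stable_app (stable_app
            (stable_con _) (hx.mono (h.trans h'))) (hy.mono h')) hz) ?_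
        exact stable_app (stable_app (hx.mono (h.trans h')) hz) (stable_app (hy.mono h') hz)
    | rec_zero =>
      rw [Form.Stable.subst]
      · exact .rec_zero
      · exact stable_all fun x d _ hx => stable_all fun y d' h hy => stable_eqN (stable_app
          (stable_app (stable_app (stable_con _) (hx.mono h)) hy) stable_zero) hy
    | rec_succ =>
      rw [Form.Stable.subst]
      · exact .rec_succ
      · refine stable_all fun x d _ hx => stable_all fun y d' h hy =>
          stable_all fun z d'' h' hz => ?_
        have hR := stable_app (stable_app (stable_con (.recursor .nat)) (hx.mono (h.trans h')))
          (hy.mono h')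
        exact stable_eqN (stable_app hR (stable_add hz stable_one))
          (stable_app (hx.mono (h.trans h')) (stable_app hR hz))
    | ext ρ τ =>
      rw [Form.Stable.subst]
      · exact .ext ρ τ
      · refine stable_all fun x d _ hx => stable_all fun y d' h hy =>
          stable_all fun z d'' h' hz => ?_
        have hx' := hx.mono (h.trans h')
        have hy' := hy.mono h'
        exact stable_imp (stable_eqAt _ hx' hy')
          (stable_eqAt _ (stable_app hz hx') (stable_app hz hy'))
    | induction h => rw [inductionFm_subst]; exact .induction (h.subst _)
    | choice h => rw [choiceFm_subst]; exact .choice (h.subst _)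
  · right
    refine Form.Stable.subst ?_ s
    refine stable_ex fun m d _ hm => stable_all fun f d' h hf => stable_imp ?_ ?_
    · exact stable_ex fun n d'' h' hn => stable_eqN (stable_app (hf.mono h') hn) stable_zero
    · exact stable_eqN (stable_app hf (stable_app (hm.mono h) hf)) stable_zero

end HigherOrderArithmetic

/-! ### Semantics of the binder notation, computed by instance search. -/

namespace HigherOrderArithmetic

local infixr:60 " ⇒ " => Ty.arr

/-! ### The meaning of expressions with binders -/

/-- A state in which an `Exp` or a `Form` is evaluated: the number `d σ` of the quantifiers of
type `σ` passed so far, the values `val σ n`, for `n < d σ`, of the variables bound by them, and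
the values `base` of the other variables. -/
structure Ctx (S : PreStr) where
  d : Ty → ℕ
  val : S.Env
  base : S.Env

namespace Ctx

variable {S : PreStr}

/-- The assignment of values to the de Bruijn indices. -/
def env (c : Ctx S) : S.Env := fun τ i =>
  if i < c.d τ then c.val τ (c.d τ - 1 - i) else c.base τ (i - c.d τ)

/-- The state under one more quantifier, with the value `a` for its variable. -/
def extend (c : Ctx S) (σ : Ty) (a : S.D σ) : Ctx S where
  d := Function.update c.d σ (c.d σ + 1)
  val := fun τ n => if h : τ = σ ∧ n = c.d σ then h.1 ▸ a else c.val τ n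
  base := c.base

theorem env_extend (c : Ctx S) (σ : Ty) (a : S.D σ) :
    (c.extend σ a).env = c.env.cons σ a := by
  refine PreStr.Env.ext_cases (σ := σ) ?_ (fun n => ?_) fun τ h n => ?_
  · simp [env, extend]
  · simp only [env, extend, Function.update_self, PreStr.Env.cons_succ, Nat.add_lt_add_iff_right]
    by_cases h : n < c.d σ
    · have h1 : c.d σ - (n + 1) = c.d σ - 1 - n := by omega
      have h2 : c.d σ - 1 - n ≠ c.d σ := by omega
      simp [h, h1, h2]
    · simp [h]
  · simp [env, extend, PreStr.Env.cons_ne _ _ h, h]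

end Ctx

/-- The state `c'` arises from `c` by passing quantifiers. -/
class Ctx.Le {S : PreStr} (c c' : Ctx S) : Prop where
  d_le : ∀ τ, c.d τ ≤ c'.d τ
  val_eq : ∀ τ, ∀ n < c.d τ, c'.val τ n = c.val τ n

theorem Ctx.Le.trans {S : PreStr} {c c' c'' : Ctx S} (h : c.Le c') (h' : c'.Le c'') : c.Le c'' :=
  ⟨fun τ => (h.d_le τ).trans (h'.d_le τ), fun τ n hn =>
    (h'.val_eq τ n (hn.trans_le (h.d_le τ))).trans (h.val_eq τ n hn)⟩

theorem Ctx.Le.refl {S : PreStr} (c : Ctx S) : c.Le c := ⟨fun _ => le_rfl, fun _ _ _ => rfl⟩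

theorem Ctx.le_extend {S : PreStr} (c : Ctx S) (σ : Ty) (a : S.D σ) : c.Le (c.extend σ a) where
  d_le τ := by
    by_cases h : τ = σ
    · subst h; simp [extend]
    · simp [extend, h]
  val_eq τ n hn := by
    have : ¬ (τ = σ ∧ n = c.d σ) := by rintro ⟨rfl, h⟩; omega
    simp [extend, this]

/-- The expression `x` has the value `a`, from the state `c` on. -/
class Exp.Den {S : PreStr} {σ : Ty} (x : Exp σ) (c : Ctx S) (a : S.D σ) : Prop where
  out : ∀ c', c.Le c' → S.eval c'.env (x c'.d) = a

/-- The form `A` means `P`, from the state `c` on. -/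
class Form.Den {S : PreStr} (A : Form) (c : Ctx S) (P : Prop) : Prop where
  out : ∀ c', c.Le c' → (S.Sat c'.env (A c'.d) ↔ P)

/-- A state that arises from `c`, and an expression with its value from there on. -/
structure Ctx.Named {S : PreStr} (c : Ctx S) (σ : Ty) where
  ctx : Ctx S
  le : c.Le ctx
  exp : Exp σ
  elt : S.D σ
  den : exp.Den ctx elt

instance {S : PreStr} {c : Ctx S} {σ : Ty} (z : c.Named σ) : c.Le z.ctx := z.le
instance {S : PreStr} {c : Ctx S} {σ : Ty} (z : c.Named σ) : z.exp.Den z.ctx z.elt := z.den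

section Den

variable {S : PreStr} {c : Ctx S} {σ τ : Ty}

set_option synthInstance.checkSynthOrder false in
-- A value known in one state persists beneath further quantifiers. The low priority leaves
-- precedence to the rules that follow the structure of an expression.
instance (priority := 50) Exp.Den.mono (x : Exp σ) (a : S.D σ) {c' : Ctx S} [h : c.Le c'] [hx : x.Den c a] :
    x.Den c' a := ⟨fun c'' h' => hx.out c'' (h.trans h')⟩

instance den_con (k : Con σ) : (con k).Den c (S.con k) := ⟨fun _ _ => rfl⟩

instance den_zero : (0 : Exp .nat).Den c (S.con .zero) := den_con _

instance den_one : (1 : Exp .nat).Den c (S.con .one) := den_con _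

instance den_app {f : Exp (σ ⇒ τ)} {x : Exp σ} {a : S.D (σ ⇒ τ)} {b : S.D σ} [hf : f.Den c a]
    [hx : x.Den c b] : (app f x).Den c (S.app a b) :=
  ⟨fun c' h => by rw [app, PreStr.eval, hf.out c' h, hx.out c' h]⟩

instance den_add {x y : Exp .nat} {a b : S.D .nat} [hx : x.Den c a] [hy : y.Den c b] :
    (x + y).Den c (S.app (S.app (S.con .add) a) b) :=
  inferInstanceAs ((app (app (con .add) x) y).Den c _)

instance den_mul {x y : Exp .nat} {a b : S.D .nat} [hx : x.Den c a] [hy : y.Den c b] :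
    (x * y).Den c (S.app (S.app (S.con .mul) a) b) :=
  inferInstanceAs ((app (app (con .mul) x) y).Den c _)

instance den_eqN {x y : Exp .nat} {a b : S.D .nat} [hx : x.Den c a] [hy : y.Den c b] :
    (eqN x y).Den c (S.eqv a b) :=
  ⟨fun c' h => by rw [eqN, PreStr.Sat, hx.out c' h, hy.out c' h]⟩

instance den_ltN {x y : Exp .nat} {a b : S.D .nat} [hx : x.Den c a] [hy : y.Den c b] :
    (ltN x y).Den c (S.lt a b) :=
  ⟨fun c' h => by rw [ltN, PreStr.Sat, hx.out c' h, hy.out c' h]⟩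

instance den_bot : bot.Den c False := ⟨fun _ _ => Iff.rfl⟩

section connectives

variable {A B : Form} {P Q : Prop}

instance den_imp [hA : A.Den c P] [hB : B.Den c Q] : (imp A B).Den c (P → Q) :=
  ⟨fun c' h => by rw [imp, PreStr.Sat, hA.out c' h, hB.out c' h]⟩

instance den_neg [hA : A.Den c P] : (neg A).Den c (¬ P) :=
  inferInstanceAs ((imp A bot).Den c (P → False))

theorem Form.Den.congr (h : A.Den c P) (hPQ : P ↔ Q) : A.Den c Q :=
  ⟨fun c' hc => (h.out c' hc).trans hPQ⟩

instance den_or [hA : A.Den c P] [hB : B.Den c Q] : (or A B).Den c (P ∨ Q) :=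
  Form.Den.congr (A := imp (neg A) B) (P := ¬ P → Q) inferInstance or_iff_not_imp_left.symm

instance den_and [hA : A.Den c P] [hB : B.Den c Q] : (and A B).Den c (P ∧ Q) :=
  Form.Den.congr (A := neg (imp A (neg B))) (P := ¬ (P → ¬ Q)) inferInstance (by tauto)

instance den_iff [hA : A.Den c P] [hB : B.Den c Q] : (iff A B).Den c (P ↔ Q) :=
  Form.Den.congr (A := and (imp A B) (imp B A)) (P := (P → Q) ∧ (Q → P)) inferInstance
    iff_iff_implies_and_implies.symm

end connectives

/-- The body is interpreted for every expression with a known value from some later state on; the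
actual bound variable is one such expression. -/
instance den_all {A : Exp σ → Form} {P : S.D σ → Prop}
    [hA : ∀ z : c.Named σ, (A z.exp).Den z.ctx (P z.elt)] :
    (all σ A).Den c (∀ a, P a) := by
  refine ⟨fun c' h => ?_⟩
  rw [all, PreStr.Sat]
  refine forall_congr' fun a => ?_
  rw [← Ctx.env_extend]
  have h1 : c.Le (c'.extend σ a) := h.trans (Ctx.le_extend c' σ a)
  -- However many quantifiers follow, the de Bruijn index adjusts so as to point to the binder
  -- passed at depth `c'.d σ`, whose stored value is `a`.
  have h2 : Exp.Den (fun e => .var σ (e σ - (c'.d σ + 1)) : Exp σ) (c'.extend σ a) a := by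
    refine ⟨fun c'' h' => ?_⟩
    have h3 := h'.d_le σ
    have h4 := h'.val_eq σ (c'.d σ) (by simp [Ctx.extend])
    simp only [Ctx.extend, Function.update_self] at h3
    have h5 : c''.d σ - (c'.d σ + 1) < c''.d σ := by omega
    have h6 : c''.d σ - 1 - (c''.d σ - (c'.d σ + 1)) = c'.d σ := by omega
    simp only [PreStr.eval, Ctx.env, if_pos h5, h6, h4]
    simp [Ctx.extend]
  exact (hA ⟨_, h1, _, a, h2⟩).out _ (.refl _)

instance den_ex {A : Exp σ → Form} {P : S.D σ → Prop}
    [hA : ∀ z : c.Named σ, (A z.exp).Den z.ctx (P z.elt)] :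
    (ex σ A).Den c (∃ a, P a) :=
  Form.Den.congr (A := neg (all σ fun x => neg (A x))) (P := ¬ ∀ a, ¬ P a) inferInstance
    (by simp)

/-- The state of a sentence. -/
def Ctx.init (v : S.Env) : Ctx S := ⟨fun _ => 0, v, v⟩

theorem sat_toFm {A : Form} {P : Prop} (v : S.Env) [h : A.Den (Ctx.init v) P] :
    S.Sat v A.toFm ↔ P := by
  have : (Ctx.init v).env = v := by funext τ n; simp [Ctx.init, Ctx.env]
  rw [← h.out _ (.refl _), this]
  rfl

end Den

/-- Equality at all types, in a structure. -/
def PreStr.EqAt (S : PreStr) : (τ : Ty) → S.D τ → S.D τ → Prop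
  | .nat, a, b => S.eqv a b
  | .arr _ τ, a, b => ∀ z, S.EqAt τ (S.app a z) (S.app b z)

instance den_eqAt {S : PreStr} (τ : Ty) {c : Ctx S} {x y : Exp τ} {a b : S.D τ} [hx : x.Den c a]
    [hy : y.Den c b] : (eqAt τ x y).Den c (S.EqAt τ a b) := by
  induction τ generalizing c with
  | nat => exact den_eqN
  | arr σ τ _ ih =>
    unfold eqAt PreStr.EqAt
    infer_instance

end HigherOrderArithmetic

/-! ### Extensional models: their internal logic and arithmetic. -/

namespace HigherOrderArithmetic

local infixr:60 " ⇒ " => Ty.arr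

/-! ### Extensional models -/

/-- An extensional model of `ACA₀^ω`, where `=₀` is equality. -/
structure Model extends PreStr where
  eqv_iff : ∀ a b, eqv a b ↔ a = b
  ext : ∀ {σ τ : Ty} (f g : D (σ ⇒ τ)), (∀ x, app f x = app g x) → f = g
  sat : ∀ A ∈ ACA, ∀ v : toPreStr.Env, toPreStr.Sat v A

namespace PreStr

variable {S : PreStr}

theorem nonempty (S : PreStr) (σ : Ty) : Nonempty (S.D σ) := by
  induction σ with
  | nat => exact ⟨S.con .zero⟩
  | arr σ τ _ ih => exact ih.map (S.app (S.con (.combPi τ σ)))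

theorem nonempty_env (S : PreStr) : Nonempty S.Env :=
  ⟨fun σ _ => (S.nonempty σ).some⟩

/-- The equality laws speak of formulas under assignments. One parameter `c`, kept in the next
variable of type `0`, is enough to derive symmetry, transitivity and congruence from atomic
formulas. -/
theorem EqvSubst.of_term (h : S.EqvSubst) {a b c : S.D .nat} {φ : Fm} {P : S.D .nat → Prop}
    (hφ : ∀ (v : S.Env) x, v .nat 0 = c → (S.Sat (v.cons .nat x) φ ↔ P x)) (hab : S.eqv a b)
    (ha : P a) : P b := by
  obtain ⟨v⟩ := S.nonempty_env
  rw [← hφ (v.cons .nat c) _ (by simp)] at ha ⊢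
  exact h.2 _ _ _ _ hab ha

theorem EqvSubst.symm (h : S.EqvSubst) {a b : S.D .nat} (hab : S.eqv a b) : S.eqv b a :=
  h.of_term (c := a) (φ := .eq (.var .nat 0) (.var .nat 1)) (P := fun x => S.eqv x a)
    (fun v x hv => by simp [Sat, eval, hv]) hab (h.1 a)

theorem EqvSubst.trans (h : S.EqvSubst) {a b c : S.D .nat} (hab : S.eqv a b) (hbc : S.eqv b c) :
    S.eqv a c :=
  h.of_term (c := a) (φ := .eq (.var .nat 1) (.var .nat 0)) (P := fun x => S.eqv a x)
    (fun v x hv => by simp [Sat, eval, hv]) hbc hab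

theorem EqvSubst.lt_congr (h : S.EqvSubst) {a b a' b' : S.D .nat} (ha : S.eqv a a')
    (hb : S.eqv b b') (hab : S.lt a b) : S.lt a' b' := by
  have : S.lt a' b :=
    h.of_term (c := b) (φ := .lt (.var .nat 0) (.var .nat 1)) (P := fun x => S.lt x b)
      (fun v x hv => by simp [Sat, eval, hv]) ha hab
  exact h.of_term (c := a') (φ := .lt (.var .nat 1) (.var .nat 0)) (P := fun x => S.lt a' x)
    (fun v x hv => by simp [Sat, eval, hv]) hb this

variable (S) in
/-- The axioms of extensionality, in a structure. -/
def IsExt : Prop := ∀ (ρ τ : Ty) (x y : S.D ρ) (φ : S.D (ρ ⇒ τ)),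
  S.EqAt ρ x y → S.EqAt τ (S.app φ x) (S.app φ y)

theorem isExt_of_sat (h : ∀ A ∈ ACA, ∀ v, S.Sat v A) : S.IsExt := fun ρ τ => by
  obtain ⟨v⟩ := S.nonempty_env
  exact (sat_toFm v).1 (h _ (.inl (.ext ρ τ)) v)

/-- Extensional equality. -/
def setoid (h : S.EqvSubst) (σ : Ty) : Setoid (S.D σ) where
  r := S.EqAt σ
  iseqv := by
    induction σ with
    | nat => exact ⟨h.1, h.symm, h.trans⟩
    | arr σ τ _ ih =>
      exact ⟨fun _ z => ih.refl _, fun h z => ih.symm (h z), fun h h' z => ih.trans (h z) (h' z)⟩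

variable (S) in
/-- The quotient by extensional equality. -/
def quotient (h : S.EqvSubst) (hS : S.IsExt) : PreStr where
  D σ := Quotient (setoid h σ)
  app := fun {σ τ} => Quotient.map₂ S.app fun _ g hfg x y hxy =>
    (setoid h τ).trans (hfg x) (hS σ τ x y g hxy)
  con c := Quotient.mk _ (S.con c)
  eqv := Eq
  lt := Quotient.lift₂ S.lt fun _ _ _ _ ha hb => propext
    ⟨h.lt_congr ha hb, h.lt_congr (h.symm ha) (h.symm hb)⟩

section quotient

variable (h : S.EqvSubst) (hS : S.IsExt)

/-- The assignment of the classes. -/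
def Env.mk (v : S.Env) : (S.quotient h hS).Env := fun σ n => Quotient.mk (setoid h σ) (v σ n)

theorem eval_mk (v : S.Env) {τ : Ty} (t : Tm τ) :
    eval (v.mk h hS) t = Quotient.mk (setoid h τ) (eval v t) := by
  induction t with
  | var => rfl
  | con => rfl
  | app f x hf hx => simp only [eval, hf, hx]; rfl

/-- Every class has a representative, so quantifiers over the quotient and over `S` agree; atomic
formulas respect the classes. -/
theorem sat_mk (v : S.Env) (φ : Fm) : Sat (v.mk h hS) φ ↔ Sat v φ := by
  induction φ generalizing v with
  | eq a b =>
    simp only [Sat, eval_mk]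
    exact Quotient.eq (r := setoid h .nat)
  | lt a b => simp only [Sat, eval_mk]; rfl
  | bot => rfl
  | imp φ ψ hφ hψ => simp only [Sat, hφ, hψ]
  | all σ φ ih =>
    have key : ∀ a : S.D σ, (v.mk h hS).cons σ (Quotient.mk (setoid h σ) a) =
        (v.cons σ a).mk h hS := fun a => by
      refine Env.ext_cases (σ := σ) ?_ (fun n => ?_) fun τ hτ n => ?_
      · exact (Env.cons_zero _ _ _).trans (by rw [Env.mk, Env.cons_zero])
      · exact (Env.cons_succ _ _ _ _).trans (by rw [Env.mk, Env.mk, Env.cons_succ])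
      · exact (Env.cons_ne _ _ hτ _).trans (by rw [Env.mk, Env.mk, Env.cons_ne _ _ hτ])
    simp only [Sat, ← ih, ← key]
    exact ⟨fun H a => H _, fun H a => Quotient.inductionOn a H⟩

end quotient

end PreStr

/-- A sentence that holds in all extensional models is provable. -/
theorem ACAProves_of_model {A : Form}
    (h : ∀ (M : Model) (v : M.toPreStr.Env), M.toPreStr.Sat v A.toFm) : ACAProves A := by
  refine completeness ACA_subst _ fun S hS hax v => ?_
  have hE := PreStr.isExt_of_sat hax
  rw [← PreStr.sat_mk hS hE]
  refine h { toPreStr := S.quotient hS hE, eqv_iff := fun _ _ => Iff.rfl, ext := ?_, sat := ?_ } _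
  · intro σ τ f g
    refine Quotient.inductionOn₂ f g fun f g hfg => Quotient.sound fun z => ?_
    exact Quotient.exact (s := PreStr.setoid hS τ) (hfg (Quotient.mk _ z))
  · intro B hB w
    have : w = PreStr.Env.mk hS hE fun σ n => (w σ n).out := by
      funext σ n; exact (Quotient.out_eq _).symm
    rw [this, PreStr.sat_mk]
    exact hax B hB _

namespace Model

variable (M : Model)

theorem eqAt_iff {τ : Ty} (a b : M.D τ) : M.EqAt τ a b ↔ a = b := by
  induction τ with
  | nat => exact M.eqv_iff a b
  | arr σ τ _ ih =>
    refine ⟨fun h => M.ext a b fun z => (ih _ _).1 (h z), ?_⟩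
    rintro rfl z
    exact (ih _ _).2 rfl

/-- The numbers of the model. -/
abbrev N : Type := M.D .nat

instance : Zero M.N := ⟨M.con .zero⟩
instance : One M.N := ⟨M.con .one⟩
instance : Add M.N := ⟨fun a b => M.app (M.app (M.con .add) a) b⟩
instance : Mul M.N := ⟨fun a b => M.app (M.app (M.con .mul) a) b⟩
instance : LT M.N := ⟨M.lt⟩

section Den

variable {M} {c : Ctx M.toPreStr}

instance den_zero : (0 : Exp .nat).Den c (0 : M.N) := HigherOrderArithmetic.den_zero

instance den_one : (1 : Exp .nat).Den c (1 : M.N) := HigherOrderArithmetic.den_one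

variable {x y : Exp .nat} {a b : M.N} [hx : x.Den c a] [hy : y.Den c b]

instance den_add : (x + y).Den c (a + b) := HigherOrderArithmetic.den_add

instance den_mul : (x * y).Den c (a * b) := HigherOrderArithmetic.den_mul

instance den_eqN : (eqN x y).Den c (a = b) :=
  HigherOrderArithmetic.den_eqN.congr (M.eqv_iff a b)

instance den_ltN : (ltN x y).Den c (a < b) := HigherOrderArithmetic.den_ltN

instance den_eqAt {τ : Ty} {x y : Exp τ} {a b : M.D τ} [hx : x.Den c a] [hy : y.Den c b] :
    (eqAt τ x y).Den c (a = b) :=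
  Form.Den.congr (HigherOrderArithmetic.den_eqAt τ) (M.eqAt_iff a b)

end Den

theorem of_rca {A : Form} {P : Prop} (h : RCA A.toFm)
    [hA : ∀ v, A.Den (Ctx.init (S := M.toPreStr) v) P] : P := by
  obtain ⟨v⟩ := M.nonempty_env
  exact (sat_toFm v).1 (M.sat _ (.inl h) v)

theorem succ_ne_zero : ∀ n : M.N, ¬ n + 1 = 0 := M.of_rca (.basic .succ_ne_zero)

theorem succ_inj : ∀ m n : M.N, m + 1 = n + 1 → m = n := M.of_rca (.basic .succ_inj)

theorem add_zero : ∀ m : M.N, m + 0 = m := M.of_rca (.basic .add_zero)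

theorem add_succ : ∀ m n : M.N, m + (n + 1) = m + n + 1 := M.of_rca (.basic .add_succ)

theorem mul_zero : ∀ m : M.N, m * 0 = 0 := M.of_rca (.basic .mul_zero)

theorem mul_succ : ∀ m n : M.N, m * (n + 1) = m * n + m := M.of_rca (.basic .mul_succ)

theorem not_lt_zero : ∀ m : M.N, ¬ m < 0 := M.of_rca (.basic .not_lt_zero)

theorem lt_succ : ∀ m n : M.N, m < n + 1 ↔ (m < n ∨ m = n) := M.of_rca (.basic .lt_succ)

variable {M}

theorem combPi_app {ρ σ : Ty} : ∀ (x : M.D ρ) (y : M.D σ),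
    M.app (M.app (M.con (.combPi ρ σ)) x) y = x := M.of_rca (.combPi ρ σ)

theorem combSigma_app {ρ σ τ : Ty} : ∀ (x : M.D (ρ ⇒ σ ⇒ τ)) (y : M.D (ρ ⇒ σ)) (z : M.D ρ),
    M.app (M.app (M.app (M.con (.combSigma ρ σ τ)) x) y) z = M.app (M.app x z) (M.app y z) :=
  M.of_rca (.combSigma ρ σ τ)

theorem recursor_zero : ∀ (f : M.D .one) (m : M.N),
    M.app (M.app (M.app (M.con (.recursor .nat)) f) m) 0 = m := M.of_rca .rec_zero

theorem recursor_succ : ∀ (f : M.D .one) (m n : M.N),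
    M.app (M.app (M.app (M.con (.recursor .nat)) f) m) (n + 1) =
      M.app f (M.app (M.app (M.app (M.con (.recursor .nat)) f) m) n) := M.of_rca .rec_succ

theorem exists_mu : ∃ μ : M.D .two, ∀ f : M.D .one,
    (∃ n : M.N, M.app f n = 0) → M.app f (M.app μ f) = 0 := by
  obtain ⟨v⟩ := M.nonempty_env
  have : muAx.Den (Ctx.init (S := M.toPreStr) v) (∃ μ : M.D .two, ∀ f : M.D .one,
      (∃ n : M.N, M.app f n = 0) → M.app f (M.app μ f) = 0) := by
    unfold muAx
    infer_instance
  exact (sat_toFm v).1 (M.sat _ (.inr rfl) v)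

/-- Induction for a function. -/
theorem induction_zero (f : M.D .one) (h0 : M.app f 0 = 0)
    (hs : ∀ n : M.N, M.app f n = 0 → M.app f (n + 1) = 0) (n : M.N) : M.app f n = 0 := by
  obtain ⟨v⟩ := M.nonempty_env
  let A : Fm := .eq (.app (.var .one 0) (.var .nat 0)) (.con .zero)
  have hA : ∀ n : M.N, M.Sat ((v.cons .one f).cons .nat n) A ↔ M.app f n = 0 := fun n => by
    have e : Ty.one ≠ Ty.nat := by decide
    simp only [A, PreStr.Sat, PreStr.eval, PreStr.Env.cons_zero, PreStr.Env.cons_ne _ _ e,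
      M.eqv_iff]
    rfl
  have := M.sat _ (.inl (RCA.induction (A := A) trivial)) (v.cons .one f)
  simp only [inductionFm, PreStr.Sat, PreStr.sat_inst] at this
  refine (hA n).1 (this ((hA 0).2 h0) (fun n hn => ?_) n)
  rw [PreStr.sat_subst]
  convert (hA (n + 1)).2 (hs n ((hA n).1 hn)) using 1
  refine PreStr.Env.ext_cases (σ := .nat) ?_ (fun n => ?_) fun τ h n => ?_
  · simp only [Subst.succ, PreStr.eval, PreStr.Env.cons_zero]; rfl
  · simp [Subst.succ, PreStr.eval]
  · cases τ with
    | nat => exact (h rfl).elim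
    | arr σ τ => simp [Subst.succ, PreStr.eval, PreStr.Env.cons_ne]

/-- The choice axiom. -/
theorem choice {A : Fm} (hA : A.IsQF) (v : M.toPreStr.Env)
    (h : ∀ x : M.D .one, ∃ y : M.N, M.Sat ((v.cons .one x).cons .nat y) A) :
    ∃ Y : M.D .two, ∀ x : M.D .one, M.Sat ((v.cons .one x).cons .nat (M.app Y x)) A := by
  have := M.sat _ (.inl (RCA.choice hA)) v
  simp only [choiceFm, PreStr.Sat, Fm.ex, Fm.neg, PreStr.sat_inst] at this
  have := this fun x hx => (h x).elim hx
  by_contra hno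
  refine this fun Y hY => hno ⟨Y, fun x => ?_⟩
  have := hY x
  rw [Fm.shift, PreStr.sat_subst] at this
  convert this using 1
  have e1 : Ty.one ≠ Ty.two := by decide
  have e2 : Ty.nat ≠ Ty.two := by decide
  funext τ n
  have e3 : PreStr.eval ((v.cons .two Y).cons .one x)
      (.app (.var .two 0) (.var .one 0) : Tm .nat) = M.app Y x := by
    simp [PreStr.eval, PreStr.Env.cons_ne _ _ e1.symm]
  rw [e3]
  simp only [Subst.raise, PreStr.eval]
  by_cases h0 : τ = .nat
  · subst h0
    cases n <;> simp [PreStr.Env.cons_ne]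
  · rw [PreStr.Env.cons_ne _ _ h0, PreStr.Env.cons_ne _ _ h0]
    by_cases h1 : τ = .one
    · subst h1
      cases n <;> simp [PreStr.Env.cons_ne]
    · rw [PreStr.Env.cons_ne _ _ h1, PreStr.Env.cons_ne _ _ h1]
      by_cases h2 : τ = .two
      · subst h2; simp
      · simp [PreStr.Env.cons_ne _ _ h2, h2]

/-- A quantifier-free property of functions has a characteristic functional. -/
theorem exists_char {P : Fm} (hP : P.IsQF) (Q : M.D .one → Prop)
    (h : ∀ (v : M.toPreStr.Env) x y, M.Sat ((v.cons .one x).cons .nat y) P ↔ Q x) :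
    ∃ Y : M.D .two, ∀ x, M.app Y x = 0 ↔ Q x := by
  obtain ⟨v⟩ := M.nonempty_env
  let y0 : Fm := .eq (.var .nat 0) (.con .zero)
  -- Choice is applied to the formula `y = 0 ↔ P(x)`, which is always solved by `0` or by `1`.
  have hA : ∀ x y, M.Sat ((v.cons .one x).cons .nat y) (Fm.and (.imp y0 P) (.imp P y0))
      ↔ (y = 0 ↔ Q x) := fun x y => by
    have : M.Sat ((v.cons .one x).cons .nat y) y0 ↔ y = 0 := by
      simp only [y0, PreStr.Sat, PreStr.eval, PreStr.Env.cons_zero, M.eqv_iff]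
      rfl
    simp only [PreStr.Sat, Fm.and, Fm.neg, h, this]
    tauto
  obtain ⟨Y, hY⟩ := choice (M := M) (A := Fm.and (.imp y0 P) (.imp P y0))
    (by simp [Fm.IsQF, Fm.and, Fm.neg, hP, y0]) v fun x => by
      simp only [hA]
      by_cases hx : Q x
      · exact ⟨0, by simp [hx]⟩
      · refine ⟨0 + 1, by simp [hx, M.succ_ne_zero]⟩
  exact ⟨Y, fun x => (hA x _).1 (hY x)⟩

end Model

end HigherOrderArithmetic

namespace HigherOrderArithmetic

local infixr:60 " ⇒ " => Ty.arr

namespace Model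

variable (M : Model)

/-! ### Representable functions and decidable predicates -/

/-- Tuples of objects of the model, with the functions of them that are given by terms with
parameters. -/
class Tup (X : Type) where
  rep : ∀ {τ : Ty}, (X → M.D τ) → Prop
  rep_const : ∀ {τ : Ty} (a : M.D τ), rep fun _ => a
  rep_app : ∀ {σ τ : Ty} {F : X → M.D (σ ⇒ τ)} {A : X → M.D σ}, rep F → rep A →
    rep fun x => M.app (F x) (A x)

/-- A function of tuples that is given by a term with parameters. -/
class Rep {X : Type} [Tup M X] {τ : Ty} (F : X → M.D τ) : Prop where
  out : Tup.rep F

instance : Tup M Unit where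
  rep _ := True
  rep_const _ := trivial
  rep_app _ _ := trivial

variable {M}

section Rep

variable {X : Type} [Tup M X] {ρ σ τ : Ty}

instance rep_const (a : M.D τ) : M.Rep fun _ : X => a := ⟨Tup.rep_const a⟩

instance rep_app {F : X → M.D (σ ⇒ τ)} {A : X → M.D σ} [hF : M.Rep F] [hA : M.Rep A] :
    M.Rep fun x => M.app (F x) (A x) := ⟨Tup.rep_app hF.out hA.out⟩

/-- Combinatory completeness is built into the definition: a function of a longer tuple counts as
representable when its abstraction over the last entry is. The combinator `Π` handles constants and
`Σ` handles application. -/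
instance : Tup M (X × M.D σ) where
  rep F := ∃ G, M.Rep (X := X) G ∧ ∀ x a, M.app (G x) a = F (x, a)
  rep_const a := ⟨fun _ => M.app (M.con (.combPi _ _)) a, inferInstance, fun _ _ => combPi_app _ _⟩
  rep_app := by
    rintro ρ τ F A ⟨G, hG, hF⟩ ⟨H, hH, hA⟩
    refine ⟨fun x => M.app (M.app (M.con (.combSigma _ _ _)) (G x)) (H x), inferInstance,
      fun x a => ?_⟩
    rw [combSigma_app, hF, hA]

/-- Abstraction. -/
theorem Rep.exists_lam {F : X × M.D σ → M.D τ} (h : M.Rep F) :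
    ∃ G : X → M.D (σ ⇒ τ), M.Rep G ∧ ∀ x a, M.app (G x) a = F (x, a) := h.out

theorem rep_fst {F : X → M.D τ} (h : M.Rep F) : M.Rep fun x : X × M.D σ => F x.1 :=
  ⟨fun x => M.app (M.con (.combPi _ _)) (F x), inferInstance, fun _ _ => combPi_app _ _⟩

instance rep_var0 : M.Rep fun x : X × M.D σ => x.2 :=
  -- The identity is `Σ Π Π`.
  ⟨fun _ => M.app (M.app (M.con (.combSigma _ _ _)) (M.con (.combPi σ (σ ⇒ σ))))
    (M.con (.combPi σ σ)), inferInstance, fun _ _ => by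
      rw [combSigma_app, combPi_app]⟩

section

variable {σ₁ σ₂ σ₃ : Ty}

instance rep_var1 : M.Rep fun x : (X × M.D σ) × M.D σ₁ => x.1.2 := rep_fst rep_var0
instance rep_var2 : M.Rep fun x : ((X × M.D σ) × M.D σ₁) × M.D σ₂ => x.1.1.2 := rep_fst rep_var1
instance rep_var3 : M.Rep fun x : (((X × M.D σ) × M.D σ₁) × M.D σ₂) × M.D σ₃ => x.1.1.1.2 :=
  rep_fst rep_var2
instance rep_wk1 {F : X → M.D τ} [h : M.Rep F] : M.Rep fun x : X × M.D σ => F x.1 := rep_fst h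
instance rep_wk2 {F : X → M.D τ} [M.Rep F] :
    M.Rep fun x : (X × M.D σ) × M.D σ₁ => F x.1.1 := rep_fst rep_wk1
instance rep_wk3 {F : X → M.D τ} [M.Rep F] :
    M.Rep fun x : ((X × M.D σ) × M.D σ₁) × M.D σ₂ => F x.1.1.1 := rep_fst rep_wk2
instance rep_wk4 {F : X → M.D τ} [M.Rep F] :
    M.Rep fun x : (((X × M.D σ) × M.D σ₁) × M.D σ₂) × M.D σ₃ => F x.1.1.1.1 := rep_fst rep_wk3

end

instance rep_add {F G : X → M.N} [hF : M.Rep F] [hG : M.Rep G] : M.Rep fun x => F x + G x :=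
  inferInstanceAs (M.Rep fun x => M.app (M.app (M.con .add) (F x)) (G x))

instance rep_mul {F G : X → M.N} [hF : M.Rep F] [hG : M.Rep G] : M.Rep fun x => F x * G x :=
  inferInstanceAs (M.Rep fun x => M.app (M.app (M.con .mul) (F x)) (G x))

end Rep

variable (M) in
/-- A predicate that has a characteristic function. -/
class Dec {X : Type} [Tup M X] (P : X → Prop) : Prop where
  out : ∃ F : X → M.N, M.Rep F ∧ ∀ x, F x = 0 ↔ P x

/-- The pair `a`, `b` as a sequence. -/
theorem exists_pair : ∃ p : M.D (.nat ⇒ .nat ⇒ .one), ∀ a b : M.N,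
    M.app (M.app (M.app p a) b) 0 = a ∧ M.app (M.app (M.app p a) b) (0 + 1) = b := by
  -- Iterating the constant function `b` from the start `a` gives `a` at `0` and `b` at `1`.
  have : M.Rep fun x : ((Unit × M.N) × M.N) => M.app (M.app (M.con (.recursor .nat))
    (M.app (M.con (.combPi .nat .nat)) x.2)) x.1.2 := inferInstance
  obtain ⟨G, hG, h⟩ := this.exists_lam
  obtain ⟨p, -, hp⟩ := hG.exists_lam
  refine ⟨p (), fun a b => ?_⟩
  rw [hp, h]
  exact ⟨recursor_zero _ _, by rw [recursor_succ, combPi_app]⟩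

section Dec

variable {X : Type} [Tup M X]

theorem Dec.congr {P Q : X → Prop} (h : M.Dec P) (hPQ : ∀ x, P x ↔ Q x) : M.Dec Q := by
  obtain ⟨F, hF, hP⟩ := h
  exact ⟨F, hF, fun x => (hP x).trans (hPQ x)⟩

/-- The choice axiom yields characteristic functionals on type `1` only, so two numbers are handed
over as the first two values of one function. -/
theorem dec_of_char {P : Fm} (hP : P.IsQF) {R : M.N → M.N → Prop}
    (h : ∀ (v : M.toPreStr.Env) x y, M.Sat ((v.cons .one x).cons .nat y) P ↔
      R (M.app x 0) (M.app x (0 + 1))) {F G : X → M.N} (hF : M.Rep F) (hG : M.Rep G) :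
    M.Dec fun x => R (F x) (G x) := by
  obtain ⟨p, hp⟩ := M.exists_pair
  obtain ⟨Y, hY⟩ := exists_char hP _ h
  refine ⟨fun x => M.app Y (M.app (M.app p (F x)) (G x)), inferInstance, fun x => ?_⟩
  rw [hY, (hp _ _).1, (hp _ _).2]

variable {F G : X → M.N} [hF : M.Rep F] [hG : M.Rep G]

def firstTm : Tm .nat := .app (.var .one 0) (.con .zero)
def secondTm : Tm .nat :=
  .app (.var .one 0) (.app (.app (.con .add) (.con .zero)) (.con .one))

theorem eval_firstTm (v : M.toPreStr.Env) (x : M.D .one) (y : M.N) :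
    PreStr.eval ((v.cons .one x).cons .nat y) firstTm = M.app x 0 := by
  have e : Ty.one ≠ Ty.nat := by decide
  simp only [firstTm, PreStr.eval, PreStr.Env.cons_ne _ _ e, PreStr.Env.cons_zero]
  rfl

theorem eval_secondTm (v : M.toPreStr.Env) (x : M.D .one) (y : M.N) :
    PreStr.eval ((v.cons .one x).cons .nat y) secondTm = M.app x (0 + 1) := by
  have e : Ty.one ≠ Ty.nat := by decide
  simp only [secondTm, PreStr.eval, PreStr.Env.cons_ne _ _ e, PreStr.Env.cons_zero]
  rfl

instance dec_eq : M.Dec fun x => F x = G x :=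
  dec_of_char (P := .eq firstTm secondTm) trivial (R := fun a b => a = b)
    (fun v x y => by simp only [PreStr.Sat, eval_firstTm, eval_secondTm, M.eqv_iff]) hF hG

instance dec_lt : M.Dec fun x => F x < G x :=
  dec_of_char (P := .lt firstTm secondTm) trivial (R := fun a b => a < b)
    (fun v x y => by simp only [PreStr.Sat, eval_firstTm, eval_secondTm]; rfl) hF hG

instance dec_imp {P Q : X → Prop} [hP : M.Dec P] [hQ : M.Dec Q] : M.Dec fun x => P x → Q x := by
  obtain ⟨F, hF, hP⟩ := hP
  obtain ⟨G, hG, hQ⟩ := hQ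
  have := dec_of_char (P := .imp (.eq firstTm (.con .zero)) (.eq secondTm (.con .zero)))
    ⟨trivial, trivial⟩ (R := fun a b : M.N => a = 0 → b = 0)
    (fun v x y => by simp only [PreStr.Sat, eval_firstTm, eval_secondTm, M.eqv_iff]; rfl) hF hG
  exact this.congr fun x => by rw [hP, hQ]

/-- A proposition that does not depend on the tuple may be decided outside the model and is then
represented by a constant. -/
instance dec_const (p : Prop) : M.Dec fun _ : X => p := by
  by_cases h : p
  · exact ⟨fun _ => 0, inferInstance, by simp [h]⟩
  · exact ⟨fun _ => 0 + 1, inferInstance, by simp [h, M.succ_ne_zero]⟩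

section connectives

variable {P Q : X → Prop}

instance dec_not [M.Dec P] : M.Dec fun x => ¬ P x :=
  inferInstanceAs (M.Dec fun x => P x → False)

instance dec_and [M.Dec P] [M.Dec Q] : M.Dec fun x => P x ∧ Q x :=
  Dec.congr (P := fun x => ¬ (P x → ¬ Q x)) inferInstance fun x => by tauto

instance dec_or [M.Dec P] [M.Dec Q] : M.Dec fun x => P x ∨ Q x :=
  Dec.congr (P := fun x => ¬ P x → Q x) inferInstance fun x => by tauto

instance dec_iff [M.Dec P] [M.Dec Q] : M.Dec fun x => P x ↔ Q x :=
  Dec.congr (P := fun x => (P x → Q x) ∧ (Q x → P x)) inferInstance fun x => by tauto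

end connectives

/-- This is where `μ` enters: a number satisfying `P` exists exactly when the one proposed by `μ`
works. Hence all arithmetical predicates with parameters of any type have characteristic functions,
and induction and comprehension apply to them. -/
instance dec_exists {P : X → M.N → Prop} [h : M.Dec fun x : X × M.N => P x.1 x.2] :
    M.Dec fun x => ∃ n, P x n := by
  obtain ⟨F, hF, hP⟩ := h
  obtain ⟨G, hG, hF⟩ := hF.exists_lam
  obtain ⟨μ, hμ⟩ := M.exists_mu
  refine ⟨fun x => M.app (G x) (M.app μ (G x)), inferInstance, fun x => ?_⟩
  constructor
  · intro h
    exact ⟨_, (hP _).1 ((hF _ _).symm.trans h)⟩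
  · rintro ⟨n, hn⟩
    exact hμ _ ⟨n, (hF _ _).trans ((hP (x, n)).2 hn)⟩

instance dec_forall {P : X → M.N → Prop} [h : M.Dec fun x : X × M.N => P x.1 x.2] :
    M.Dec fun x => ∀ n, P x n :=
  Dec.congr (P := fun x => ¬ ∃ n, ¬ P x n) inferInstance fun x => by simp

/-- A search function. -/
theorem exists_search {P : X → M.N → Prop} [h : M.Dec fun x : X × M.N => P x.1 x.2] :
    ∃ F : X → M.N, M.Rep F ∧ ∀ x, (∃ n, P x n) → P x (F x) := by
  obtain ⟨F, hF, hP⟩ := h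
  obtain ⟨G, hG, hF⟩ := hF.exists_lam
  obtain ⟨μ, hμ⟩ := M.exists_mu
  refine ⟨fun x => M.app μ (G x), inferInstance, ?_⟩
  rintro x ⟨n, hn⟩
  exact (hP (x, _)).1 ((hF _ _).symm.trans (hμ _ ⟨n, (hF _ _).trans ((hP (x, n)).2 hn)⟩))

theorem Dec.comp {σ : Ty} {P : M.D σ → Prop} (h : M.Dec fun x : Unit × M.D σ => P x.2)
    {A : X → M.D σ} (hA : M.Rep A) : M.Dec fun x => P (A x) := by
  obtain ⟨F, hF, hP⟩ := h
  obtain ⟨G, hG, hF⟩ := hF.exists_lam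
  exact ⟨fun x => M.app (G ()) (A x), inferInstance, fun x => by simp only [hF, hP]⟩

instance dec_wk1 {σ : Ty} {P : X → Prop} [h : M.Dec P] : M.Dec fun x : X × M.D σ => P x.1 := by
  obtain ⟨F, hF, hP⟩ := h
  exact ⟨_, rep_fst hF, fun x => hP _⟩

end Dec

/-- Induction for decidable predicates. -/
theorem induction {P : M.N → Prop} (h : M.Dec fun x : Unit × M.N => P x.2) (h0 : P 0)
    (hs : ∀ n, P n → P (n + 1)) (n : M.N) : P n := by
  obtain ⟨F, hF, hP⟩ := h
  obtain ⟨G, hG, hF⟩ := hF.exists_lam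
  have key : ∀ n, M.app (G ()) n = 0 ↔ P n := fun n => by rw [hF, hP]
  exact (key n).1 (induction_zero _ ((key 0).2 h0)
    (fun n hn => (key _).2 (hs n ((key n).1 hn))) n)

/-! ### Arithmetic in a model -/

section arith

variable (M)

theorem zero_add (n : M.N) : 0 + n = n := by
  induction n using induction with
  | h => infer_instance
  | h0 => exact M.add_zero 0
  | hs n ih => rw [M.add_succ, ih]

theorem add_assoc (a b c : M.N) : a + b + c = a + (b + c) := by
  induction c using induction with
  | h => infer_instance
  | h0 => rw [M.add_zero, M.add_zero]
  | hs n ih => rw [M.add_succ, M.add_succ, M.add_succ, ih]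

theorem succ_add (a b : M.N) : a + 1 + b = a + b + 1 := by
  induction b using induction with
  | h => infer_instance
  | h0 => rw [M.add_zero, M.add_zero]
  | hs n ih => rw [M.add_succ, M.add_succ, ih]

theorem add_comm (a b : M.N) : a + b = b + a := by
  induction b using induction with
  | h => infer_instance
  | h0 => rw [M.add_zero, M.zero_add]
  | hs n ih => rw [M.add_succ, M.succ_add, ih]

theorem zero_mul (n : M.N) : 0 * n = 0 := by
  induction n using induction with
  | h => infer_instance
  | h0 => exact M.mul_zero 0
  | hs n ih => rw [M.mul_succ, ih, M.add_zero]

theorem succ_mul (a b : M.N) : (a + 1) * b = a * b + b := by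
  induction b using induction with
  | h => infer_instance
  | h0 => rw [M.mul_zero, M.mul_zero, M.add_zero]
  | hs n ih =>
    rw [M.mul_succ, M.mul_succ, ih, M.add_succ, M.add_succ, M.add_assoc (a * n),
      M.add_comm n a, ← M.add_assoc]

theorem mul_comm (a b : M.N) : a * b = b * a := by
  induction b using induction with
  | h => infer_instance
  | h0 => rw [M.mul_zero, M.zero_mul]
  | hs n ih => rw [M.mul_succ, M.succ_mul, ih]

theorem mul_add (a b c : M.N) : a * (b + c) = a * b + a * c := by
  induction c using induction with
  | h => infer_instance
  | h0 => rw [M.mul_zero, M.add_zero, M.add_zero]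
  | hs n ih => rw [M.add_succ, M.mul_succ, M.mul_succ, ih, M.add_assoc]

theorem mul_assoc (a b c : M.N) : a * b * c = a * (b * c) := by
  induction c using induction with
  | h => infer_instance
  | h0 => rw [M.mul_zero, M.mul_zero, M.mul_zero]
  | hs n ih => rw [M.mul_succ, M.mul_succ, M.mul_add, ih]

theorem one_mul (a : M.N) : 1 * a = a := by
  rw [← M.zero_add 1, M.succ_mul, M.zero_mul, M.zero_add]

instance : CommSemiring M.N where
  add_assoc := M.add_assoc
  zero_add := M.zero_add
  add_zero := M.add_zero
  add_comm := M.add_comm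
  nsmul := nsmulRec
  left_distrib := M.mul_add
  right_distrib a b c := by rw [M.mul_comm, M.mul_add, M.mul_comm c, M.mul_comm c]
  zero_mul := M.zero_mul
  mul_zero := M.mul_zero
  mul_assoc := M.mul_assoc
  one_mul := M.one_mul
  mul_one a := by rw [M.mul_comm, M.one_mul]
  mul_comm := M.mul_comm

theorem add_right_cancel' {a b c : M.N} (h : a + c = b + c) : a = b := by
  induction c using induction with
  | h => infer_instance
  | h0 => simpa using h
  | hs n ih => exact ih (M.succ_inj _ _ (by rw [← M.add_succ, h, M.add_succ]))

variable {M}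

theorem zero_or_succ (n : M.N) : n = 0 ∨ ∃ m, n = m + 1 := by
  induction n using induction with
  | h => infer_instance
  | h0 => exact .inl rfl
  | hs n _ => exact .inr ⟨n, rfl⟩

/-- The axioms describe `<` only by recursion on the right argument; expressed through addition, the
order laws become semiring identities. -/
theorem lt_iff_exists (a b : M.N) : a < b ↔ ∃ c, b = a + c + 1 := by
  induction b using induction with
  | h => infer_instance
  | h0 =>
    simp only [M.not_lt_zero, false_iff, not_exists]
    exact fun c h => M.succ_ne_zero _ h.symm
  | hs n ih =>
    rw [M.lt_succ, ih]
    constructor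
    · rintro (⟨c, rfl⟩ | rfl)
      · exact ⟨c + 1, by ring⟩
      · exact ⟨0, by ring⟩
    · rintro ⟨c, hc⟩
      have hc := M.succ_inj _ _ hc
      rcases zero_or_succ c with rfl | ⟨d, rfl⟩
      · right; rw [hc, M.add_zero]
      · left; exact ⟨d, by rw [hc]; ring⟩

theorem lt_trichotomy' (a b : M.N) : a < b ∨ a = b ∨ b < a := by
  induction a using induction with
  | h => infer_instance
  | h0 =>
    rcases zero_or_succ b with rfl | ⟨d, rfl⟩
    · exact .inr (.inl rfl)
    · exact .inl ((lt_iff_exists _ _).2 ⟨d, by ring⟩)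
  | hs n ih =>
    rcases ih with h | rfl | h
    · obtain ⟨c, rfl⟩ := (lt_iff_exists _ _).1 h
      rcases zero_or_succ c with rfl | ⟨d, rfl⟩
      · right; left; ring
      · left; exact (lt_iff_exists _ _).2 ⟨d, by ring⟩
    · right; right; exact (lt_iff_exists _ _).2 ⟨0, by ring⟩
    · right; right
      obtain ⟨c, rfl⟩ := (lt_iff_exists _ _).1 h
      exact (lt_iff_exists _ _).2 ⟨c + 1, by ring⟩

theorem lt_irrefl' (a : M.N) : ¬ a < a := by
  rw [lt_iff_exists]
  rintro ⟨c, hc⟩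
  refine M.succ_ne_zero c (M.add_right_cancel' (c := a) ?_)
  rw [M.zero_add]
  conv_rhs => rw [hc]
  ring

theorem lt_trans' {a b c : M.N} (h : a < b) (h' : b < c) : a < c := by
  obtain ⟨d, rfl⟩ := (lt_iff_exists _ _).1 h
  obtain ⟨e, rfl⟩ := (lt_iff_exists _ _).1 h'
  exact (lt_iff_exists _ _).2 ⟨d + e + 1, by ring⟩

/-- The relation `≤` is taken to be `¬ b < a` so as to agree with `leN`. -/
noncomputable instance : LinearOrder M.N where
  le a b := ¬ b < a
  le_refl := lt_irrefl'
  le_trans a b c h h' hca := by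
    rcases lt_trichotomy' a b with h1 | rfl | h1
    · exact h' (lt_trans' hca h1)
    · exact h' hca
    · exact h h1
  lt_iff_le_not_ge a b := by
    constructor
    · exact fun h => ⟨fun h' => lt_irrefl' _ (lt_trans' h h'), fun h' => h' h⟩
    · exact fun h => not_not.1 h.2
  le_antisymm a b h h' := by
    rcases lt_trichotomy' a b with h1 | h1 | h1
    · exact (h' h1).elim
    · exact h1
    · exact (h h1).elim
  le_total a b := by
    by_contra hc
    push Not at hc
    exact lt_irrefl' _ (lt_trans' hc.1 hc.2)
  toDecidableLE := Classical.decRel _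

theorem le_iff_exists_add' (a b : M.N) : a ≤ b ↔ ∃ c, b = a + c := by
  rw [le_iff_lt_or_eq, lt_iff_exists]
  constructor
  · rintro (⟨c, rfl⟩ | rfl)
    · exact ⟨c + 1, by ring⟩
    · exact ⟨0, by simp⟩
  · rintro ⟨c, rfl⟩
    rcases zero_or_succ c with rfl | ⟨d, rfl⟩
    · right; simp
    · left; exact ⟨d, by ring⟩

theorem zero_le' (a : M.N) : 0 ≤ a := M.not_lt_zero a

instance : IsStrictOrderedRing M.N where
  add_le_add_left a b h c := by
    obtain ⟨d, rfl⟩ := (le_iff_exists_add' _ _).1 h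
    exact (le_iff_exists_add' _ _).2 ⟨d, by ring⟩
  le_of_add_le_add_left a b c h := by
    obtain ⟨d, hd⟩ := (le_iff_exists_add' _ _).1 h
    refine (le_iff_exists_add' _ _).2 ⟨d, M.add_right_cancel' (c := a) ?_⟩
    rw [M.add_comm, hd]; ring
  zero_le_one := zero_le' 1
  exists_pair_ne := ⟨0, 0 + 1, fun h => M.succ_ne_zero 0 h.symm⟩
  mul_lt_mul_of_pos_left _ ha _ _ h := by
    obtain ⟨d, rfl⟩ := (lt_iff_exists _ _).1 h
    obtain ⟨e, rfl⟩ := (lt_iff_exists _ _).1 ha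
    exact (lt_iff_exists _ _).2 ⟨e * d + e + d, by ring⟩
  mul_lt_mul_of_pos_right _ ha _ _ h := by
    obtain ⟨d, rfl⟩ := (lt_iff_exists _ _).1 h
    obtain ⟨e, rfl⟩ := (lt_iff_exists _ _).1 ha
    exact (lt_iff_exists _ _).2 ⟨e * d + e + d, by ring⟩

instance : CanonicallyOrderedAdd M.N where
  exists_add_of_le h := (le_iff_exists_add' _ _).1 h
  le_self_add _ b := (le_iff_exists_add' _ _).2 ⟨b, rfl⟩
  le_add_self _ b := (le_iff_exists_add' _ _).2 ⟨b, M.add_comm _ _⟩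

theorem lt_add_one_iff' {a b : M.N} : a < b + 1 ↔ a ≤ b := by
  rw [M.lt_succ, le_iff_lt_or_eq]

theorem succ_le_iff' {a b : M.N} : a + 1 ≤ b ↔ a < b := by
  rw [← not_lt, lt_add_one_iff', not_le]

instance dec_le {X : Type} [Tup M X] {F G : X → M.N} [M.Rep F] [M.Rep G] :
    M.Dec fun x => F x ≤ G x := inferInstanceAs (M.Dec fun x => ¬ G x < F x)

/-- The least number principle for decidable predicates. -/
theorem exists_least {P : M.N → Prop} [h : M.Dec fun x : Unit × M.N => P x.2] (hP : ∃ n, P n) :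
    ∃ n, P n ∧ ∀ m < n, ¬ P m := by
  by_contra! hno
  have key : ∀ n, ∀ m, m < n → ¬ P m := fun n => by
    have : M.Dec fun x : (Unit × M.N) × M.N => P x.2 :=
      h.comp inferInstance
    induction n using induction with
    | h => infer_instance
    | h0 => exact fun m hm => (M.not_lt_zero m hm).elim
    | hs n ih =>
      intro m hm hPm
      rcases (M.lt_succ _ _).1 hm with hm | rfl
      · exact ih m hm hPm
      · obtain ⟨k, hk, hPk⟩ := hno m hPm
        exact ih k hk hPk
  obtain ⟨n, hn⟩ := hP
  exact key _ n (lt_add_one n) hn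

end arith

end Model

end HigherOrderArithmetic

/-! ### External ordered fields for the values of rationals and reals. -/

namespace HigherOrderArithmetic

/-! ### The ordered field of fractions of an ordered semiring -/

section Differences

variable (N : Type) [CommSemiring N] [LinearOrder N] [IsStrictOrderedRing N]

/-- Pairs with the same difference. -/
def diffSetoid : Setoid (N × N) where
  r p q := p.1 + q.2 = q.1 + p.2
  iseqv :=
    ⟨fun _ => rfl, fun h => h.symm, fun {p q r} h h' => by
      refine add_right_cancel (b := q.1 + q.2) ?_
      calc p.1 + r.2 + (q.1 + q.2) = (p.1 + q.2) + (q.1 + r.2) := by ring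
        _ = (q.1 + p.2) + (r.1 + q.2) := by rw [h, h']
        _ = _ := by ring⟩

/-- Formal differences. -/
def Diff : Type := Quotient (diffSetoid N)

namespace Diff

variable {N}

/-- The formal difference `a - b`. -/
def mk (a b : N) : Diff N := Quotient.mk (diffSetoid N) (a, b)

theorem mk_eq_mk {a b c d : N} : mk a b = mk c d ↔ a + d = c + b :=
  Quotient.eq (r := diffSetoid N)

theorem ind {P : Diff N → Prop} (h : ∀ a b, P (mk a b)) (x : Diff N) : P x :=
  Quotient.inductionOn x fun p => h p.1 p.2

instance : Zero (Diff N) := ⟨mk 0 0⟩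
instance : One (Diff N) := ⟨mk 1 0⟩
instance : Neg (Diff N) := ⟨Quotient.map (fun p => (p.2, p.1)) fun p q (h : _ = _) => by
  change p.2 + q.1 = q.2 + p.1
  rw [add_comm, ← h, add_comm]⟩
instance : Add (Diff N) := ⟨Quotient.map₂ (fun p q => (p.1 + q.1, p.2 + q.2))
  fun p p' (h : _ = _) q q' (h' : _ = _) => by
    change p.1 + q.1 + (p'.2 + q'.2) = p'.1 + q'.1 + (p.2 + q.2)
    calc _ = (p.1 + p'.2) + (q.1 + q'.2) := by ring
      _ = _ := by rw [h, h']; ring⟩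
instance : Mul (Diff N) := ⟨Quotient.map₂ (fun p q => (p.1 * q.1 + p.2 * q.2, p.1 * q.2 + p.2 * q.1))
  fun p p' (h : _ = _) q q' (h' : _ = _) => by
    change p.1 * q.1 + p.2 * q.2 + (p'.1 * q'.2 + p'.2 * q'.1) =
      p'.1 * q'.1 + p'.2 * q'.2 + (p.1 * q.2 + p.2 * q.1)
    -- A semiring offers cancellation but no subtraction, so cross terms are added on both sides to
    -- bring in the two hypotheses.
    refine add_right_cancel (b := p'.1 * q.2 + p'.2 * q.1 + (p'.1 * q.1 + p'.2 * q.2)) ?_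
    calc _ = (p.1 + p'.2) * q.1 + (p'.1 + p.2) * q.2 + p'.1 * (q'.2 + q.1) +
          p'.2 * (q'.1 + q.2) := by ring
      _ = (p'.1 + p.2) * q.1 + (p.1 + p'.2) * q.2 + p'.1 * (q'.1 + q.2) +
          p'.2 * (q.1 + q'.2) := by rw [h, h', add_comm q'.2 q.1, h']
      _ = _ := by ring⟩

theorem zero_def : (0 : Diff N) = mk 0 0 := rfl
theorem one_def : (1 : Diff N) = mk 1 0 := rfl
theorem neg_mk (a b : N) : -mk a b = mk b a := rfl
theorem mk_add_mk (a b c d : N) : mk a b + mk c d = mk (a + c) (b + d) := rfl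
theorem mk_mul_mk (a b c d : N) : mk a b * mk c d = mk (a * c + b * d) (a * d + b * c) := rfl

instance : CommRing (Diff N) where
  add_assoc x y z := by
    induction x using ind; induction y using ind; induction z using ind
    simp only [mk_add_mk, add_assoc]
  zero_add x := by
    induction x using ind
    simp only [zero_def, mk_add_mk, zero_add]
  add_zero x := by
    induction x using ind
    simp only [zero_def, mk_add_mk, add_zero]
  add_comm x y := by
    induction x using ind; induction y using ind
    simp only [mk_add_mk, mk_eq_mk]; ring
  neg_add_cancel x := by
    induction x using ind
    simp only [neg_mk, mk_add_mk, zero_def, mk_eq_mk]; ring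
  nsmul := nsmulRec
  zsmul := zsmulRec
  left_distrib x y z := by
    induction x using ind; induction y using ind; induction z using ind
    simp only [mk_add_mk, mk_mul_mk, mk_eq_mk]; ring
  right_distrib x y z := by
    induction x using ind; induction y using ind; induction z using ind
    simp only [mk_add_mk, mk_mul_mk, mk_eq_mk]; ring
  zero_mul x := by
    induction x using ind
    simp only [zero_def, mk_mul_mk, mk_eq_mk]; ring
  mul_zero x := by
    induction x using ind
    simp only [zero_def, mk_mul_mk, mk_eq_mk]; ring
  mul_assoc x y z := by
    induction x using ind; induction y using ind; induction z using ind
    simp only [mk_mul_mk, mk_eq_mk]; ring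
  one_mul x := by
    induction x using ind
    simp only [one_def, mk_mul_mk, mk_eq_mk]; ring
  mul_one x := by
    induction x using ind
    simp only [one_def, mk_mul_mk, mk_eq_mk]; ring
  mul_comm x y := by
    induction x using ind; induction y using ind
    simp only [mk_mul_mk, mk_eq_mk]; ring

/-- The embedding of the semiring. -/
def of : N →+* Diff N where
  toFun a := mk a 0
  map_zero' := rfl
  map_one' := rfl
  map_add' a b := by rw [mk_add_mk, add_zero]
  map_mul' a b := by simp [mk_mul_mk]

theorem of_injective : Function.Injective (of (N := N)) := fun a b h => by
  simpa using mk_eq_mk.1 h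

variable [CanonicallyOrderedAdd N]

theorem eq_of_or_neg (x : Diff N) : ∃ a, x = of a ∨ x = -of a := by
  induction x using ind with | h a b => ?_
  rcases le_total b a with h | h <;> obtain ⟨c, rfl⟩ := exists_add_of_le h
  · exact ⟨c, .inl (mk_eq_mk.2 (by ring))⟩
  · exact ⟨c, .inr (mk_eq_mk.2 (by ring))⟩

instance : Nontrivial (Diff N) := of_injective.nontrivial

instance : NoZeroDivisors (Diff N) where
  eq_zero_or_eq_zero_of_mul_eq_zero {x y} h := by
    obtain ⟨a, ha⟩ := eq_of_or_neg x
    obtain ⟨b, hb⟩ := eq_of_or_neg y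
    have hab : of (a * b) = (0 : Diff N) := by
      rw [map_mul]
      rcases ha with rfl | rfl <;> rcases hb with rfl | rfl <;> simpa using h
    have : a * b = 0 := of_injective (hab.trans (map_zero _).symm)
    rcases mul_eq_zero.1 this with rfl | rfl
    · left; simpa using ha
    · right; simpa using hb

instance : IsDomain (Diff N) := NoZeroDivisors.to_isDomain _

end Diff

variable [CanonicallyOrderedAdd N]

/-- The field of fractions of an ordered semiring. -/
def Frac : Type := FractionRing (Diff N)

namespace Frac

noncomputable instance : Field (Frac N) := inferInstanceAs (Field (FractionRing (Diff N)))

variable {N}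

/-- The embedding of the semiring. -/
noncomputable def of : N →+* Frac N := (algebraMap (Diff N) (FractionRing (Diff N))).comp Diff.of

theorem of_injective : Function.Injective (of (N := N)) :=
  (IsFractionRing.injective (Diff N) (FractionRing (Diff N))).comp Diff.of_injective

theorem of_eq_zero {a : N} : of a = 0 ↔ a = 0 := map_eq_zero_iff _ of_injective

theorem exists_eq (x : Frac N) : ∃ a c : N, c ≠ 0 ∧ (x = of a / of c ∨ x = -(of a / of c)) := by
  obtain ⟨y, z, hz, rfl⟩ := IsFractionRing.div_surjective (A := Diff N) (K := FractionRing (Diff N)) x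
  have hz := nonZeroDivisors.ne_zero hz
  obtain ⟨a, ha⟩ := Diff.eq_of_or_neg y
  obtain ⟨c, hc⟩ := Diff.eq_of_or_neg z
  refine ⟨a, c, ?_, ?_⟩
  · rintro rfl
    simp at hc
    exact hz hc
  · rcases ha with rfl | rfl <;> rcases hc with rfl | rfl
    · exact .inl rfl
    · right; rw [map_neg, div_neg]; rfl
    · right; rw [map_neg, neg_div]; rfl
    · left; rw [map_neg, map_neg, neg_div_neg_eq]; rfl

/-- The nonnegative fractions. -/
noncomputable def cone : RingCone (Frac N) where
  carrier := {x | ∃ a c : N, c ≠ 0 ∧ x = of a / of c}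
  zero_mem' := ⟨0, 1, one_ne_zero, by simp⟩
  one_mem' := ⟨1, 1, one_ne_zero, by simp⟩
  add_mem' := by
    rintro _ _ ⟨a, c, hc, rfl⟩ ⟨b, d, hd, rfl⟩
    refine ⟨a * d + c * b, c * d, mul_ne_zero hc hd, ?_⟩
    rw [div_add_div _ _ (of_eq_zero.not.2 hc) (of_eq_zero.not.2 hd)]
    simp
  mul_mem' := by
    rintro _ _ ⟨a, c, hc, rfl⟩ ⟨b, d, hd, rfl⟩
    refine ⟨a * b, c * d, mul_ne_zero hc hd, ?_⟩
    rw [div_mul_div_comm]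
    simp
  eq_zero_of_mem_of_neg_mem' := by
    rintro _ ⟨a, c, hc, rfl⟩ ⟨b, d, hd, h⟩
    have hc' := of_eq_zero.not.2 hc
    have hd' := of_eq_zero.not.2 hd
    have : of (a * d + c * b) = 0 := by
      have := neg_eq_iff_add_eq_zero.1 h
      rw [div_add_div _ _ hc' hd', div_eq_zero_iff] at this
      simpa [hc', hd'] using this
    have h0 : a * d = 0 := (add_eq_zero.1 (of_eq_zero.1 this)).1
    rcases mul_eq_zero.1 h0 with rfl | h0
    · simp
    · exact (hd h0).elim

instance : HasMemOrNegMem (cone (N := N)) where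
  mem_or_neg_mem x := by
    obtain ⟨a, c, hc, h | h⟩ := exists_eq x
    · exact .inl ⟨a, c, hc, h⟩
    · exact .inr ⟨a, c, hc, by rw [h, neg_neg]⟩

noncomputable instance : LinearOrder (Frac N) :=
  have : DecidablePred (· ∈ cone (N := N)) := Classical.decPred _
  LinearOrder.mkOfAddGroupCone cone

instance : IsOrderedRing (Frac N) := IsOrderedRing.mkOfCone cone

instance : IsStrictOrderedRing (Frac N) := inferInstance

theorem of_nonneg (a : N) : 0 ≤ of a := by
  change of a - 0 ∈ cone
  exact ⟨a, 1, one_ne_zero, by simp⟩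

theorem of_lt_of {a b : N} : of a < of b ↔ a < b :=
  StrictMono.lt_iff_lt (f := of) fun a b h => by
    obtain ⟨c, rfl⟩ := exists_add_of_le h.le
    rw [map_add]
    refine lt_add_of_pos_right _ ((of_nonneg c).lt_of_ne' (of_eq_zero.not.2 ?_))
    rintro rfl
    simp at h

theorem of_le_of {a b : N} : of a ≤ of b ↔ a ≤ b := by
  rw [← not_lt, of_lt_of, not_lt]

end Frac

end Differences

end HigherOrderArithmetic

namespace HigherOrderArithmetic

/-! ### A field with limits of Cauchy sequences of arbitrary length -/

section Completion

open Filter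

variable (K : Type) [Field K] [LinearOrder K] [IsStrictOrderedRing K]
  (N : Type) [LinearOrder N] [Nonempty N]

/-- An ultrafilter at infinity. -/
noncomputable def atTopUlt : Ultrafilter N := Ultrafilter.of atTop

/-- Germs of sequences at infinity. -/
abbrev Seqs : Type := Germ (atTopUlt N : Filter N) K

/-- The germs of bounded sequences. -/
noncomputable def boundedSeqs : ValuationSubring (Seqs K N) where
  carrier := {g | ∃ k : K, |g| ≤ (k : Seqs K N)}
  zero_mem' := ⟨0, abs_zero.le⟩
  one_mem' := ⟨1, abs_one.le⟩
  add_mem' := by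
    rintro a b ⟨k, hk⟩ ⟨l, hl⟩
    exact ⟨k + l, (abs_add_le a b).trans (add_le_add hk hl)⟩
  mul_mem' := by
    rintro a b ⟨k, hk⟩ ⟨l, hl⟩
    refine ⟨k * l, ?_⟩
    rw [abs_mul]
    exact mul_le_mul hk hl (abs_nonneg _) ((abs_nonneg _).trans hk)
  neg_mem' := by
    rintro a ⟨k, hk⟩
    exact ⟨k, by rwa [abs_neg]⟩
  -- A germ of absolute value at least `1` has a bounded inverse. So the bounded germs form a
  -- valuation ring, and its maximal ideal consists of the germs that are infinitesimal relative to
  -- `K`.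
  mem_or_inv_mem' x := by
    rcases le_total |x| 1 with h | h
    · exact .inl ⟨1, h⟩
    · refine .inr ⟨1, ?_⟩
      rw [abs_inv]
      exact inv_le_one_of_one_le₀ h

variable {K N} in
theorem mem_boundedSeqs {g : Seqs K N} : g ∈ boundedSeqs K N ↔ ∃ k : K, |g| ≤ (k : Seqs K N) :=
  Iff.rfl

/-- Bounded sequences up to infinitesimals. -/
def Compl : Type := IsLocalRing.ResidueField (boundedSeqs K N)

namespace Compl

noncomputable instance : Field (Compl K N) :=
  inferInstanceAs (Field (IsLocalRing.ResidueField (boundedSeqs K N)))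

variable {K N}

/-- The class of a bounded sequence. -/
noncomputable def res : boundedSeqs K N →+* Compl K N := IsLocalRing.residue (boundedSeqs K N)

theorem res_surjective : Function.Surjective (res (K := K) (N := N)) :=
  IsLocalRing.residue_surjective

/-- A non-zero residue comes from a unit, and a bound for the inverse is a lower bound for `|x|`. -/
theorem exists_of_res_ne_zero {x : boundedSeqs K N} (h : res x ≠ 0) :
    ∃ k : K, 0 < k ∧ (k : Seqs K N) ≤ |x.1| := by
  have hu : IsUnit x := by
    by_contra hx
    exact h ((IsLocalRing.residue_eq_zero_iff x).2 ((IsLocalRing.mem_maximalIdeal x).2 hx))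
  obtain ⟨y, hy⟩ := hu.exists_right_inv
  have hxy : x.1 * y.1 = 1 := congrArg Subtype.val hy
  obtain ⟨k, hk⟩ := mem_boundedSeqs.1 y.2
  have hy0 : 0 < |y.1| := abs_pos.2 (right_ne_zero_of_mul_eq_one hxy)
  have hk0 : (0 : Seqs K N) < (k : Seqs K N) := hy0.trans_le hk
  refine ⟨k⁻¹, inv_pos.2 (Germ.const_lt_iff.1 hk0), ?_⟩
  rw [Germ.const_inv, eq_inv_of_mul_eq_one_left hxy, abs_inv]
  exact inv_anti₀ hy0 hk

theorem res_eq_zero_of_le {x y : boundedSeqs K N} (hx : 0 ≤ x.1) (hxy : x.1 ≤ y.1)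
    (hy : res y = 0) : res x = 0 := by
  by_contra h
  obtain ⟨k, hk, hkx⟩ := exists_of_res_ne_zero h
  rw [abs_of_nonneg hx] at hkx
  have hk' : (0 : Seqs K N) < (k : Seqs K N) := Germ.const_lt hk
  have hky := hkx.trans hxy
  have hy0 : y.1 ≠ 0 := (hk'.trans_le hky).ne'
  have hm : y.1⁻¹ ∈ boundedSeqs K N := by
    refine mem_boundedSeqs.2 ⟨k⁻¹, ?_⟩
    rw [Germ.const_inv, abs_inv, abs_of_pos (hk'.trans_le hky)]
    exact inv_anti₀ hk' hky
  have : y * ⟨_, hm⟩ = 1 := Subtype.ext (mul_inv_cancel₀ hy0)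
  have h1 := congrArg res this
  rw [map_mul, hy, zero_mul, map_one] at h1
  exact zero_ne_one h1

/-- The nonnegative classes. -/
noncomputable def cone : RingCone (Compl K N) where
  carrier := {r | ∃ x : boundedSeqs K N, 0 ≤ x.1 ∧ r = res x}
  zero_mem' := ⟨0, le_rfl, (map_zero _).symm⟩
  one_mem' := ⟨1, zero_le_one (α := Seqs K N), (map_one _).symm⟩
  add_mem' := by
    rintro _ _ ⟨x, hx, rfl⟩ ⟨y, hy, rfl⟩
    exact ⟨x + y, add_nonneg hx hy, (map_add _ _ _).symm⟩
  mul_mem' := by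
    rintro _ _ ⟨x, hx, rfl⟩ ⟨y, hy, rfl⟩
    exact ⟨x * y, mul_nonneg hx hy, (map_mul _ _ _).symm⟩
  eq_zero_of_mem_of_neg_mem' := by
    rintro _ ⟨x, hx, rfl⟩ ⟨y, hy, h⟩
    refine res_eq_zero_of_le (y := x + y) hx (le_add_of_nonneg_right hy) ?_
    rw [map_add, ← h, add_neg_cancel]

instance : HasMemOrNegMem (cone (K := K) (N := N)) where
  mem_or_neg_mem r := by
    obtain ⟨x, rfl⟩ := res_surjective r
    rcases le_total 0 x.1 with h | h
    · exact .inl ⟨x, h, rfl⟩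
    · exact .inr ⟨-x, neg_nonneg.2 h, (map_neg _ _).symm⟩

noncomputable instance : LinearOrder (Compl K N) :=
  have : DecidablePred (· ∈ cone (K := K) (N := N)) := Classical.decPred _
  LinearOrder.mkOfAddGroupCone cone

instance : IsOrderedRing (Compl K N) := IsOrderedRing.mkOfCone cone

instance : IsStrictOrderedRing (Compl K N) := inferInstance

theorem res_mono {x y : boundedSeqs K N} (h : x.1 ≤ y.1) : res x ≤ res y := by
  change res y - res x ∈ cone
  exact ⟨y - x, sub_nonneg.2 h, (map_sub _ _ _).symm⟩

theorem const_mem (k : K) : (k : Seqs K N) ∈ boundedSeqs K N :=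
  mem_boundedSeqs.2 ⟨|k|, (Germ.const_abs k).ge⟩

/-- A constant sequence. -/
noncomputable def cst (k : K) : boundedSeqs K N := ⟨(k : Seqs K N), const_mem k⟩

variable (N) in
/-- The class of a constant sequence. -/
noncomputable def const : K →+* Compl K N where
  toFun k := res (cst k)
  map_zero' := map_zero res
  map_one' := map_one res
  map_add' k l := map_add res (cst k) (cst l)
  map_mul' k l := map_mul res (cst k) (cst l)

theorem const_le_const {k l : K} (h : k ≤ l) : const N k ≤ const N l :=
  res_mono (x := cst k) (y := cst l) (Germ.const_le h)

theorem const_strictMono : StrictMono (const N : K → Compl K N) :=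
  have h : Monotone (const N : K → Compl K N) := fun _ _ h => const_le_const h
  h.strictMono_of_injective (RingHom.injective (const N : K →+* Compl K N))

/-- No positive element lies below all positive constants. Convergence in the completion can
therefore be tested with bounds from `K`, and later with powers of `1 / 2` alone. -/
theorem exists_const_le {r : Compl K N} (h : 0 < r) : ∃ k : K, 0 < k ∧ const N k ≤ r := by
  obtain ⟨x, rfl⟩ := res_surjective r
  obtain ⟨k, hk, hkx⟩ := exists_of_res_ne_zero h.ne'
  refine ⟨k, hk, ?_⟩
  rcases le_total 0 x.1 with h0 | h0
  · rw [abs_of_nonneg h0] at hkx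
    exact res_mono (x := cst k) hkx
  · have : res x ≤ res 0 := res_mono h0
    rw [map_zero] at this
    exact (this.not_gt h).elim

open Classical in
/-- The limit of a sequence; it has a meaning for Cauchy sequences. -/
noncomputable def lim (x : N → K) : Compl K N :=
  if h : (x : Seqs K N) ∈ boundedSeqs K N then res ⟨x, h⟩ else 0

/-- The ultrafilter refines `atTop`, so an estimate valid from some index on holds for the germ and
passes to its residue. This is the only property of limits that is needed. -/
theorem abs_lim_sub_le {x : N → K} {c k : K} (h : ∀ᶠ n in atTop, |x n - c| ≤ k) :
    |lim x - const N c| ≤ const N k := by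
  have h' : ∀ᶠ n in (atTopUlt N : Filter N), |x n - c| ≤ k := Ultrafilter.of_le _ h
  have h1 : (x : Seqs K N) ≤ ((c + k : K) : Seqs K N) :=
    Germ.coe_le.2 (h'.mono fun n hn => by linarith [(abs_le.1 hn).2])
  have h2 : ((c - k : K) : Seqs K N) ≤ (x : Seqs K N) :=
    Germ.coe_le.2 (h'.mono fun n hn => by
      change c - k ≤ x n
      linarith [(abs_le.1 hn).1])
  have hm : (x : Seqs K N) ∈ boundedSeqs K N := by
    refine mem_boundedSeqs.2 ⟨|c| + k, ?_⟩
    rw [abs_le]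
    constructor
    · refine le_trans ?_ h2
      rw [← Germ.const_neg]
      exact Germ.const_le (by linarith [neg_abs_le c])
    · exact h1.trans (Germ.const_le (by linarith [le_abs_self c]))
  have h3 : lim x ≤ const N (c + k) := by
    rw [lim, dif_pos hm]
    exact res_mono (x := ⟨_, hm⟩) (y := cst (c + k)) h1
  have h4 : const N (c - k) ≤ lim x := by
    rw [lim, dif_pos hm]
    exact res_mono (x := cst (c - k)) (y := ⟨_, hm⟩) h2
  rw [map_add] at h3
  rw [map_sub] at h4
  rw [abs_le]
  constructor <;> linarith

end Compl

end Completion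

end HigherOrderArithmetic

/-! ### Rationals and reals of a model, with values in the external fields. -/

namespace HigherOrderArithmetic

local infixr:60 " ⇒ " => Ty.arr

namespace Model

variable (M : Model)

set_option synthInstance.maxSize 4000
set_option synthInstance.maxHeartbeats 400000

/-! ### Rational numbers in a model -/

/-- The rational numbers of the model. -/
abbrev Q : Type := Frac M.N

/-- The field in which the real numbers of the model have their values. -/
abbrev R : Type := Compl M.Q M.N

variable {M}

section Den

variable {c : Ctx M.toPreStr}

instance den_zero' : (0 : Exp .nat).Den c (0 : M.N) := HigherOrderArithmetic.den_zero

instance den_one' : (1 : Exp .nat).Den c (1 : M.N) := HigherOrderArithmetic.den_one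

variable {x y : Exp .nat} {a b : M.N} [hx : x.Den c a] [hy : y.Den c b]

instance den_add' : (x + y).Den c (a + b) := HigherOrderArithmetic.den_add

instance den_mul' : (x * y).Den c (a * b) := HigherOrderArithmetic.den_mul

instance den_ltN' : (ltN x y).Den c (a < b) := HigherOrderArithmetic.den_ltN

instance den_leN : (leN x y).Den c (a ≤ b) :=
  Form.Den.congr (A := neg (ltN y x)) (P := ¬ b < a) inferInstance not_lt

end Den

/-- The power `2 ^ n`. -/
def pw (n : M.N) : M.N :=
  M.app (M.app (M.app (M.con (.recursor .nat))
    (M.app (M.app (M.con (.combSigma .nat .nat .nat)) (M.con .add))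
      (M.app (M.app (M.con (.combSigma .nat .one .nat)) (M.con (.combPi .nat .one)))
        (M.con (.combPi .nat .nat))))) 1) n

theorem pw_zero : M.pw 0 = 1 := recursor_zero _ _

theorem pw_succ (n : M.N) : M.pw (n + 1) = M.pw n + M.pw n := by
  rw [pw, recursor_succ, combSigma_app, combSigma_app, combPi_app]
  rfl

instance rep_pw {X : Type} [Tup M X] {F : X → M.N} [M.Rep F] : M.Rep fun x => pw (F x) :=
  rep_app

instance den_pow2 {c : Ctx M.toPreStr} {x : NatE} {a : M.N} [x.Den c a] :
    (pow2 x).Den c (pw a) := HigherOrderArithmetic.den_app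

theorem lt_pw (n : M.N) : n < pw n := by
  induction n using induction with
  | h => infer_instance
  | h0 => rw [pw_zero]; exact zero_lt_one
  | hs n ih =>
    rw [pw_succ]
    have := add_lt_add_of_lt_of_le ih (succ_le_iff'.2 ((zero_le' n).trans_lt ih))
    rwa [M.zero_add] at this

theorem pw_pos (n : M.N) : 0 < pw n := (zero_le' n).trans_lt (lt_pw n)

theorem pw_add (m n : M.N) : pw (m + n) = pw m * pw n := by
  induction n using induction with
  | h => infer_instance
  | h0 => rw [pw_zero, M.add_zero, mul_one]
  | hs n ih => rw [M.add_succ, pw_succ, pw_succ, ih]; ring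

/-- `q` codes `(a - b) / c`. -/
def CodesRat (q a b c : M.N) : Prop :=
  ∃ n m : M.N, q + q = (n + m) * (n + m + 1) + (n + n) ∧ c = m + 1 ∧
    ((n = a + a ∧ b = 0) ∨ (n + 1 = b + b ∧ a = 0))

instance den_codesRat {c : Ctx M.toPreStr} {x y z w : NatE} {q i j k : M.N} [x.Den c q] [y.Den c i]
    [z.Den c j] [w.Den c k] : (codesRat x y z w).Den c (CodesRat q i j k) := by
  unfold codesRat CodesRat exN
  infer_instance

instance dec_codesRat {X : Type} [Tup M X] {F G H K : X → M.N} [M.Rep F] [M.Rep G] [M.Rep H]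
    [M.Rep K] : M.Dec fun x => CodesRat (F x) (G x) (H x) (K x) := by
  unfold CodesRat
  infer_instance

/-- Induction along the antidiagonals: the pair after `(n, m + 1)` is `(n + 1, m)`, and the pair
after `(n, 0)` is `(0, n + 1)`. -/
theorem exists_unpair (q : M.N) : ∃ n m : M.N, q + q = (n + m) * (n + m + 1) + (n + n) := by
  induction q using induction with
  | h => infer_instance
  | h0 => exact ⟨0, 0, by simp⟩
  | hs q ih =>
    obtain ⟨n, m, h⟩ := ih
    rcases zero_or_succ m with rfl | ⟨m, rfl⟩
    · refine ⟨0, n + 1, ?_⟩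
      calc q + 1 + (q + 1) = q + q + 2 := by ring
        _ = _ := by rw [h]; ring
    · refine ⟨n + 1, m, ?_⟩
      calc q + 1 + (q + 1) = q + q + 2 := by ring
        _ = _ := by rw [h]; ring

theorem exists_half (s : M.N) : (∃ a, s = a + a) ∨ ∃ a, s + 1 = a + a := by
  induction s using induction with
  | h => infer_instance
  | h0 => exact .inl ⟨0, by simp⟩
  | hs s ih =>
    rcases ih with ⟨a, rfl⟩ | ⟨a, h⟩
    · exact .inr ⟨a + 1, by ring⟩
    · exact .inl ⟨a, h⟩

theorem double_ne (a b : M.N) : a + a + 1 ≠ b + b := fun h => by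
  rcases lt_or_ge a b with hab | hab
  · have h1 := succ_le_iff'.2 hab
    have h2 := add_le_add h1 h1
    rw [← h] at h2
    have : a + 1 + (a + 1) = a + a + 1 + 1 := by ring
    rw [this, succ_le_iff'] at h2
    exact lt_irrefl _ h2
  · have h2 := add_le_add hab hab
    rw [← h, succ_le_iff'] at h2
    exact lt_irrefl _ h2

theorem double_injective {a b : M.N} (h : a + a = b + b) : a = b := by
  rcases lt_trichotomy a b with h' | h' | h'
  · exact ((add_lt_add h' h').ne h).elim
  · exact h'
  · exact ((add_lt_add h' h').ne h.symm).elim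

theorem exists_pair_code (n m : M.N) : ∃ q : M.N, q + q = (n + m) * (n + m + 1) + (n + n) := by
  have : ∃ t, (n + m) * (n + m + 1) = t + t := by
    rcases exists_half (n + m) with ⟨a, h⟩ | ⟨a, h⟩
    · exact ⟨a * (n + m + 1), by rw [← add_mul, ← h]⟩
    · exact ⟨(n + m) * a, by rw [← mul_add, ← h]⟩
  obtain ⟨t, ht⟩ := this
  exact ⟨t + n, by rw [ht]; ring⟩

/-- Doubled codes on the antidiagonal `s` lie between `s (s + 1)` and `s (s + 1) + 2 s`, which is
below `(s + 1) (s + 2)`. So the code determines `s`, and then `n`. -/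
theorem unpair_unique {n m n' m' : M.N}
    (h : (n + m) * (n + m + 1) + (n + n) = (n' + m') * (n' + m' + 1) + (n' + n')) :
    n = n' ∧ m = m' := by
  have key : ∀ n m n' m' : M.N, n + m < n' + m' →
      (n + m) * (n + m + 1) + (n + n) < (n' + m') * (n' + m' + 1) + (n' + n') := by
    intro n m n' m' h
    have h1 := succ_le_iff'.2 h
    calc (n + m) * (n + m + 1) + (n + n) ≤ (n + m) * (n + m + 1) + (n + m + (n + m)) :=
          add_le_add_right (add_le_add (le_self_add) le_self_add) _
      _ < (n + m + 1) * (n + m + 1 + 1) := by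
          have : (n + m + 1) * (n + m + 1 + 1) =
            (n + m) * (n + m + 1) + (n + m + (n + m)) + (1 + 1) := by ring
          rw [this]
          exact lt_add_of_pos_right _ (add_pos zero_lt_one zero_lt_one)
      _ ≤ (n' + m') * (n' + m' + 1) := mul_le_mul' h1 (add_le_add_left h1 1)
      _ ≤ _ := le_self_add
  have hs : n + m = n' + m' := by
    rcases lt_trichotomy (n + m) (n' + m') with h' | h' | h'
    · exact ((key _ _ _ _ h').ne h).elim
    · exact h'
    · exact ((key _ _ _ _ h').ne h.symm).elim
  rw [hs] at h
  have hn := double_injective (add_left_cancel h)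
  exact ⟨hn, add_left_cancel (hs.trans (by rw [hn]))⟩

theorem exists_codesRat (q : M.N) : ∃ a b c : M.N, CodesRat q a b c := by
  obtain ⟨n, m, h⟩ := exists_unpair q
  rcases exists_half n with ⟨a, ha⟩ | ⟨b, hb⟩
  · exact ⟨a, 0, m + 1, n, m, h, rfl, .inl ⟨ha, rfl⟩⟩
  · exact ⟨0, b, m + 1, n, m, h, rfl, .inr ⟨hb, rfl⟩⟩

theorem CodesRat.unique {q a b c a' b' c' : M.N} (h : CodesRat q a b c)
    (h' : CodesRat q a' b' c') : a = a' ∧ b = b' ∧ c = c' := by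
  obtain ⟨n, m, hq, rfl, hn⟩ := h
  obtain ⟨n', m', hq', rfl, hn'⟩ := h'
  obtain ⟨rfl, rfl⟩ := unpair_unique (hq.symm.trans hq')
  rcases hn with ⟨h1, rfl⟩ | ⟨h1, rfl⟩ <;> rcases hn' with ⟨h2, rfl⟩ | ⟨h2, rfl⟩
  · exact ⟨double_injective (h1.symm.trans h2), rfl, rfl⟩
  · rw [h1] at h2; exact (double_ne _ _ h2).elim
  · rw [h2] at h1; exact (double_ne _ _ h1).elim
  · exact ⟨rfl, double_injective (h1.symm.trans h2), rfl⟩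

theorem CodesRat.ne_zero {q a b c : M.N} (h : CodesRat q a b c) : c ≠ 0 := by
  obtain ⟨n, m, -, rfl, -⟩ := h
  exact M.succ_ne_zero m

theorem exists_rat (q : M.N) : ∃ x : M.Q, ∀ a b c, CodesRat q a b c →
    x = (Frac.of a - Frac.of b) / Frac.of c := by
  obtain ⟨a, b, c, h⟩ := exists_codesRat q
  refine ⟨(Frac.of a - Frac.of b) / Frac.of c, fun a' b' c' h' => ?_⟩
  obtain ⟨rfl, rfl, rfl⟩ := h.unique h'
  rfl

/-- The rational with the code `q`. -/
noncomputable def rat (q : M.N) : M.Q := (exists_rat q).choose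

theorem CodesRat.rat_eq {q a b c : M.N} (h : CodesRat q a b c) :
    rat q = (Frac.of a - Frac.of b) / Frac.of c := (exists_rat q).choose_spec a b c h

theorem rat_surjective (x : M.Q) : ∃ q, rat q = x := by
  obtain ⟨a, c, hc, h⟩ := Frac.exists_eq x
  obtain ⟨m, rfl⟩ := (zero_or_succ c).resolve_left hc
  rcases h with rfl | rfl
  · obtain ⟨q, hq⟩ := exists_pair_code (a + a) m
    refine ⟨q, ?_⟩
    have h : CodesRat q a 0 (m + 1) := ⟨_, _, hq, rfl, .inl ⟨rfl, rfl⟩⟩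
    rw [h.rat_eq]
    simp
  -- The odd codes stand for strictly negative rationals only, so `-0` has to be coded with an even
  -- `n`.
  · rcases zero_or_succ a with rfl | ⟨b, rfl⟩
    · obtain ⟨q, hq⟩ := exists_pair_code (0 + 0) m
      refine ⟨q, ?_⟩
      have h : CodesRat q 0 0 (m + 1) := ⟨_, _, hq, rfl, .inl ⟨rfl, rfl⟩⟩
      rw [h.rat_eq]
      simp
    · obtain ⟨q, hq⟩ := exists_pair_code (b + b + 1) m
      refine ⟨q, ?_⟩
      have h : CodesRat q 0 (b + 1) (m + 1) := ⟨_, _, hq, rfl, .inr ⟨by ring, rfl⟩⟩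
      rw [h.rat_eq, map_zero, zero_sub, neg_div]

/-- The condition `A` on the parts of the rational with the code `q`. -/
def WithRat (q : M.N) (A : M.N → M.N → M.N → Prop) : Prop :=
  ∃ a b c, CodesRat q a b c ∧ A a b c

instance den_withRat {c : Ctx M.toPreStr} {x : NatE} {q : M.N} {A : NatE → NatE → NatE → Form}
    {P : M.N → M.N → M.N → Prop} [x.Den c q]
    [hA : ∀ (i : c.Named .nat) (j : i.ctx.Named .nat) (k : j.ctx.Named .nat),
      (A i.exp j.exp k.exp).Den k.ctx (P i.elt j.elt k.elt)] :
    (withRat x A).Den c (WithRat q P) := by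
  unfold withRat WithRat exN
  infer_instance

theorem CodesRat.withRat_iff {q a b c : M.N} (h : CodesRat q a b c)
    {A : M.N → M.N → M.N → Prop} : WithRat q A ↔ A a b c := by
  refine ⟨?_, fun hA => ⟨a, b, c, h, hA⟩⟩
  rintro ⟨a', b', c', h', hA⟩
  obtain ⟨rfl, rfl, rfl⟩ := h.unique h'
  exact hA

theorem of_pos {a : M.N} (h : a ≠ 0) : (0 : M.Q) < Frac.of a := by
  rw [← map_zero (Frac.of (N := M.N)), Frac.of_lt_of]
  exact pos_iff_ne_zero.2 h

theorem ratLtAdd_iff {p q u v : M.N} (hv : v ≠ 0) :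
    (WithRat p fun a b c => WithRat q fun a' b' c' =>
      v * (a * c' + b' * c) < v * (a' * c + b * c') + u * (c * c')) ↔
    rat p < rat q + Frac.of u / Frac.of v := by
  obtain ⟨a, b, c, h⟩ := exists_codesRat p
  obtain ⟨a', b', c', h'⟩ := exists_codesRat q
  have hc := of_pos h.ne_zero
  have hc' := of_pos h'.ne_zero
  have hv := of_pos hv
  rw [h.withRat_iff, h'.withRat_iff, h.rat_eq, h'.rat_eq, ← Frac.of_lt_of,
    div_add_div _ _ hc'.ne' hv.ne', div_lt_div_iff₀ hc (mul_pos hc' hv)]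
  simp only [map_mul, map_add]
  constructor <;> intro H <;> linarith

theorem ratLeAdd_iff {p q u v : M.N} (hv : v ≠ 0) :
    (WithRat p fun a b c => WithRat q fun a' b' c' =>
      v * (a * c' + b' * c) ≤ v * (a' * c + b * c') + u * (c * c')) ↔
    rat p ≤ rat q + Frac.of u / Frac.of v := by
  obtain ⟨a, b, c, h⟩ := exists_codesRat p
  obtain ⟨a', b', c', h'⟩ := exists_codesRat q
  have hc := of_pos h.ne_zero
  have hc' := of_pos h'.ne_zero
  have hv := of_pos hv
  rw [h.withRat_iff, h'.withRat_iff, h.rat_eq, h'.rat_eq, ← Frac.of_le_of,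
    div_add_div _ _ hc'.ne' hv.ne', div_le_div_iff₀ hc (mul_pos hc' hv)]
  simp only [map_mul, map_add]
  constructor <;> intro H <;> linarith

/-- The rational `2 ^ (-n)`. -/
noncomputable def eps (n : M.N) : M.Q := 1 / Frac.of (pw n)

theorem eps_pos (n : M.N) : 0 < eps n := one_div_pos.2 (of_pos (pw_pos n).ne')

section Den

variable {c : Ctx M.toPreStr} {x y z : NatE} {p q r n : M.N} [x.Den c p] [y.Den c q] [z.Den c r]

instance den_ratLtAdd {w : NatE} [w.Den c n] : (ratLtAdd x y z w).Den c
    (WithRat p fun a b c => WithRat q fun a' b' c' =>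
      n * (a * c' + b' * c) < n * (a' * c + b * c') + r * (c * c')) := by
  unfold ratLtAdd
  infer_instance

instance den_ratLeAdd {w : NatE} [w.Den c n] : (ratLeAdd x y z w).Den c
    (WithRat p fun a b c => WithRat q fun a' b' c' =>
      n * (a * c' + b' * c) ≤ n * (a' * c + b * c') + r * (c * c')) := by
  unfold ratLeAdd
  infer_instance

instance den_ratNear : (ratNear x y z).Den c (|rat p - rat q| < eps r) := by
  refine Form.Den.congr (den_and (hA := den_ratLtAdd (p := p) (q := q) (r := 1) (n := pw r))
    (hB := den_ratLtAdd (p := q) (q := p) (r := 1) (n := pw r))) ?_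
  rw [ratLtAdd_iff (pw_pos r).ne', ratLtAdd_iff (pw_pos r).ne', map_one, abs_lt, ← eps]
  constructor
  · exact fun h => ⟨by linarith, by linarith⟩
  · exact fun h => ⟨by linarith, by linarith⟩

instance den_ratLeAdd_two : (ratLeAdd x y (1 + 1) (pow2 z)).Den c
    (rat p ≤ rat q + 2 * eps r) := by
  refine Form.Den.congr (den_ratLeAdd (p := p) (q := q) (r := 1 + 1) (n := pw r)) ?_
  rw [ratLeAdd_iff (pw_pos r).ne', eps, map_add, map_one, one_add_one_eq_two, mul_one_div]

instance den_ratAdd : (ratAdd x y z).Den c (rat p + rat q = rat r) := by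
  refine Form.Den.congr (P := WithRat p fun a b c => WithRat q fun a' b' c' =>
    WithRat r fun a'' b'' c'' => (a * c' + a' * c) * c'' + b'' * (c * c') =
      (b * c' + b' * c) * c'' + a'' * (c * c')) (by unfold ratAdd; infer_instance) ?_
  obtain ⟨a, b, c, h⟩ := exists_codesRat p
  obtain ⟨a', b', c', h'⟩ := exists_codesRat q
  obtain ⟨a'', b'', c'', h''⟩ := exists_codesRat r
  have hc := (of_pos h.ne_zero).ne'
  have hc' := (of_pos h'.ne_zero).ne'
  have hc'' := (of_pos h''.ne_zero).ne'
  rw [h.withRat_iff, h'.withRat_iff, h''.withRat_iff, h.rat_eq, h'.rat_eq, h''.rat_eq,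
    ← Frac.of_injective.eq_iff, div_add_div _ _ hc hc', div_eq_div_iff (mul_ne_zero hc hc') hc'']
  simp only [map_mul, map_add]
  constructor <;> intro H <;> linear_combination H

instance den_ratMul : (ratMul x y z).Den c (rat p * rat q = rat r) := by
  refine Form.Den.congr (P := WithRat p fun a b c => WithRat q fun a' b' c' =>
    WithRat r fun a'' b'' c'' => (a * a' + b * b') * c'' + b'' * (c * c') =
      (a * b' + b * a') * c'' + a'' * (c * c')) (by unfold ratMul; infer_instance) ?_
  obtain ⟨a, b, c, h⟩ := exists_codesRat p
  obtain ⟨a', b', c', h'⟩ := exists_codesRat q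
  obtain ⟨a'', b'', c'', h''⟩ := exists_codesRat r
  have hc := (of_pos h.ne_zero).ne'
  have hc' := (of_pos h'.ne_zero).ne'
  have hc'' := (of_pos h''.ne_zero).ne'
  rw [h.withRat_iff, h'.withRat_iff, h''.withRat_iff, h.rat_eq, h'.rat_eq, h''.rat_eq,
    ← Frac.of_injective.eq_iff, div_mul_div_comm, div_eq_div_iff (mul_ne_zero hc hc') hc'']
  simp only [map_mul, map_add]
  constructor <;> intro H <;> linear_combination H

end Den

end Model

end HigherOrderArithmetic

namespace HigherOrderArithmetic

local infixr:60 " ⇒ " => Ty.arr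

namespace Model

set_option synthInstance.maxSize 4000
set_option synthInstance.maxHeartbeats 400000

variable {M : Model}

/-! ### Representable functions with rational values -/

section RatRep

variable {X : Type} [Tup M X]

/-- The parts of a code are found by search. Relations between rationals then become polynomial
relations between numbers, which are decidable. -/
theorem exists_parts : ∃ a b c : M.D .one,
    ∀ q, CodesRat q (M.app a q) (M.app b q) (M.app c q) := by
  obtain ⟨a, ha, hA⟩ := exists_search (X := Unit × M.N)
    (P := fun x i => ∃ b c, CodesRat x.2 i b c)
  obtain ⟨b, hb, hB⟩ := exists_search (X := Unit × M.N)
    (P := fun x i => ∃ c, CodesRat x.2 (a x) i c)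
  obtain ⟨c, hc, hC⟩ := exists_search (X := Unit × M.N)
    (P := fun x i => CodesRat x.2 (a x) (b x) i)
  obtain ⟨a', -, ha⟩ := ha.exists_lam
  obtain ⟨b', -, hb⟩ := hb.exists_lam
  obtain ⟨c', -, hc⟩ := hc.exists_lam
  refine ⟨a' (), b' (), c' (), fun q => ?_⟩
  rw [ha, hb, hc]
  exact hC ((), q) (hB ((), q) (hA ((), q) (exists_codesRat q)))

instance dec_ratLt {F G : X → M.N} [M.Rep F] [M.Rep G] : M.Dec fun x => rat (F x) < rat (G x) := by
  obtain ⟨a, b, c, h⟩ := M.exists_parts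
  refine Dec.congr (P := fun x => M.app a (F x) * M.app c (G x) + M.app b (G x) * M.app c (F x) <
    M.app a (G x) * M.app c (F x) + M.app b (F x) * M.app c (G x)) inferInstance fun x => ?_
  have hc := of_pos (h (F x)).ne_zero
  have hc' := of_pos (h (G x)).ne_zero
  rw [(h (F x)).rat_eq, (h (G x)).rat_eq, div_lt_div_iff₀ hc hc', ← Frac.of_lt_of]
  simp only [map_mul, map_add]
  constructor <;> intro H <;> linarith

instance dec_ratLe {F G : X → M.N} [M.Rep F] [M.Rep G] : M.Dec fun x => rat (F x) ≤ rat (G x) :=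
  Dec.congr (P := fun x => ¬ rat (G x) < rat (F x)) inferInstance fun _ => not_lt

instance dec_ratEq {F G : X → M.N} [M.Rep F] [M.Rep G] : M.Dec fun x => rat (F x) = rat (G x) :=
  Dec.congr (P := fun x => rat (F x) ≤ rat (G x) ∧ rat (G x) ≤ rat (F x)) inferInstance
    fun _ => le_antisymm_iff.symm

variable (M) in
/-- A function with rational values whose codes are given by a term with parameters. -/
class RatRep (z : X → M.Q) : Prop where
  out : ∃ F : X → M.N, M.Rep F ∧ ∀ x, rat (F x) = z x

/-- A decidable graph suffices, because every rational has a code and search finds one. This spares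
explicit codes for the field operations. -/
theorem RatRep.of_graph {z : X → M.Q} (h : M.Dec fun x : X × M.N => rat x.2 = z x.1) :
    M.RatRep z := by
  obtain ⟨F, hF, H⟩ := exists_search (P := fun x q => rat q = z x) (h := h)
  exact ⟨F, hF, fun x => H x (rat_surjective _)⟩

instance ratRep_rat {F : X → M.N} [hF : M.Rep F] : M.RatRep fun x => rat (F x) :=
  ⟨F, hF, fun _ => rfl⟩

instance ratRep_const (r : M.Q) : M.RatRep fun _ : X => r := by
  obtain ⟨q, rfl⟩ := rat_surjective r
  infer_instance

variable {z w : X → M.Q} [hz : M.RatRep z] [hw : M.RatRep w]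

instance dec_ratRep_lt : M.Dec fun x => z x < w x := by
  obtain ⟨F, hF, h⟩ := hz
  obtain ⟨G, hG, h'⟩ := hw
  simp only [← h, ← h']
  infer_instance

instance dec_ratRep_le : M.Dec fun x => z x ≤ w x := by
  obtain ⟨F, hF, h⟩ := hz
  obtain ⟨G, hG, h'⟩ := hw
  simp only [← h, ← h']
  infer_instance

instance dec_ratRep_eq : M.Dec fun x => z x = w x := by
  obtain ⟨F, hF, h⟩ := hz
  obtain ⟨G, hG, h'⟩ := hw
  simp only [← h, ← h']
  infer_instance

theorem dec_ratAdd {F G H : X → M.N} [M.Rep F] [M.Rep G] [M.Rep H] :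
    M.Dec fun x => rat (F x) + rat (G x) = rat (H x) := by
  obtain ⟨a, b, c, h⟩ := M.exists_parts
  refine Dec.congr (P := fun x =>
    (M.app a (F x) * M.app c (G x) + M.app a (G x) * M.app c (F x)) * M.app c (H x) +
      M.app b (H x) * (M.app c (F x) * M.app c (G x)) =
    (M.app b (F x) * M.app c (G x) + M.app b (G x) * M.app c (F x)) * M.app c (H x) +
      M.app a (H x) * (M.app c (F x) * M.app c (G x))) inferInstance fun x => ?_
  have hc := (of_pos (h (F x)).ne_zero).ne'
  have hc' := (of_pos (h (G x)).ne_zero).ne'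
  have hc'' := (of_pos (h (H x)).ne_zero).ne'
  rw [(h (F x)).rat_eq, (h (G x)).rat_eq, (h (H x)).rat_eq, ← Frac.of_injective.eq_iff,
    div_add_div _ _ hc hc', div_eq_div_iff (mul_ne_zero hc hc') hc'']
  simp only [map_mul, map_add]
  constructor <;> intro H <;> linear_combination H

theorem dec_ratMul {F G H : X → M.N} [M.Rep F] [M.Rep G] [M.Rep H] :
    M.Dec fun x => rat (F x) * rat (G x) = rat (H x) := by
  obtain ⟨a, b, c, h⟩ := M.exists_parts
  refine Dec.congr (P := fun x =>
    (M.app a (F x) * M.app a (G x) + M.app b (F x) * M.app b (G x)) * M.app c (H x) +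
      M.app b (H x) * (M.app c (F x) * M.app c (G x)) =
    (M.app a (F x) * M.app b (G x) + M.app b (F x) * M.app a (G x)) * M.app c (H x) +
      M.app a (H x) * (M.app c (F x) * M.app c (G x))) inferInstance fun x => ?_
  have hc := (of_pos (h (F x)).ne_zero).ne'
  have hc' := (of_pos (h (G x)).ne_zero).ne'
  have hc'' := (of_pos (h (H x)).ne_zero).ne'
  rw [(h (F x)).rat_eq, (h (G x)).rat_eq, (h (H x)).rat_eq, ← Frac.of_injective.eq_iff,
    div_mul_div_comm, div_eq_div_iff (mul_ne_zero hc hc') hc'']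
  simp only [map_mul, map_add]
  constructor <;> intro H <;> linear_combination H

instance ratRep_add : M.RatRep fun x => z x + w x := by
  obtain ⟨F, hF, h⟩ := hz
  obtain ⟨G, hG, h'⟩ := hw
  have : M.Dec fun x : X × M.N => rat (F x.1) + rat (G x.1) = rat x.2 := dec_ratAdd
  refine .of_graph (this.congr fun x => ?_)
  rw [h, h', eq_comm]

instance ratRep_mul : M.RatRep fun x => z x * w x := by
  obtain ⟨F, hF, h⟩ := hz
  obtain ⟨G, hG, h'⟩ := hw
  have : M.Dec fun x : X × M.N => rat (F x.1) * rat (G x.1) = rat x.2 := dec_ratMul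
  refine .of_graph (this.congr fun x => ?_)
  rw [h, h', eq_comm]

instance ratRep_neg : M.RatRep fun x => - z x := by
  obtain ⟨F, hF, h⟩ := hz
  have : M.Dec fun x : X × M.N => rat (F x.1) + rat x.2 = 0 := inferInstance
  refine .of_graph (this.congr fun x => ?_)
  rw [h, eq_neg_iff_add_eq_zero, _root_.add_comm]

instance ratRep_sub : M.RatRep fun x => z x - w x := by
  simp only [sub_eq_add_neg]
  infer_instance

instance ratRep_inv : M.RatRep fun x => (z x)⁻¹ := by
  obtain ⟨F, hF, h⟩ := hz
  -- The first alternative accounts for the convention `0⁻¹ = 0`.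
  have : M.Dec fun x : X × M.N => (rat (F x.1) = 0 ∧ rat x.2 = 0) ∨
    rat (F x.1) * rat x.2 = 1 := inferInstance
  refine .of_graph (this.congr fun x => ?_)
  rw [h]
  by_cases h0 : z x.1 = 0
  · simp [h0]
  · simp only [h0, false_and, false_or]
    rw [_root_.mul_comm, mul_eq_one_iff_eq_inv₀ h0]

instance ratRep_ite {P : X → Prop} [DecidablePred P] [hP : M.Dec P] : M.RatRep fun x => if P x then z x else w x := by
  obtain ⟨F, hF, h⟩ := hz
  obtain ⟨G, hG, h'⟩ := hw
  refine .of_graph (Dec.congr (P := fun x => (P x.1 ∧ rat x.2 = rat (F x.1)) ∨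
    (¬ P x.1 ∧ rat x.2 = rat (G x.1))) inferInstance fun x => ?_)
  by_cases h0 : P x.1 <;> simp [h0, h, h']

instance ratRep_abs : M.RatRep fun x => |z x| := by
  classical
  have : (fun x => |z x|) = fun x => if 0 ≤ z x then z x else - z x := by
    funext x
    split_ifs with h
    · exact abs_of_nonneg h
    · exact abs_of_neg (not_le.1 h)
  rw [this]
  infer_instance

instance ratRep_of {F : X → M.N} [hF : M.Rep F] : M.RatRep fun x => (Frac.of (F x) : M.Q) := by
  refine .of_graph (Dec.congr (P := fun x => WithRat x.2 fun a b c => a = b + F x.1 * c)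
    (by simp only [WithRat]; infer_instance) fun x => ?_)
  obtain ⟨a, b, c, h⟩ := exists_codesRat x.2
  have hc := (of_pos h.ne_zero).ne'
  rw [h.withRat_iff, h.rat_eq, div_eq_iff hc, ← Frac.of_injective.eq_iff, map_add, map_mul,
    sub_eq_iff_eq_add']

instance ratRep_eps {F : X → M.N} [hF : M.Rep F] : M.RatRep fun x => eps (F x) := by
  simp only [eps, one_div]
  infer_instance

end RatRep

theorem eps_succ (n : M.N) : eps (n + 1) = eps n / 2 := by
  rw [eps, eps, pw_succ, map_add, div_div, mul_two]

theorem eps_add (m n : M.N) : eps (m + n) = eps m * eps n := by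
  rw [eps, eps, eps, pw_add, map_mul, one_div_mul_one_div]

theorem of_mul_eps_lt_one (n : M.N) : Frac.of n * eps n < 1 := by
  rw [eps, mul_one_div, div_lt_one (of_pos (pw_pos n).ne'), Frac.of_lt_of]
  exact lt_pw n

theorem eps_le_one (n : M.N) : eps n ≤ 1 := by
  rw [eps, div_le_one (of_pos (pw_pos n).ne'), ← map_one (Frac.of (N := M.N)), Frac.of_le_of]
  have := succ_le_iff'.2 (pw_pos n)
  rwa [M.zero_add] at this

theorem eps_anti {m n : M.N} (h : m ≤ n) : eps n ≤ eps m := by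
  obtain ⟨c, rfl⟩ := (le_iff_exists_add' _ _).1 h
  rw [eps_add]
  exact mul_le_of_le_one_right (eps_pos m).le (eps_le_one c)

/-! ### Real numbers in a model -/

/-- The embedding of the rationals. -/
noncomputable abbrev ofQ : M.Q →+* M.R := Compl.const M.N

theorem ofQ_lt {a b : M.Q} : ofQ a < ofQ b ↔ a < b := Compl.const_strictMono.lt_iff_lt

theorem ofQ_pos {a : M.Q} (h : 0 < a) : 0 < ofQ a := by
  rw [← map_zero (ofQ (M := M))]
  exact ofQ_lt.2 h

theorem ofQ_le {a b : M.Q} : ofQ a ≤ ofQ b ↔ a ≤ b := Compl.const_strictMono.le_iff_le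

theorem ofQ_abs (a : M.Q) : ofQ |a| = |ofQ a| :=
  Compl.const_strictMono.monotone.map_max.trans (by rw [map_neg]; rfl)

theorem exists_eps_lt {r : M.R} (hr : 0 < r) : ∃ n : M.N, ofQ (eps n) < r := by
  obtain ⟨k, hk, hkr⟩ := Compl.exists_const_le hr
  suffices ∃ n : M.N, eps n < k by
    obtain ⟨n, hn⟩ := this
    exact ⟨n, (ofQ_lt.2 hn).trans_le hkr⟩
  obtain ⟨a, c, hc, h⟩ := Frac.exists_eq k
  have hc' := of_pos hc
  rcases h with rfl | rfl
  -- Since `c < 2 ^ c` and `a ≥ 1`, the denominator itself serves as the exponent.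
  · refine ⟨c, ?_⟩
    have ha : a ≠ 0 := by rintro rfl; simp at hk
    have ha' : (1 : M.Q) ≤ Frac.of a := by
      rw [← map_one (Frac.of (N := M.N)), Frac.of_le_of, ← M.zero_add 1]
      exact succ_le_iff'.2 (pos_iff_ne_zero.2 ha)
    rw [lt_div_iff₀ hc', _root_.mul_comm]
    exact (of_mul_eps_lt_one c).trans_le ha'
  · have : (0 : M.Q) ≤ Frac.of a / Frac.of c := div_nonneg (Frac.of_nonneg _) hc'.le
    linarith

noncomputable instance : TopologicalSpace M.R := Preorder.topology M.R

instance : OrderTopology M.R := ⟨rfl⟩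

open Filter Topology

theorem tendsto_iff_eps {a : M.N → M.R} {r : M.R} : Tendsto a atTop (𝓝 r) ↔
    ∀ k : M.N, ∃ n, ∀ m, n ≤ m → |a m - r| < ofQ (eps k) := by
  rw [LinearOrderedAddCommGroup.tendsto_nhds]
  constructor
  · intro h k
    exact eventually_atTop.1 (h _ (ofQ_pos (eps_pos k)))
  · intro h e he
    obtain ⟨k, hk⟩ := exists_eps_lt he
    exact eventually_atTop.2 ((h k).imp fun n hn m hm => (hn m hm).trans hk)

/-- `x` codes a real. -/
def IsReal (x : M.D .one) : Prop := ∀ n i : M.N, |rat (M.app x n) - rat (M.app x (n + i))| < eps n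

open Classical in
/-- The value of a real. -/
noncomputable def val (x : M.D .one) : M.R :=
  if IsReal x then Compl.lim fun n => rat (M.app x n) else 0

theorem abs_val_sub_le {x : M.D .one} (hx : IsReal x) (n : M.N) :
    |val x - ofQ (rat (M.app x n))| ≤ ofQ (eps n) := by
  rw [val, if_pos hx]
  refine Compl.abs_lim_sub_le (eventually_atTop.2 ⟨n, fun m hm => ?_⟩)
  obtain ⟨i, rfl⟩ := (le_iff_exists_add' _ _).1 hm
  rw [abs_sub_comm]
  exact (hx n i).le

theorem tendsto_of_le_eps {a : M.N → M.R} {r : M.R} (h : ∀ n, |a n - r| ≤ ofQ (eps n)) :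
    Tendsto a atTop (𝓝 r) := by
  refine tendsto_iff_eps.2 fun k => ⟨k + 1, fun m hm => (h m).trans_lt (ofQ_lt.2 ?_)⟩
  refine (eps_anti hm).trans_lt ?_
  rw [eps_succ]
  exact half_lt_self (eps_pos k)

theorem tendsto_val {x : M.D .one} (hx : IsReal x) :
    Tendsto (fun n => ofQ (rat (M.app x n))) atTop (𝓝 (val x)) :=
  tendsto_of_le_eps fun n => by rw [abs_sub_comm]; exact abs_val_sub_le hx n

theorem tendsto_eps : Tendsto (fun n : M.N => (ofQ (eps n) : M.R)) atTop (𝓝 0) :=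
  tendsto_of_le_eps fun n => by
    rw [sub_zero, ← ofQ_abs, abs_of_pos (eps_pos n)]

section iff

variable {x y z : M.D .one} (hx : IsReal x) (hy : IsReal y) (hz : IsReal z)

include hx hy in
-- Each `n`-th approximation is within `eps n` of its value, which accounts for the factor `2`; in
-- the other direction the error term vanishes in the limit.
theorem leR_iff : (∀ n, rat (M.app x n) ≤ rat (M.app y n) + 2 * eps n) ↔ val x ≤ val y := by
  constructor
  · intro h
    have h1 := (tendsto_val hy).add (tendsto_eps.const_mul (2 : M.R))
    rw [MulZeroClass.mul_zero, _root_.add_zero] at h1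
    refine le_of_tendsto_of_tendsto' (tendsto_val hx) h1 fun n => ?_
    have := (ofQ_le (M := M)).2 (h n)
    rwa [map_add, map_mul, map_ofNat] at this
  · intro h n
    rw [← ofQ_le, map_add, map_mul, map_ofNat]
    have h1 := abs_le.1 (abs_val_sub_le hx n)
    have h2 := abs_le.1 (abs_val_sub_le hy n)
    linarith

include hx hy in
theorem eqR_iff : (∀ n, rat (M.app x n) ≤ rat (M.app y n) + 2 * eps n ∧
    rat (M.app y n) ≤ rat (M.app x n) + 2 * eps n) ↔ val x = val y := by
  rw [forall_and, leR_iff hx hy, leR_iff hy hx, le_antisymm_iff]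

theorem near_iff_tendsto {a : M.N → M.Q} : (∀ k : M.N, ∃ N : M.N, ∀ n, N ≤ n →
    ∃ r, a n = rat r ∧ |rat r - rat (M.app z n)| < eps k) ↔
    Tendsto (fun n => ofQ (a n) - ofQ (rat (M.app z n))) atTop (𝓝 0) := by
  rw [tendsto_iff_eps]
  refine forall_congr' fun k => exists_congr fun N => forall_congr' fun n => forall_congr' fun _ => ?_
  rw [sub_zero, ← map_sub, ← ofQ_abs, ofQ_lt]
  constructor
  · rintro ⟨r, h, h'⟩
    rwa [h]
  · intro h
    obtain ⟨r, hr⟩ := rat_surjective (a n)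
    exact ⟨r, hr.symm, by rwa [hr]⟩

include hz in
theorem near_iff_eq {a : M.N → M.Q} {s : M.R} (ha : Tendsto (fun n => ofQ (a n)) atTop (𝓝 s)) :
    (∀ k : M.N, ∃ N : M.N, ∀ n, N ≤ n →
      ∃ r, a n = rat r ∧ |rat r - rat (M.app z n)| < eps k) ↔ s = val z := by
  rw [near_iff_tendsto]
  have h := ha.sub (tendsto_val hz)
  constructor
  · exact fun h' => sub_eq_zero.1 (tendsto_nhds_unique h h')
  · rintro rfl
    rwa [sub_self] at h

include hx hy hz in
theorem addR_iff : (∀ k : M.N, ∃ N : M.N, ∀ n, N ≤ n → ∃ r,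
    rat (M.app x n) + rat (M.app y n) = rat r ∧ |rat r - rat (M.app z n)| < eps k) ↔
    val x + val y = val z := by
  refine near_iff_eq hz ?_
  simp only [map_add]
  exact (tendsto_val hx).add (tendsto_val hy)

include hx hy hz in
theorem mulR_iff : (∀ k : M.N, ∃ N : M.N, ∀ n, N ≤ n → ∃ r,
    rat (M.app x n) * rat (M.app y n) = rat r ∧ |rat r - rat (M.app z n)| < eps k) ↔
    val x * val y = val z := by
  refine near_iff_eq hz ?_
  simp only [map_mul]
  exact (tendsto_val hx).mul (tendsto_val hy)

end iff

end Model

end HigherOrderArithmetic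

namespace HigherOrderArithmetic

local infixr:60 " ⇒ " => Ty.arr

namespace Model

set_option synthInstance.maxSize 4000
set_option synthInstance.maxHeartbeats 400000

variable {M : Model}

open Filter Topology

/-! ### Representable functions with real values -/

/-- Two extra halvings leave a total error of half of `eps n`, hence the strict inequality demanded
of a real. -/
theorem isReal_of_abs_sub_le {x : M.D .one} {r : M.R}
    (h : ∀ n, |ofQ (rat (M.app x n)) - r| ≤ ofQ (eps (n + 1 + 1))) : IsReal x ∧ val x = r := by
  have h1 : ∀ n : M.N, eps (n + 1 + 1) ≤ eps n := fun n => by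
    exact eps_anti (le_self_add.trans le_self_add)
  have hx : IsReal x := fun n i => by
    rw [← ofQ_lt, ofQ_abs, map_sub]
    have h2 := h n
    have h3 := (h (n + i)).trans (ofQ_le.2 (eps_anti (show n + 1 + 1 ≤ n + i + 1 + 1 from
      add_le_add_left (add_le_add_left le_self_add 1) 1)))
    have h4 := abs_sub_le (ofQ (rat (M.app x n))) r (ofQ (rat (M.app x (n + i))))
    rw [abs_sub_comm r] at h4
    have h5 : ofQ (eps (n + 1 + 1)) + ofQ (eps (n + 1 + 1)) < ofQ (eps n) := by
      rw [← map_add, ofQ_lt, eps_succ, eps_succ]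
      linarith [eps_pos n]
    linarith
  exact ⟨hx, tendsto_nhds_unique (tendsto_val hx)
    (tendsto_of_le_eps fun n => (h n).trans (ofQ_le.2 (h1 n)))⟩

section RealRep

variable {X : Type} [Tup M X]

variable (M) in
/-- A function with real values which are given by a term with parameters. -/
class RealRep (z : X → M.R) : Prop where
  out : ∃ F : X → M.D .one, M.Rep F ∧ ∀ x, IsReal (F x) ∧ val (F x) = z x

/-- Completeness of the reals of the model for represented sequences. The Cauchy condition is
arithmetical, so `exists_search` finds a modulus uniformly in the parameters, and the sequence
thinned out along it is a real with the given limit. -/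
theorem RealRep.of_tendsto {z : X → M.R} {a : X → M.N → M.Q}
    (ha : M.RatRep fun x : X × M.N => a x.1 x.2)
    (h : ∀ x, Tendsto (fun n => ofQ (a x n)) atTop (𝓝 (z x))) : M.RealRep z := by
  obtain ⟨F, hF, hFa⟩ := ha
  obtain ⟨G, hG, hGF⟩ := hF.exists_lam
  obtain ⟨K, hK, hK'⟩ := exists_search (X := X × M.N) (P := fun x m => ∀ i, m ≤ i → ∀ j, m ≤ j →
    |rat (M.app (G x.1) i) - rat (M.app (G x.1) j)| < eps (x.2 + 1 + 1))
  obtain ⟨H, hH, hHK⟩ := Rep.exists_lam (X := X) (F := fun x : X × M.N => M.app (G x.1) (K x))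
    inferInstance
  refine ⟨H, hH, fun x => isReal_of_abs_sub_le fun n => ?_⟩
  have hlim : Tendsto (fun n => ofQ (rat (M.app (G x) n))) atTop (𝓝 (z x)) := by
    have := h x
    simp only [hGF, hFa]
    exact this
  have hN := hK' (x, n) (by
    obtain ⟨N, hN⟩ := tendsto_iff_eps.1 hlim (n + 1 + 1 + 1)
    refine ⟨N, fun i hi j hj => ?_⟩
    have h1 := hN i hi
    have h2 := hN j hj
    rw [← ofQ_lt, ofQ_abs, map_sub]
    have h4 := abs_sub_le (ofQ (rat (M.app (G x) i))) (z x) (ofQ (rat (M.app (G x) j)))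
    rw [abs_sub_comm (z x)] at h4
    have h5 : (ofQ (eps (n + 1 + 1 + 1)) + ofQ (eps (n + 1 + 1 + 1)) : M.R) =
        ofQ (eps (n + 1 + 1)) := by
      rw [← map_add, eps_succ (n + 1 + 1), add_halves]
    linarith)
  rw [hHK]
  refine le_of_tendsto ((tendsto_const_nhds.sub hlim).abs) (eventually_atTop.2 ⟨K (x, n), ?_⟩)
  intro j hj
  rw [← map_sub, ← ofQ_abs, ofQ_le]
  exact (hN _ le_rfl j hj).le

instance dec_isReal {F : X → M.D .one} [M.Rep F] : M.Dec fun x => IsReal (F x) := by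
  unfold IsReal
  infer_instance

instance realRep_val {F : X → M.D .one} [M.Rep F] : M.RealRep fun x => val (F x) := by
  classical
  refine .of_tendsto (a := fun x n => if IsReal (F x) then rat (M.app (F x) n) else 0)
    inferInstance fun x => ?_
  by_cases h : IsReal (F x)
  · simp only [if_pos h]
    exact tendsto_val h
  · simp only [if_neg h, val, map_zero]
    exact tendsto_const_nhds

instance realRep_ofQ {a : X → M.Q} [h : M.RatRep a] : M.RealRep fun x => ofQ (a x) := by
  obtain ⟨F, hF, h⟩ := h
  simp only [← h]
  exact .of_tendsto (a := fun x _ => rat (F x)) inferInstance fun x => tendsto_const_nhds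

theorem RealRep.exists_lam {σ : Ty} {z : X × M.D σ → M.R} (h : M.RealRep z) :
    ∃ g : X → M.D (σ ⇒ .one), M.Rep g ∧
      ∀ x a, IsReal (M.app (g x) a) ∧ val (M.app (g x) a) = z (x, a) := by
  obtain ⟨F, hF, h⟩ := h
  obtain ⟨G, hG, hGF⟩ := hF.exists_lam
  exact ⟨G, hG, fun x a => by rw [hGF]; exact h _⟩

variable (M) in
/-- An element of the field that is the value of a real. -/
class IsVal (r : M.R) : Prop where
  out : ∃ x, IsReal x ∧ val x = r

theorem RealRep.isVal {z : X → M.R} (h : M.RealRep z) (x : X) : M.IsVal (z x) := by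
  obtain ⟨F, -, h⟩ := h
  exact ⟨F x, h x⟩

theorem IsVal.of_rep {r : M.R} (h : M.RealRep fun _ : Unit => r) : M.IsVal r := h.isVal ()

instance isVal_val (x : M.D .one) : M.IsVal (val x) := .of_rep inferInstance

instance realRep_const (r : M.R) [h : M.IsVal r] : M.RealRep fun _ : X => r := by
  obtain ⟨x, -, rfl⟩ := h
  infer_instance

instance realRep_zero : M.RealRep fun _ : X => (0 : M.R) := by
  simp only [← map_zero (ofQ (M := M))]
  infer_instance

instance realRep_one : M.RealRep fun _ : X => (1 : M.R) := by
  simp only [← map_one (ofQ (M := M))]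
  infer_instance

instance realRep_ofNat (n : ℕ) [n.AtLeastTwo] :
    M.RealRep fun _ : X => (OfNat.ofNat n : M.R) := by
  simp only [← map_ofNat (ofQ (M := M))]
  infer_instance

variable {z w : X → M.R} [hz : M.RealRep z] [hw : M.RealRep w]

instance dec_realRep_le : M.Dec fun x => z x ≤ w x := by
  obtain ⟨F, hF, h⟩ := hz
  obtain ⟨G, hG, h'⟩ := hw
  have : M.Dec fun x => ∀ n, rat (M.app (F x) n) ≤ rat (M.app (G x) n) + 2 * eps n := inferInstance
  refine this.congr fun x => ?_
  rw [leR_iff (h x).1 (h' x).1, (h x).2, (h' x).2]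

instance dec_realRep_lt : M.Dec fun x => z x < w x :=
  Dec.congr (P := fun x => ¬ w x ≤ z x) inferInstance fun _ => not_le

instance dec_realRep_eq : M.Dec fun x => z x = w x :=
  Dec.congr (P := fun x => z x ≤ w x ∧ w x ≤ z x) inferInstance fun _ => le_antisymm_iff.symm

instance realRep_add : M.RealRep fun x => z x + w x := by
  obtain ⟨F, hF, h⟩ := hz
  obtain ⟨G, hG, h'⟩ := hw
  refine .of_tendsto (a := fun x n => rat (M.app (F x) n) + rat (M.app (G x) n)) inferInstance
    fun x => ?_
  simp only [map_add, ← (h x).2, ← (h' x).2]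
  exact (tendsto_val (h x).1).add (tendsto_val (h' x).1)

instance realRep_mul : M.RealRep fun x => z x * w x := by
  obtain ⟨F, hF, h⟩ := hz
  obtain ⟨G, hG, h'⟩ := hw
  refine .of_tendsto (a := fun x n => rat (M.app (F x) n) * rat (M.app (G x) n)) inferInstance
    fun x => ?_
  simp only [map_mul, ← (h x).2, ← (h' x).2]
  exact (tendsto_val (h x).1).mul (tendsto_val (h' x).1)

instance realRep_neg : M.RealRep fun x => - z x := by
  obtain ⟨F, hF, h⟩ := hz
  refine .of_tendsto (a := fun x n => - rat (M.app (F x) n)) inferInstance fun x => ?_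
  simp only [map_neg, ← (h x).2]
  exact (tendsto_val (h x).1).neg

instance realRep_sub : M.RealRep fun x => z x - w x := by
  simp only [sub_eq_add_neg]
  infer_instance

instance realRep_ite {P : X → Prop} [DecidablePred P] [M.Dec P] : M.RealRep fun x => if P x then z x else w x := by
  obtain ⟨F, hF, h⟩ := hz
  obtain ⟨G, hG, h'⟩ := hw
  refine .of_tendsto (a := fun x n => if P x then rat (M.app (F x) n) else rat (M.app (G x) n))
    inferInstance fun x => ?_
  simp only [← (h x).2, ← (h' x).2]
  split_ifs
  · exact tendsto_val (h x).1
  · exact tendsto_val (h' x).1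

instance realRep_inv : M.RealRep fun x => (z x)⁻¹ := by
  classical
  obtain ⟨F, hF, h⟩ := hz
  obtain rfl : z = fun x => val (F x) := funext fun x => (h x).2.symm
  -- Equality of a real with `0` is arithmetical, hence a permitted case distinction; away from `0`
  -- the reciprocals of the approximations converge.
  refine .of_tendsto (a := fun x n => if val (F x) = 0 then 0 else (rat (M.app (F x) n))⁻¹)
    inferInstance fun x => ?_
  by_cases h0 : val (F x) = 0
  · simp only [h0, if_true, map_zero, inv_zero]
    exact tendsto_const_nhds
  · simp only [if_neg h0, map_inv₀]
    exact (tendsto_val (h x).1).inv₀ h0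

instance realRep_div : M.RealRep fun x => z x / w x := by
  simp only [div_eq_mul_inv]
  infer_instance

instance realRep_min : M.RealRep fun x => min (z x) (w x) := by
  classical
  simp only [min_def]
  infer_instance

instance realRep_max : M.RealRep fun x => max (z x) (w x) := by
  classical
  simp only [max_def]
  infer_instance

instance realRep_abs : M.RealRep fun x => |z x| :=
  inferInstanceAs (M.RealRep fun x => max (z x) (- z x))

end RealRep

section IsVal

variable {r s : M.R} [M.IsVal r] [M.IsVal s]

instance isVal_zero : M.IsVal 0 := .of_rep inferInstance
instance isVal_one : M.IsVal 1 := .of_rep inferInstance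
instance isVal_ofNat (n : ℕ) [n.AtLeastTwo] : M.IsVal (no_index (OfNat.ofNat n)) := .of_rep inferInstance
instance isVal_add : M.IsVal (r + s) := .of_rep inferInstance
instance isVal_sub : M.IsVal (r - s) := .of_rep inferInstance
instance isVal_mul : M.IsVal (r * s) := .of_rep inferInstance
instance isVal_inv : M.IsVal r⁻¹ := .of_rep inferInstance
instance isVal_div : M.IsVal (r / s) := .of_rep inferInstance
instance isVal_min : M.IsVal (min r s) := .of_rep inferInstance
instance isVal_abs : M.IsVal |r| := .of_rep inferInstance

end IsVal

theorem exists_val (r : M.R) [h : M.IsVal r] : ∃ x, IsReal x ∧ val x = r := h.out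

/-- Quantification over codes of reals becomes quantification over the field elements that are
values. The external field may contain further elements, hence the guard `IsVal`. -/
theorem forall_real_congr {Q : M.D .one → Prop} {P : M.R → Prop}
    (h : ∀ x, IsReal x → (Q x ↔ P (val x))) : (∀ x, IsReal x → Q x) ↔ ∀ r, M.IsVal r → P r := by
  constructor
  · rintro H r ⟨x, hx, rfl⟩
    exact (h x hx).1 (H x hx)
  · exact fun H x hx => (h x hx).2 (H _ inferInstance)

theorem exists_real_congr {Q : M.D .one → Prop} {P : M.R → Prop}
    (h : ∀ x, IsReal x → (Q x ↔ P (val x))) : (∃ x, IsReal x ∧ Q x) ↔ ∃ r, M.IsVal r ∧ P r := by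
  constructor
  · rintro ⟨x, hx, H⟩
    exact ⟨val x, inferInstance, (h x hx).1 H⟩
  · rintro ⟨r, ⟨x, hx, rfl⟩, H⟩
    exact ⟨x, hx, (h x hx).2 H⟩

/-! ### Recursion -/

theorem exists_unpair_fun : ∃ L R : M.D .one, ∀ n m, ∃ q, M.app L q = n ∧ M.app R q = m := by
  obtain ⟨a, ha, hA⟩ := exists_search (X := Unit × M.N)
    (P := fun x n => ∃ m, x.2 + x.2 = (n + m) * (n + m + 1) + (n + n))
  obtain ⟨b, hb, hB⟩ := exists_search (X := Unit × M.N)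
    (P := fun x m => x.2 + x.2 = (a x + m) * (a x + m + 1) + (a x + a x))
  obtain ⟨L, -, hL⟩ := ha.exists_lam
  obtain ⟨R, -, hR⟩ := hb.exists_lam
  refine ⟨L (), R (), fun n m => ?_⟩
  obtain ⟨q, hq⟩ := exists_pair_code n m
  have h1 := hB ((), q) (hA ((), q) ⟨n, m, hq⟩)
  obtain ⟨h2, h3⟩ := unpair_unique (hq.symm.trans h1)
  exact ⟨q, by rw [hL, h2], by rw [hR, h3]⟩

/-- Primitive recursion. -/
theorem exists_rec {X : Type} [Tup M X] {a : X → M.N} (ha : M.Rep a)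
    {h : (X × M.N) × M.N → M.N} (hh : M.Rep h) :
    ∃ G : X × M.N → M.N, M.Rep G ∧ (∀ x, G (x, 0) = a x) ∧
      ∀ x i, G (x, i + 1) = h ((x, i), G (x, i)) := by
  obtain ⟨L, R, hLR⟩ := M.exists_unpair_fun
  obtain ⟨h', hh', hh''⟩ := hh.exists_lam
  obtain ⟨g, hg, hgh⟩ := hh'.exists_lam
  have hs (x : X) (i y : M.N) : M.app (M.app (g x) i) y = h ((x, i), y) := by rw [hgh, hh'']
  -- The recursor iterates a map that sees only the previous value, so the iterated object is a code
  -- for the pair of stage and value.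
  obtain ⟨b, hb, hb'⟩ := exists_search (X := X) (P := fun x q => M.app L q = 0 ∧ M.app R q = a x)
  obtain ⟨s, hs1, hs2⟩ := exists_search (X := X × M.N) (P := fun x q =>
    M.app L q = M.app L x.2 + 1 ∧ M.app R q = M.app (M.app (g x.1) (M.app L x.2)) (M.app R x.2))
  obtain ⟨t, ht, hts⟩ := hs1.exists_lam
  let T : X × M.N → M.N := fun x => M.app (M.app (M.app (M.con (.recursor .nat)) (t x.1)) (b x.1)) x.2
  have hT : M.Rep T := by unfold T; infer_instance
  have hT0 : ∀ x, T (x, 0) = b x := fun x => recursor_zero _ _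
  have hTs : ∀ x i, T (x, i + 1) = s (x, T (x, i)) := fun x i =>
    (recursor_succ _ _ _).trans (hts _ _)
  have hTL : ∀ x i, M.app L (T (x, i)) = i := fun x i => by
    have : M.Dec fun y : Unit × M.N => M.app L
        (M.app (M.app (M.app (M.con (.recursor .nat)) (t x)) (b x)) y.2) = y.2 := inferInstance
    induction i using induction with
    | h => exact this
    | h0 => rw [hT0]; exact (hb' x (hLR _ _)).1
    | hs n ih => rw [hTs, (hs2 _ (hLR _ _)).1, ih]
  refine ⟨fun x => M.app R (T x), inferInstance, fun x => ?_, fun x i => ?_⟩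
  · exact (congrArg _ (hT0 x)).trans (hb' x (hLR _ _)).2
  · simp only [hTs, (hs2 (x, _) (hLR _ _)).2, hs, hTL]

/-- The partial sums of a sequence of reals. -/
theorem exists_sum {c : M.N → M.R} (hc : M.RealRep fun x : Unit × M.N => c x.2) :
    ∃ S : M.D (.nat ⇒ .one), (∀ i, IsReal (M.app S i)) ∧ val (M.app S 0) = 0 ∧
      ∀ i, val (M.app S (i + 1)) = val (M.app S i) + c i := by
  obtain ⟨C, hC, hCc⟩ := hc.exists_lam
  obtain ⟨C, rfl⟩ : ∃ C' : M.D (.nat ⇒ .one), C = fun _ => C' := ⟨C (), rfl⟩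
  obtain ⟨q0, hq0⟩ := rat_surjective (M := M) 0
  obtain ⟨h, hh, hh'⟩ := exists_search (X := ((Unit × M.N) × M.N) × M.N)
    (P := fun x q => rat q = rat x.2 + rat (M.app (M.app C x.1.2) x.1.1.2))
  obtain ⟨G, hG, hG0, hGs⟩ := exists_rec (X := Unit × M.N) (a := fun _ => q0) inferInstance hh
  obtain ⟨g, hg, hgG⟩ := hG.exists_lam
  obtain ⟨g', hg', hgg⟩ := hg.exists_lam
  -- Only recursion on numbers is available, so the `m`-th rational approximations are summed. The
  -- partial sum of length `i` then has error at most `i * eps m`.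
  let A : M.N → M.N → M.Q := fun m i => rat (M.app (M.app (g' ()) m) i)
  have hA0 : ∀ m, A m 0 = 0 := fun m => by simp only [A, hgg, hgG, hG0, hq0]
  have hAs : ∀ m i, A m (i + 1) = A m i + rat (M.app (M.app C i) m) := fun m i => by
    simp only [A, hgg, hgG, hGs]
    exact hh' ((((), m), i), G (((), m), i)) (rat_surjective _)
  have hAd : ∀ m j i, |A m i - A (m + j) i| ≤ Frac.of i * eps m := fun m j i => by
    induction i using induction with
    | h => simp only [A]; infer_instance
    | h0 => simp [hA0]
    | hs i ih =>
      rw [hAs, hAs, map_add, map_one]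
      have h1 := abs_le.1 ((hCc () i).1 m j).le
      have h2 := abs_le.1 ih
      rw [abs_le]
      constructor <;> linarith [h1.1, h1.2, h2.1, h2.2]
  have hsm : ∀ n i : M.N, Frac.of i * eps (n + i) < eps n := fun n i => by
    have := mul_lt_mul_of_pos_left (of_mul_eps_lt_one i) (eps_pos n)
    rw [eps_add]
    linarith
  -- The precision `n + i` absorbs the accumulated error, as `i * eps i < 1`.
  obtain ⟨S, hS0, hS⟩ := Rep.exists_lam (X := Unit × M.N) (σ := .nat) (τ := .nat)
    (F := fun x => M.app (M.app (g' ()) (x.2 + x.1.2)) x.1.2) inferInstance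
  obtain ⟨S', -, hS'⟩ := Rep.exists_lam (X := Unit) (σ := .nat) (F := S) hS0
  have hSA : ∀ i n, rat (M.app (M.app (S' ()) i) n) = A (n + i) i := fun i n => by rw [hS', hS]
  have hSr : ∀ i, IsReal (M.app (S' ()) i) := fun i n j => by
    rw [hSA, hSA]
    have : n + j + i = n + i + j := by ring
    rw [this]
    exact (hAd _ _ _).trans_lt (hsm n i)
  have hlim : ∀ i, Tendsto (fun m => ofQ (A m i)) atTop (𝓝 (val (M.app (S' ()) i))) := fun i => by
    refine tendsto_iff_eps.2 fun k => ⟨k + 1 + i, fun m hm => ?_⟩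
    obtain ⟨j, rfl⟩ := (le_iff_exists_add' _ _).1 hm
    have h1 := abs_val_sub_le (hSr i) (k + 1 + j)
    have h2 : k + 1 + j + i = k + 1 + i + j := by ring
    rw [hSA, h2, abs_sub_comm] at h1
    refine h1.trans_lt (ofQ_lt.2 ((eps_anti le_self_add).trans_lt ?_))
    rw [eps_succ]
    exact half_lt_self (eps_pos k)
  refine ⟨S' (), hSr, ?_, fun i => ?_⟩
  · refine tendsto_nhds_unique (hlim 0) ?_
    simp only [hA0, map_zero]
    exact tendsto_const_nhds
  · refine tendsto_nhds_unique (hlim (i + 1)) ?_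
    simp only [hAs, map_add]
    have h1 := hCc () i
    rw [← h1.2]
    exact (hlim i).add (tendsto_val h1.1)

end Model

end HigherOrderArithmetic

/-! ### Translation of the formal sentences into statements about values. -/

namespace HigherOrderArithmetic

local infixr:60 " ⇒ " => Ty.arr

namespace Model

set_option synthInstance.maxSize 4000
set_option synthInstance.maxHeartbeats 400000

variable {M : Model}

local infixl:100 " ⋄ " => PreStr.app (Model.toPreStr _)

/-! ### The meaning of the relations between reals -/

/-- `x ≤_ℝ y`. -/
def LeR (x y : M.D .one) : Prop := ∀ n, rat (x ⋄ n) ≤ rat (y ⋄ n) + 2 * eps n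

/-- `x =_ℝ y`. -/
def EqR (x y : M.D .one) : Prop := ∀ n, rat (x ⋄ n) ≤ rat (y ⋄ n) + 2 * eps n ∧
  rat (y ⋄ n) ≤ rat (x ⋄ n) + 2 * eps n

/-- `x + y =_ℝ z`. -/
def AddR (x y z : M.D .one) : Prop := ∀ k : M.N, ∃ N : M.N, ∀ n, N ≤ n → ∃ r,
  rat (x ⋄ n) + rat (y ⋄ n) = rat r ∧ |rat r - rat (z ⋄ n)| < eps k

/-- `x y =_ℝ z`. -/
def MulR (x y z : M.D .one) : Prop := ∀ k : M.N, ∃ N : M.N, ∀ n, N ≤ n → ∃ r,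
  rat (x ⋄ n) * rat (y ⋄ n) = rat r ∧ |rat r - rat (z ⋄ n)| < eps k

/-- `x < y + e`. -/
def LtAdd (x y e : M.D .one) : Prop := ∃ u, IsReal u ∧ AddR y e u ∧ ¬ LeR u x

/-- `x ≤ y + e`. -/
def LeAdd (x y e : M.D .one) : Prop := ∃ u, IsReal u ∧ AddR y e u ∧ LeR x u

/-- `|x - y| < e`. -/
def Near (x y e : M.D .one) : Prop := LtAdd x y e ∧ LtAdd y x e

variable (M) in
/-- The real `0`. -/
def zeroC : M.D .one := M.con (.combPi .nat .nat) ⋄ 0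

variable (M) in
/-- The real `1`. -/
def oneC : M.D .one := M.con (.combPi .nat .nat) ⋄ (1 + 1 + 1 + 1 + 1)

section Den

variable {c : Ctx M.toPreStr} {x y z : Re} {a b d : M.D .one} [x.Den c a] [y.Den c b] [z.Den c d]

instance den_isReal : (isReal x).Den c (IsReal a) := by
  unfold isReal IsReal allN
  infer_instance

instance den_leR : (leR x y).Den c (LeR a b) := by
  unfold leR LeR allN
  infer_instance

instance den_eqR : (eqR x y).Den c (EqR a b) := by
  unfold eqR EqR allN
  infer_instance

instance den_addR : (addR x y z).Den c (AddR a b d) := by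
  unfold addR AddR allN exN
  infer_instance

instance den_mulR : (mulR x y z).Den c (MulR a b d) := by
  unfold mulR MulR allN exN
  infer_instance

instance den_ltR : (ltR x y).Den c (¬ LeR b a) := by
  unfold ltR
  infer_instance

instance den_ltAdd : (ltAdd x y z).Den c (LtAdd a b d) := by
  unfold ltAdd LtAdd exR
  infer_instance

instance den_leAdd : (leAdd x y z).Den c (LeAdd a b d) := by
  unfold leAdd LeAdd exR
  infer_instance

instance den_near : (near x y z).Den c (Near a b d) := by
  unfold near Near
  infer_instance

instance den_between : (between x y z).Den c (LeR a b ∧ LeR b d) := by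
  unfold between
  infer_instance

instance den_zeroR : zeroR.Den c M.zeroC := by
  unfold zeroR zeroC
  infer_instance

instance den_oneR : oneR.Den c M.oneC := by
  unfold oneR oneC
  infer_instance

end Den

theorem exists_add_and_iff {y z : M.D .one} (hy : IsReal y) (hz : IsReal z) {P : M.R → Prop} {Q : M.D .one → Prop}
    (h : ∀ u, IsReal u → (Q u ↔ P (val u))) :
    (∃ u, IsReal u ∧ AddR y z u ∧ Q u) ↔ P (val y + val z) := by
  constructor
  · rintro ⟨u, hu, h1, h2⟩
    rw [(addR_iff hy hz hu).1 h1]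
    exact (h u hu).1 h2
  · intro hP
    obtain ⟨u, hu, h1⟩ := exists_val (val y + val z)
    exact ⟨u, hu, (addR_iff hy hz hu).2 h1.symm, (h u hu).2 (h1 ▸ hP)⟩

section iff

variable {x y z : M.D .one} (hx : IsReal x) (hy : IsReal y) (hz : IsReal z)

include hx hy

theorem LeR.iff : LeR x y ↔ val x ≤ val y := leR_iff hx hy

theorem not_leR_iff : ¬ LeR x y ↔ val y < val x := by rw [LeR.iff hx hy, not_le]

theorem EqR.iff : EqR x y ↔ val x = val y := eqR_iff hx hy

include hz

theorem AddR.iff : AddR x y z ↔ val x + val y = val z := addR_iff hx hy hz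

theorem MulR.iff : MulR x y z ↔ val x * val y = val z := mulR_iff hx hy hz

theorem LtAdd.iff : LtAdd x y z ↔ val x < val y + val z :=
  exists_add_and_iff hy hz fun _ hu => not_leR_iff hu hx

theorem LeAdd.iff : LeAdd x y z ↔ val x ≤ val y + val z :=
  exists_add_and_iff hy hz fun _ hu => LeR.iff hx hu

theorem Near.iff : Near x y z ↔ |val x - val y| < val z := by
  rw [Near, LtAdd.iff hx hy hz, LtAdd.iff hy hx hz, abs_lt]
  constructor
  · exact fun h => ⟨by linarith [h.2], by linarith [h.1]⟩
  · exact fun h => ⟨by linarith [h.2], by linarith [h.1]⟩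

end iff

theorem isReal_const {q : M.N} : IsReal (M.con (.combPi .nat .nat) ⋄ q) ∧
    val (M.con (.combPi .nat .nat) ⋄ q) = ofQ (rat q) := by
  refine isReal_of_abs_sub_le fun n => ?_
  rw [combPi_app, sub_self, abs_zero]
  exact (ofQ_pos (eps_pos _)).le

theorem isReal_zeroC : IsReal M.zeroC := isReal_const.1

theorem val_zeroC : val M.zeroC = 0 := by
  have : CodesRat (0 : M.N) 0 0 1 := ⟨0, 0, by ring, by ring, .inl ⟨by ring, rfl⟩⟩
  rw [zeroC, isReal_const.2, this.rat_eq]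
  simp

theorem isReal_oneC : IsReal M.oneC := isReal_const.1

theorem val_oneC : val M.oneC = 1 := by
  have : CodesRat (1 + 1 + 1 + 1 + 1 : M.N) 1 0 1 :=
    ⟨1 + 1, 0, by ring, by ring, .inl ⟨by ring, rfl⟩⟩
  rw [oneC, isReal_const.2, this.rat_eq]
  simp

/-! ### The meaning of the notions of integration -/

/-- Real values on `I`, equal at equal reals. -/
structure IsFunOnI (f : M.D (.one ⇒ .one)) : Prop where
  isReal : ∀ x, IsReal x → 0 ≤ val x → val x ≤ 1 → IsReal (f ⋄ x)
  congr : ∀ x y, IsReal x → IsReal y → 0 ≤ val x → val x ≤ 1 → val x = val y →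
    val (f ⋄ x) = val (f ⋄ y)

/-- Positive real values on all reals, equal at equal reals. -/
structure IsGauge (δ : M.D (.one ⇒ .one)) : Prop where
  isReal : ∀ x, IsReal x → IsReal (δ ⋄ x)
  pos : ∀ x, IsReal x → 0 < val (δ ⋄ x)
  congr : ∀ x y, IsReal x → IsReal y → val x = val y → val (δ ⋄ x) = val (δ ⋄ y)

instance den_isFunOnI {c : Ctx M.toPreStr} {f : ReFun} {a : M.D (.one ⇒ .one)} [f.Den c a] :
    (isFunOnI f).Den c (IsFunOnI a) := by
  refine Form.Den.congr (P := (∀ x, IsReal x → LeR M.zeroC x ∧ LeR x M.oneC → IsReal (a ⋄ x)) ∧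
    (∀ x, IsReal x → ∀ y, IsReal y → LeR M.zeroC x ∧ LeR x M.oneC →
      LeR M.zeroC y ∧ LeR y M.oneC → EqR x y → EqR (a ⋄ x) (a ⋄ y)))
    (by unfold isFunOnI allR; infer_instance) ?_
  have key : ∀ x, IsReal x → ((LeR M.zeroC x ∧ LeR x M.oneC) ↔ (0 ≤ val x ∧ val x ≤ 1)) :=
    fun x hx => by rw [LeR.iff isReal_zeroC hx, LeR.iff hx isReal_oneC, val_zeroC, val_oneC]
  constructor
  · rintro ⟨h, h'⟩
    have hr : ∀ x, IsReal x → 0 ≤ val x → val x ≤ 1 → IsReal (a ⋄ x) := fun x hx h0 h1 =>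
      h x hx ((key x hx).2 ⟨h0, h1⟩)
    refine ⟨hr, fun x y hx hy h0 h1 hxy => ?_⟩
    have h2 := h' x hx y hy ((key x hx).2 ⟨h0, h1⟩) ((key y hy).2 (hxy ▸ ⟨h0, h1⟩))
      ((EqR.iff hx hy).2 hxy)
    exact (EqR.iff (hr x hx h0 h1) (hr y hy (hxy ▸ h0) (hxy ▸ h1))).1 h2
  · intro h
    refine ⟨fun x hx h1 => ?_, fun x hx y hy h1 h2 h3 => ?_⟩
    · have := (key x hx).1 h1
      exact h.isReal x hx this.1 this.2
    · have h1 := (key x hx).1 h1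
      have h2 := (key y hy).1 h2
      rw [EqR.iff (h.isReal x hx h1.1 h1.2) (h.isReal y hy h2.1 h2.2)]
      exact h.congr x y hx hy h1.1 h1.2 ((EqR.iff hx hy).1 h3)

instance den_isGauge {c : Ctx M.toPreStr} {f : ReFun} {a : M.D (.one ⇒ .one)} [f.Den c a] :
    (isGauge f).Den c (IsGauge a) := by
  refine Form.Den.congr (P := (∀ x, IsReal x → IsReal (a ⋄ x) ∧ ¬ LeR (a ⋄ x) M.zeroC) ∧
    (∀ x, IsReal x → ∀ y, IsReal y → EqR x y → EqR (a ⋄ x) (a ⋄ y)))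
    (by unfold isGauge allR; infer_instance) ?_
  constructor
  · rintro ⟨h, h'⟩
    refine ⟨fun x hx => (h x hx).1, fun x hx => ?_, fun x y hx hy hxy => ?_⟩
    · have := (not_leR_iff (h x hx).1 isReal_zeroC).1 (h x hx).2
      rwa [val_zeroC] at this
    · exact (EqR.iff (h x hx).1 (h y hy).1).1 (h' x hx y hy ((EqR.iff hx hy).2 hxy))
  · intro h
    refine ⟨fun x hx => ⟨h.isReal x hx, ?_⟩, fun x hx y hy hxy => ?_⟩
    · rw [not_leR_iff (h.isReal x hx) isReal_zeroC, val_zeroC]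
      exact h.pos x hx
    · rw [EqR.iff (h.isReal x hx) (h.isReal y hy)]
      exact h.congr x y hx hy ((EqR.iff hx hy).1 hxy)

variable (M) in
/-- The Cousin lemma, in the model. -/
def Cousin : Prop := ∀ Ψ : M.D (.one ⇒ .one), IsGauge Ψ →
  ∃ (k : M.N) (y : M.D (.nat ⇒ .one)), (∀ i, i < k → IsReal (y ⋄ i)) ∧
    ∀ x, IsReal x → 0 ≤ val x → val x ≤ 1 → ∃ i, i < k ∧ |val x - val (y ⋄ i)| < val (Ψ ⋄ (y ⋄ i))

instance den_HBU {c : Ctx M.toPreStr} : HBU.Den c M.Cousin := by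
  refine Form.Den.congr (P := ∀ Ψ : M.D (.one ⇒ .one), IsGauge Ψ →
    ∃ (k : M.N) (y : M.D (.nat ⇒ .one)), (∀ i, i < k → IsReal (y ⋄ i)) ∧
    ∀ x, IsReal x → LeR M.zeroC x ∧ LeR x M.oneC → ∃ i, i < k ∧ Near x (y ⋄ i) (Ψ ⋄ (y ⋄ i)))
    (by unfold HBU allR exN allLt allN; infer_instance) ?_
  refine forall_congr' fun Ψ => forall_congr' fun hΨ => exists_congr fun k => exists_congr fun y =>
    and_congr_right fun hy => forall_congr' fun x => forall_congr' fun hx => ?_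
  rw [LeR.iff isReal_zeroC hx, LeR.iff hx isReal_oneC, val_zeroC, val_oneC, and_imp]
  refine forall_congr' fun _ => forall_congr' fun _ => exists_congr fun i =>
    and_congr_right fun hi => ?_
  rw [Near.iff hx (hy i hi) (hΨ.isReal _ (hy i hi))]

/-- A tagged partition of `[a, b]`. -/
structure IsPart (a b : M.R) (k : M.N) (p t : M.D (.nat ⇒ .one)) : Prop where
  real_p : ∀ i, i ≤ k → IsReal (p ⋄ i)
  real_t : ∀ i, i < k → IsReal (t ⋄ i)
  left : val (p ⋄ 0) = a
  right : val (p ⋄ k) = b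
  lt : ∀ i, i < k → val (p ⋄ i) < val (p ⋄ (i + 1))
  le_tag : ∀ i, i < k → val (p ⋄ i) ≤ val (t ⋄ i)
  tag_le : ∀ i, i < k → val (t ⋄ i) ≤ val (p ⋄ (i + 1))

/-- The partition is `δ`-fine. -/
def Fine (δ : M.D (.one ⇒ .one)) (k : M.N) (p t : M.D (.nat ⇒ .one)) : Prop :=
  ∀ i, i < k → val (t ⋄ i) ≤ val (p ⋄ i) + val (δ ⋄ (t ⋄ i)) ∧
    val (p ⋄ (i + 1)) ≤ val (t ⋄ i) + val (δ ⋄ (t ⋄ i))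

/-- The mesh of the partition is at most `d`. -/
def Mesh (d : M.R) (k : M.N) (p : M.D (.nat ⇒ .one)) : Prop :=
  ∀ i, i < k → val (p ⋄ (i + 1)) ≤ val (p ⋄ i) + d

/-- The Riemann sum has distance less than `e` from `A`. -/
def SumNear (f : M.D (.one ⇒ .one)) (k : M.N) (p t : M.D (.nat ⇒ .one)) (A e : M.R) : Prop :=
  ∃ S : M.D (.nat ⇒ .one), (∀ i, i ≤ k → IsReal (S ⋄ i)) ∧ val (S ⋄ 0) = 0 ∧
    (∀ i, i < k → val (S ⋄ (i + 1)) =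
      val (S ⋄ i) + val (f ⋄ (t ⋄ i)) * (val (p ⋄ (i + 1)) - val (p ⋄ i))) ∧
    |val (S ⋄ k) - A| < e

section raw

variable (a b : M.D .one) (k : M.N) (p t : M.D (.nat ⇒ .one)) (f : M.D (.one ⇒ .one))

/-- This and the other `Raw` notions are the literal readings of the formulas, in terms of codes,
before the passage to values. -/
def TPRaw : Prop := (∀ i, i ≤ k → IsReal (p ⋄ i)) ∧ (∀ i, i < k → IsReal (t ⋄ i)) ∧
  EqR (p ⋄ 0) a ∧ EqR (p ⋄ k) b ∧ ∀ i, i < k → ¬ LeR (p ⋄ (i + 1)) (p ⋄ i) ∧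
    LeR (p ⋄ i) (t ⋄ i) ∧ LeR (t ⋄ i) (p ⋄ (i + 1))

def FineRaw : Prop := ∀ i, i < k → ∀ y, IsReal y → LeR (p ⋄ i) y ∧ LeR y (p ⋄ (i + 1)) →
  LeAdd (t ⋄ i) y (f ⋄ (t ⋄ i)) ∧ LeAdd y (t ⋄ i) (f ⋄ (t ⋄ i))

def MeshRaw : Prop := ∀ i, i < k → LeAdd (p ⋄ (i + 1)) (p ⋄ i) a

def SumRaw : Prop := ∃ s, IsReal s ∧ (∃ S : M.D (.nat ⇒ .one), (∀ i, i ≤ k → IsReal (S ⋄ i)) ∧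
  EqR (S ⋄ 0) M.zeroC ∧ (∀ i, i < k → ∃ l, IsReal l ∧ ∃ m, IsReal m ∧
    AddR (p ⋄ i) l (p ⋄ (i + 1)) ∧ MulR (f ⋄ (t ⋄ i)) l m ∧ AddR (S ⋄ i) m (S ⋄ (i + 1))) ∧
  EqR s (S ⋄ k)) ∧ Near s a b

variable {a b k p t f}

theorem tpRaw_iff (ha : IsReal a) (hb : IsReal b) :
    TPRaw a b k p t ↔ IsPart (val a) (val b) k p t := by
  have h1 : ∀ i : M.N, i < k → i + 1 ≤ k := fun i => succ_le_iff'.2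
  constructor
  · rintro ⟨hp, ht, h0, hk, h⟩
    refine ⟨hp, ht, (EqR.iff (hp 0 (zero_le' k)) ha).1 h0, (EqR.iff (hp k le_rfl) hb).1 hk,
      fun i hi => ?_, fun i hi => ?_, fun i hi => ?_⟩
    · exact (not_leR_iff (hp _ (h1 i hi)) (hp i hi.le)).1 (h i hi).1
    · exact (LeR.iff (hp i hi.le) (ht i hi)).1 (h i hi).2.1
    · exact (LeR.iff (ht i hi) (hp _ (h1 i hi))).1 (h i hi).2.2
  · rintro ⟨hp, ht, h0, hk, h2, h3, h4⟩
    refine ⟨hp, ht, (EqR.iff (hp 0 (zero_le' k)) ha).2 h0, (EqR.iff (hp k le_rfl) hb).2 hk,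
      fun i hi => ⟨?_, ?_, ?_⟩⟩
    · exact (not_leR_iff (hp _ (h1 i hi)) (hp i hi.le)).2 (h2 i hi)
    · exact (LeR.iff (hp i hi.le) (ht i hi)).2 (h3 i hi)
    · exact (LeR.iff (ht i hi) (hp _ (h1 i hi))).2 (h4 i hi)

/-- Inclusion of an interval in an interval need only be tested at the two end points. -/
theorem fineRaw_iff {A B : M.R} (h : IsPart A B k p t) (hf : IsGauge f) :
    FineRaw k p t f ↔ Fine f k p t := by
  refine forall_congr' fun i => forall_congr' fun hi => ?_
  have hp := h.real_p i hi.le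
  have hp' := h.real_p _ (succ_le_iff'.2 hi)
  have ht := h.real_t i hi
  have hft := hf.isReal _ ht
  constructor
  · intro H
    have h1 := (H _ hp ⟨(LeR.iff hp hp).2 le_rfl, (LeR.iff hp hp').2 (h.lt i hi).le⟩).1
    have h2 := (H _ hp' ⟨(LeR.iff hp hp').2 (h.lt i hi).le, (LeR.iff hp' hp').2 le_rfl⟩).2
    exact ⟨(LeAdd.iff ht hp hft).1 h1, (LeAdd.iff hp' ht hft).1 h2⟩
  · rintro ⟨H1, H2⟩ y hy ⟨h1, h2⟩
    rw [LeAdd.iff ht hy hft, LeAdd.iff hy ht hft]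
    have h1 := (LeR.iff hp hy).1 h1
    have h2 := (LeR.iff hy hp').1 h2
    exact ⟨by linarith, by linarith⟩

theorem meshRaw_iff (ha : IsReal a) {A B : M.R} (h : IsPart A B k p t) :
    MeshRaw a k p ↔ Mesh (val a) k p :=
  forall_congr' fun i => forall_congr' fun hi =>
    LeAdd.iff (h.real_p _ (succ_le_iff'.2 hi)) (h.real_p i hi.le) ha

theorem sumRaw_iff (ha : IsReal a) (hb : IsReal b) {A B : M.R} (h : IsPart A B k p t)
    (hf : ∀ i, i < k → IsReal (f ⋄ (t ⋄ i))) :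
    SumRaw a b k p t f ↔ SumNear f k p t (val a) (val b) := by
  constructor
  · rintro ⟨s, hs, ⟨S, hS, h0, h1, hk⟩, hn⟩
    refine ⟨S, hS, ?_, fun i hi => ?_, ?_⟩
    · rw [(EqR.iff (hS 0 (zero_le' k)) isReal_zeroC).1 h0, val_zeroC]
    · obtain ⟨l, hl, m, hm, h2, h3, h4⟩ := h1 i hi
      have hi' := succ_le_iff'.2 hi
      rw [AddR.iff (h.real_p i hi.le) hl (h.real_p _ hi')] at h2
      rw [MulR.iff (hf i hi) hl hm] at h3
      rw [AddR.iff (hS i hi.le) hm (hS _ hi')] at h4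
      rw [← h4, ← h3, ← h2, add_sub_cancel_left]
    · rw [← (EqR.iff hs (hS k le_rfl)).1 hk]
      exact (Near.iff hs ha hb).1 hn
  · rintro ⟨S, hS, h0, h1, hn⟩
    refine ⟨S ⋄ k, hS k le_rfl, ⟨S, hS, ?_, fun i hi => ?_, ?_⟩, ?_⟩
    · rw [EqR.iff (hS 0 (zero_le' k)) isReal_zeroC, h0, val_zeroC]
    · have hi' := succ_le_iff'.2 hi
      obtain ⟨l, hl, hl'⟩ := exists_val (val (p ⋄ (i + 1)) - val (p ⋄ i))
      obtain ⟨m, hm, hm'⟩ := exists_val (val (f ⋄ (t ⋄ i)) * val l)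
      refine ⟨l, hl, m, hm, ?_, ?_, ?_⟩
      · rw [AddR.iff (h.real_p i hi.le) hl (h.real_p _ hi'), hl', add_sub_cancel]
      · rw [MulR.iff (hf i hi) hl hm, hm']
      · rw [AddR.iff (hS i hi.le) hm (hS _ hi'), h1 i hi, hm', hl']
    · rw [EqR.iff (hS k le_rfl) (hS k le_rfl)]
    · rwa [Near.iff (hS k le_rfl) ha hb]

section Den

variable {c : Ctx M.toPreStr} {x y : Re} {k' : NatE} {p' t' : ReSeq} {f' : ReFun}
  [x.Den c a] [y.Den c b] [k'.Den c k] [p'.Den c p] [t'.Den c t] [f'.Den c f]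

instance den_isTaggedPartition : (isTaggedPartition x y k' p' t').Den c (TPRaw a b k p t) := by
  unfold isTaggedPartition TPRaw allLe allLt allN
  infer_instance

instance den_isFine : (isFine f' k' p' t').Den c (FineRaw k p t f) := by
  unfold isFine FineRaw allLt allR allN
  infer_instance

instance den_meshLe : (meshLe x k' p').Den c (MeshRaw a k p) := by
  unfold meshLe MeshRaw allLt allN
  infer_instance

instance den_sumNear : (sumNear f' k' p' t' x y).Den c (SumRaw a b k p t f) := by
  unfold sumNear SumRaw isRiemannSum allLe allLt exR allN
  infer_instance

end Den

end raw

end Model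

end HigherOrderArithmetic

namespace HigherOrderArithmetic

local infixr:60 " ⇒ " => Ty.arr

namespace Model

set_option synthInstance.maxSize 4000
set_option synthInstance.maxHeartbeats 400000

variable {M : Model}

local infixl:100 " ⋄ " => PreStr.app (Model.toPreStr _)

/-! ### Partitions -/

section IsPart

variable {a b : M.R} {k : M.N} {p t : M.D (.nat ⇒ .one)} {f : M.D (.one ⇒ .one)}

theorem IsPart.mono (h : IsPart a b k p t) {i j : M.N} (hij : i ≤ j) (hj : j ≤ k) :
    val (p ⋄ i) ≤ val (p ⋄ j) := by
  obtain ⟨d, rfl⟩ := (le_iff_exists_add' _ _).1 hij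
  clear hij
  revert hj
  induction d using induction with
  | h => infer_instance
  | h0 => intro _; rw [M.add_zero]
  | hs d ih =>
    intro hj
    rw [M.add_succ] at hj ⊢
    exact (ih (lt_of_lt_of_le (lt_add_one _) hj).le).trans (h.lt _ (succ_le_iff'.1 hj)).le

theorem IsPart.left_le (h : IsPart a b k p t) {i : M.N} (hi : i ≤ k) : a ≤ val (p ⋄ i) := by
  rw [← h.left]
  exact h.mono (zero_le' i) hi

theorem IsPart.le_right (h : IsPart a b k p t) {i : M.N} (hi : i ≤ k) : val (p ⋄ i) ≤ b := by
  rw [← h.right]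
  exact h.mono hi le_rfl

theorem IsPart.isReal_tag (h : IsPart a b k p t) (ha : 0 ≤ a) (hb : b ≤ 1) (hf : IsFunOnI f)
    (i : M.N) (hi : i < k) : IsReal (f ⋄ (t ⋄ i)) :=
  hf.isReal _ (h.real_t i hi) (ha.trans ((h.left_le hi.le).trans (h.le_tag i hi)))
    ((h.tag_le i hi).trans ((h.le_right (succ_le_iff'.2 hi)).trans hb))

end IsPart

/-! ### Integrals -/

section integrals

variable (f : M.D (.one ⇒ .one))

/-- `B` is a Riemann integral of `f` on `[a, b]`. -/
def RInt (a b B : M.R) : Prop := ∀ e, M.IsVal e → 0 < e → ∃ d, M.IsVal d ∧ 0 < d ∧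
  ∀ k p t, IsPart a b k p t → Mesh d k p → SumNear f k p t B e

/-- `A` is a gauge integral of `f`. -/
def GInt (A : M.R) : Prop := ∀ e, M.IsVal e → 0 < e → ∃ δ, IsGauge δ ∧
  ∀ k p t, IsPart 0 1 k p t → Fine δ k p t → SumNear f k p t A e

/-- `Φ` is a gauge modulus for the gauge integral `A` of `f`. -/
structure GMod (A : M.R) (Φ : M.D (.one ⇒ .one ⇒ .one)) : Prop where
  gauge : ∀ e, IsReal e → IsGauge (Φ ⋄ e)
  congr : ∀ e e', IsReal e → IsReal e' → val e = val e' → ∀ x, IsReal x →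
    val (Φ ⋄ e ⋄ x) = val (Φ ⋄ e' ⋄ x)
  sumNear : ∀ e, IsReal e → 0 < val e → ∀ k p t, IsPart 0 1 k p t → Fine (Φ ⋄ e) k p t →
    SumNear f k p t A (val e)

/-- `f` is gauge integrable with a modulus. -/
def GIntegrable : Prop := ∃ A, M.IsVal A ∧ ∃ Φ, GMod f A Φ

/-- `f` is Riemann integrable on `[x, 1]` for all `x ∈ (0, 1]`. -/
def RIntegrableOffZero : Prop := ∀ x, M.IsVal x → 0 < x → x ≤ 1 → ∃ B, M.IsVal B ∧ RInt f x 1 B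

/-- The Riemann integrals of `f` on `[x, 1]` tend to `L` as `x → 0+`. -/
def Tends (L : M.R) : Prop := ∀ e, M.IsVal e → 0 < e → ∃ η, M.IsVal η ∧ 0 < η ∧
  ∀ x, M.IsVal x → 0 < x → x < η → x ≤ 1 → ∀ B, M.IsVal B → RInt f x 1 B → |B - L| < e

def RIntRaw (a b B : M.D .one) : Prop := ∀ e, IsReal e → ¬ LeR e M.zeroC →
  ∃ d, IsReal d ∧ ¬ LeR d M.zeroC ∧ ∀ (k : M.N) p t, TPRaw a b k p t → MeshRaw d k p →
    SumRaw B e k p t f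

def GIntRaw (A : M.D .one) : Prop := ∀ e, IsReal e → ¬ LeR e M.zeroC →
  ∃ δ, IsGauge δ ∧ ∀ (k : M.N) p t, TPRaw M.zeroC M.oneC k p t → FineRaw k p t δ →
    SumRaw A e k p t f

def GModRaw (A : M.D .one) (Φ : M.D (.one ⇒ .one ⇒ .one)) : Prop :=
  (∀ e, IsReal e → IsGauge (Φ ⋄ e)) ∧
  (∀ e, IsReal e → ∀ e', IsReal e' → EqR e e' → ∀ x, IsReal x → EqR (Φ ⋄ e ⋄ x) (Φ ⋄ e' ⋄ x)) ∧
  (∀ e, IsReal e → ¬ LeR e M.zeroC → ∀ (k : M.N) p t, TPRaw M.zeroC M.oneC k p t →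
    FineRaw k p t (Φ ⋄ e) → SumRaw A e k p t f)

def TendsRaw (L : M.D .one) : Prop := ∀ e, IsReal e → ¬ LeR e M.zeroC →
  ∃ η, IsReal η ∧ ¬ LeR η M.zeroC ∧ ∀ x, IsReal x → ¬ LeR x M.zeroC → ¬ LeR η x →
    LeR x M.oneC → ∀ B, IsReal B → RIntRaw f x M.oneC B → Near B L e

variable {f}

theorem not_leR_zeroC_iff {x : M.D .one} (hx : IsReal x) : ¬ LeR x M.zeroC ↔ 0 < val x := by
  rw [not_leR_iff hx isReal_zeroC, val_zeroC]

theorem tpRaw_unit_iff {k : M.N} {p t : M.D (.nat ⇒ .one)} :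
    TPRaw M.zeroC M.oneC k p t ↔ IsPart 0 1 k p t := by
  rw [tpRaw_iff isReal_zeroC isReal_oneC, val_zeroC, val_oneC]

variable (hf : IsFunOnI f)

include hf

/-- The bounds on `a` and `b` keep the tags inside `I`, where `f` takes real values, so that Riemann
sums may be computed with values. -/
theorem rIntRaw_iff {a b B : M.D .one} (ha : IsReal a) (hb : IsReal b) (hB : IsReal B)
    (ha0 : 0 ≤ val a) (hb1 : val b ≤ 1) : RIntRaw f a b B ↔ RInt f (val a) (val b) (val B) := by
  refine forall_real_congr (P := fun e => 0 < e → ∃ d, M.IsVal d ∧ 0 < d ∧ ∀ k p t,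
    IsPart (val a) (val b) k p t → Mesh d k p → SumNear f k p t (val B) e) fun e he => ?_
  refine imp_congr (not_leR_zeroC_iff he) ?_
  refine exists_real_congr (P := fun d => 0 < d ∧ ∀ k p t,
    IsPart (val a) (val b) k p t → Mesh d k p → SumNear f k p t (val B) (val e)) fun d hd => ?_
  refine and_congr (not_leR_zeroC_iff hd) ?_
  refine forall_congr' fun k => forall_congr' fun p => forall_congr' fun t =>
    imp_congr_ctx (tpRaw_iff ha hb) fun h => ?_
  rw [meshRaw_iff hd h, sumRaw_iff hB he h (h.isReal_tag ha0 hb1 hf)]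

theorem gIntRaw_iff {A : M.D .one} (hA : IsReal A) : GIntRaw f A ↔ GInt f (val A) := by
  refine forall_real_congr (P := fun e => 0 < e → ∃ δ, IsGauge δ ∧ ∀ k p t,
    IsPart 0 1 k p t → Fine δ k p t → SumNear f k p t (val A) e) fun e he => ?_
  refine imp_congr (not_leR_zeroC_iff he) ?_
  refine exists_congr fun δ => and_congr_right fun hδ => ?_
  refine forall_congr' fun k => forall_congr' fun p => forall_congr' fun t =>
    imp_congr_ctx tpRaw_unit_iff fun h => ?_
  rw [fineRaw_iff h hδ, sumRaw_iff hA he h (h.isReal_tag le_rfl le_rfl hf)]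

theorem gModRaw_iff {A : M.D .one} (hA : IsReal A) {Φ : M.D (.one ⇒ .one ⇒ .one)} :
    GModRaw f A Φ ↔ GMod f (val A) Φ := by
  have key : ∀ e, IsReal e → IsGauge (Φ ⋄ e) → ∀ k p t, IsPart 0 1 k p t →
      ((FineRaw k p t (Φ ⋄ e) → SumRaw A e k p t f) ↔
        (Fine (Φ ⋄ e) k p t → SumNear f k p t (val A) (val e))) := fun e he hg k p t h => by
    rw [fineRaw_iff h hg, sumRaw_iff hA he h (h.isReal_tag le_rfl le_rfl hf)]
  constructor
  · rintro ⟨h1, h2, h3⟩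
    refine ⟨h1, fun e e' he he' hee x hx => ?_, fun e he he0 k p t h => ?_⟩
    · exact (EqR.iff ((h1 e he).isReal x hx) ((h1 e' he').isReal x hx)).1
        (h2 e he e' he' ((EqR.iff he he').2 hee) x hx)
    · exact (key e he (h1 e he) k p t h).1
        (h3 e he ((not_leR_zeroC_iff he).2 he0) k p t (tpRaw_unit_iff.2 h))
  · rintro ⟨h1, h2, h3⟩
    refine ⟨h1, fun e he e' he' hee x hx => ?_, fun e he he0 k p t h => ?_⟩
    · exact (EqR.iff ((h1 e he).isReal x hx) ((h1 e' he').isReal x hx)).2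
        (h2 e e' he he' ((EqR.iff he he').1 hee) x hx)
    · have h := tpRaw_unit_iff.1 h
      exact (key e he (h1 e he) k p t h).2 (h3 e he ((not_leR_zeroC_iff he).1 he0) k p t h)

theorem tendsRaw_iff {L : M.D .one} (hL : IsReal L) : TendsRaw f L ↔ Tends f (val L) := by
  refine forall_real_congr (P := fun e => 0 < e → ∃ η, M.IsVal η ∧ 0 < η ∧
    ∀ x, M.IsVal x → 0 < x → x < η → x ≤ 1 → ∀ B, M.IsVal B → RInt f x 1 B →
      |B - val L| < e) fun e he => ?_
  refine imp_congr (not_leR_zeroC_iff he) ?_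
  refine exists_real_congr (P := fun η => 0 < η ∧
    ∀ x, M.IsVal x → 0 < x → x < η → x ≤ 1 → ∀ B, M.IsVal B → RInt f x 1 B →
      |B - val L| < val e) fun η hη => ?_
  refine and_congr (not_leR_zeroC_iff hη) ?_
  refine forall_real_congr (P := fun x => 0 < x → x < val η → x ≤ 1 →
    ∀ B, M.IsVal B → RInt f x 1 B → |B - val L| < val e) fun x hx => ?_
  refine imp_congr_ctx (not_leR_zeroC_iff hx) fun hx0 => imp_congr (not_leR_iff hη hx) ?_
  rw [LeR.iff hx isReal_oneC, val_oneC]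
  refine imp_congr_right fun _ => ?_
  refine forall_real_congr (P := fun B => RInt f (val x) 1 B → |B - val L| < val e) fun B hB => ?_
  rw [rIntRaw_iff hf hx isReal_oneC hB hx0.le val_oneC.le, val_oneC, Near.iff hB hL he]

omit hf

section Den

variable {c : Ctx M.toPreStr} {x y z : Re} {a b d : M.D .one} [x.Den c a] [y.Den c b] [z.Den c d]
  {f' : ReFun} [f'.Den c f]

instance den_isRiemannIntegral : (isRiemannIntegral f' x y z).Den c (RIntRaw f a b d) := by
  unfold isRiemannIntegral RIntRaw allR exR allTP allN
  infer_instance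

instance den_isGaugeIntegral : (isGaugeIntegral f' x).Den c (GIntRaw f a) := by
  unfold isGaugeIntegral GIntRaw allR allTP allN
  infer_instance

instance den_isGaugeModulus {Φ' : Exp (.one ⇒ .one ⇒ .one)} {Φ : M.D (.one ⇒ .one ⇒ .one)}
    [Φ'.Den c Φ] : (isGaugeModulus f' x Φ').Den c (GModRaw f a Φ) := by
  unfold isGaugeModulus GModRaw allR allTP allN
  infer_instance

instance den_tendsToAtZero : (tendsToAtZero f' x).Den c (TendsRaw f a) := by
  unfold tendsToAtZero TendsRaw allR exR
  infer_instance

end Den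

end integrals

variable (M) in
/-- There is a function that is not gauge integrable with a modulus. -/
def NotAllGaugeIntegrable : Prop := ∃ f : M.D (.one ⇒ .one), IsFunOnI f ∧ ¬ GIntegrable f

variable (M) in
/-- Hake's theorem. -/
def Hake : Prop := ∀ f : M.D (.one ⇒ .one), IsFunOnI f → GIntegrable f →
  RIntegrableOffZero f → ∀ A, M.IsVal A → GInt f A → Tends f A

variable (M) in
/-- The weak Hake theorem. -/
def WeakHake : Prop := ∀ f : M.D (.one ⇒ .one), IsFunOnI f → GIntegrable f →
  RIntegrableOffZero f → ∃ L, M.IsVal L ∧ Tends f L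

section sentences

variable {f : M.D (.one ⇒ .one)} (hf : IsFunOnI f)

include hf

theorem gIntegrable_iff : (∃ A, IsReal A ∧ ∃ Φ, GModRaw f A Φ) ↔ GIntegrable f :=
  exists_real_congr (P := fun A => ∃ Φ, GMod f A Φ) fun _ hA => exists_congr fun _ =>
    gModRaw_iff hf hA

theorem rIntegrableOffZero_iff : (∀ x, IsReal x → ¬ LeR x M.zeroC → LeR x M.oneC →
    ∃ B, IsReal B ∧ RIntRaw f x M.oneC B) ↔ RIntegrableOffZero f := by
  refine forall_real_congr (P := fun x => 0 < x → x ≤ 1 → ∃ B, M.IsVal B ∧ RInt f x 1 B)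
    fun x hx => imp_congr_ctx (not_leR_zeroC_iff hx) fun hx0 => ?_
  rw [LeR.iff hx isReal_oneC, val_oneC]
  refine imp_congr_right fun _ => exists_real_congr (P := fun B => RInt f (val x) 1 B)
    fun B hB => ?_
  rw [rIntRaw_iff hf hx isReal_oneC hB hx0.le val_oneC.le, val_oneC]

end sentences

section Den

variable {c : Ctx M.toPreStr}

instance den_notAllGaugeIntegrable : notAllGaugeIntegrable.Den c M.NotAllGaugeIntegrable := by
  refine Form.Den.congr (P := ∃ f : M.D (.one ⇒ .one), IsFunOnI f ∧
      ¬ ∃ A, IsReal A ∧ ∃ Φ, GModRaw f A Φ)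
    (by unfold notAllGaugeIntegrable gaugeIntegrableWithModulus exR; infer_instance) ?_
  exact exists_congr fun f => and_congr_right fun hf => not_congr (gIntegrable_iff hf)

instance den_hake : hake.Den c M.Hake := by
  refine Form.Den.congr (P := ∀ f : M.D (.one ⇒ .one), IsFunOnI f →
      (∃ A, IsReal A ∧ ∃ Φ, GModRaw f A Φ) → (∀ x, IsReal x → ¬ LeR x M.zeroC → LeR x M.oneC →
      ∃ B, IsReal B ∧ RIntRaw f x M.oneC B) → ∀ A, IsReal A → GIntRaw f A → TendsRaw f A)
    (by unfold hake gaugeIntegrableWithModulus riemannIntegrableOffZero allR exR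
        infer_instance) ?_
  refine forall_congr' fun f => forall_congr' fun hf => ?_
  rw [gIntegrable_iff hf, rIntegrableOffZero_iff hf]
  refine imp_congr_right fun _ => imp_congr_right fun _ => ?_
  exact forall_real_congr (P := fun A => GInt f A → Tends f A) fun A hA => by
    rw [gIntRaw_iff hf hA, tendsRaw_iff hf hA]

instance den_weakHake : weakHake.Den c M.WeakHake := by
  refine Form.Den.congr (P := ∀ f : M.D (.one ⇒ .one), IsFunOnI f →
      (∃ A, IsReal A ∧ ∃ Φ, GModRaw f A Φ) → (∀ x, IsReal x → ¬ LeR x M.zeroC → LeR x M.oneC →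
      ∃ B, IsReal B ∧ RIntRaw f x M.oneC B) → ∃ L, IsReal L ∧ TendsRaw f L)
    (by unfold weakHake gaugeIntegrableWithModulus riemannIntegrableOffZero allR exR
        infer_instance) ?_
  refine forall_congr' fun f => forall_congr' fun hf => ?_
  rw [gIntegrable_iff hf, rIntegrableOffZero_iff hf]
  refine imp_congr_right fun _ => imp_congr_right fun _ => ?_
  exact exists_real_congr (P := fun L => Tends f L) fun L hL => tendsRaw_iff hf hL

end Den

end Model

end HigherOrderArithmetic

/-! ### The analysis in a model: Cousin's lemma, Hake's theorem, and a counterexample. -/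

namespace HigherOrderArithmetic

local infixr:60 " ⇒ " => Ty.arr

namespace Model

set_option synthInstance.maxSize 4000
set_option synthInstance.maxHeartbeats 400000

variable {M : Model}

local infixl:100 " ⋄ " => PreStr.app (Model.toPreStr _)

/-! ### Sequences -/

theorem RealRep.exists_seq {z : M.N → M.R} (h : M.RealRep fun x : Unit × M.N => z x.2) :
    ∃ s : M.D (.nat ⇒ .one), ∀ i, IsReal (s ⋄ i) ∧ val (s ⋄ i) = z i := by
  obtain ⟨g, -, hg⟩ := h.exists_lam
  exact ⟨g (), hg ()⟩

theorem Dec.exists_fun {P : M.N → Prop} (h : M.Dec fun x : Unit × M.N => P x.2) :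
    ∃ f : M.D .one, ∀ i, f ⋄ i = 0 ↔ P i := by
  obtain ⟨F, hF, hP⟩ := h
  obtain ⟨g, -, hg⟩ := hF.exists_lam
  exact ⟨g (), fun i => by rw [hg, hP]⟩

theorem exists_pred : ∃ f : M.D .one, ∀ i, f ⋄ (i + 1) = i := by
  obtain ⟨F, hF, h⟩ := exists_search (X := Unit × M.N) (P := fun x j => x.2 = j + 1)
  obtain ⟨g, -, hg⟩ := hF.exists_lam
  refine ⟨g (), fun i => ?_⟩
  rw [hg]
  exact (add_right_cancel (h ((), i + 1) ⟨i, rfl⟩)).symm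

/-- The sequence `r, s 0, s 1, …`. -/
theorem exists_shift (r : M.R) [M.IsVal r] (s : M.D (.nat ⇒ .one)) :
    ∃ s' : M.D (.nat ⇒ .one), (∀ i, IsReal (s' ⋄ i)) ∧ val (s' ⋄ 0) = r ∧
      ∀ i, val (s' ⋄ (i + 1)) = val (s ⋄ i) := by
  classical
  obtain ⟨f, hf⟩ := M.exists_pred
  obtain ⟨s', hs⟩ := RealRep.exists_seq (M := M)
    (z := fun i => if i = 0 then r else val (s ⋄ (f ⋄ i))) inferInstance
  refine ⟨s', fun i => (hs i).1, ?_, fun i => ?_⟩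
  · rw [(hs 0).2, if_pos rfl]
  · rw [(hs _).2, if_neg (M.succ_ne_zero i), hf]

/-- The maximum of finitely many reals. -/
theorem exists_max (f : M.D .one) (v : M.D (.nat ⇒ .one)) {k : M.N}
    (h : ∃ j, j < k ∧ f ⋄ j = 0) :
    ∃ j, (j < k ∧ f ⋄ j = 0) ∧ ∀ i, i < k → f ⋄ i = 0 → val (v ⋄ i) ≤ val (v ⋄ j) := by
  revert h
  induction k using induction with
  | h => infer_instance
  | h0 => exact fun ⟨j, hj, _⟩ => (M.not_lt_zero j hj).elim
  | hs k ih =>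
    intro h
    have hsucc : ∀ {i : M.N}, i < k → i < k + 1 := fun hi => hi.trans (lt_add_one k)
    by_cases hk : f ⋄ k = 0
    · by_cases h' : ∃ j, j < k ∧ f ⋄ j = 0
      · obtain ⟨j, ⟨hj, hfj⟩, hmax⟩ := ih h'
        rcases le_total (val (v ⋄ j)) (val (v ⋄ k)) with hle | hle
        · refine ⟨k, ⟨lt_add_one k, hk⟩, fun i hi hfi => ?_⟩
          rcases (M.lt_succ _ _).1 hi with hi | rfl
          · exact (hmax i hi hfi).trans hle
          · exact le_rfl
        · refine ⟨j, ⟨hsucc hj, hfj⟩, fun i hi hfi => ?_⟩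
          rcases (M.lt_succ _ _).1 hi with hi | rfl
          · exact hmax i hi hfi
          · exact hle
      · refine ⟨k, ⟨lt_add_one k, hk⟩, fun i hi hfi => ?_⟩
        rcases (M.lt_succ _ _).1 hi with hi | rfl
        · exact (h' ⟨i, hi, hfi⟩).elim
        · exact le_rfl
    · obtain ⟨j, hj, hfj⟩ := h
      have hlt : ∀ i, i < k + 1 → f ⋄ i = 0 → i < k := fun i hi hfi => by
        rcases (M.lt_succ _ _).1 hi with hi | rfl
        · exact hi
        · exact (hk hfi).elim
      obtain ⟨j, ⟨hj, hfj⟩, hmax⟩ := ih ⟨j, hlt j hj hfj, hfj⟩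
      exact ⟨j, ⟨hsucc hj, hfj⟩, fun i hi hfi => hmax i (hlt i hi hfi) hfi⟩

theorem exists_max_of_dec {P : M.N → Prop} (hP : M.Dec fun x : Unit × M.N => P x.2)
    (v : M.D (.nat ⇒ .one)) {k : M.N} (h : ∃ j, j < k ∧ P j) :
    ∃ j, (j < k ∧ P j) ∧ ∀ i, i < k → P i → val (v ⋄ i) ≤ val (v ⋄ j) := by
  obtain ⟨f, hf⟩ := hP.exists_fun
  simp only [← hf] at h ⊢
  exact exists_max f v h

/-- Finitely many open intervals that cover `[a, b]` contain a chain of overlapping intervals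
from `a` to `b` with increasing ends. -/
theorem exists_chain {a b : M.R} [M.IsVal a] [M.IsVal b] (hab : a ≤ b) (l r : M.D (.nat ⇒ .one))
    {k : M.N} (hcov : ∀ u, M.IsVal u → a ≤ u → u ≤ b →
      ∃ j, j < k ∧ val (l ⋄ j) < u ∧ u < val (r ⋄ j)) :
    ∃ (n : M.N) (c : M.D .one), (∀ i, i ≤ n → c ⋄ i < k) ∧
      val (l ⋄ (c ⋄ 0)) < a ∧ a < val (r ⋄ (c ⋄ 0)) ∧
      val (l ⋄ (c ⋄ n)) < b ∧ b < val (r ⋄ (c ⋄ n)) ∧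
      ∀ i, i < n → val (l ⋄ (c ⋄ i)) < val (l ⋄ (c ⋄ (i + 1))) ∧
        val (r ⋄ (c ⋄ i)) < val (r ⋄ (c ⋄ (i + 1))) ∧
        val (l ⋄ (c ⋄ (i + 1))) < val (r ⋄ (c ⋄ i)) := by
  -- The greedy choice: begin with an interval around `a` that reaches furthest to the right.
  obtain ⟨j₀, ⟨hj₀, hl₀, hr₀⟩, hmax₀⟩ := exists_max_of_dec (M := M)
    (P := fun j => val (l ⋄ j) < a ∧ a < val (r ⋄ j)) inferInstance r (hcov a ‹_› le_rfl hab)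
  -- The next interval contains the current right end and, among all such intervals, reaches
  -- furthest.
  obtain ⟨g, hg, hgP⟩ := exists_search (X := Unit × M.N) (P := fun x j =>
    (j < k ∧ val (l ⋄ j) < val (r ⋄ x.2) ∧ val (r ⋄ x.2) < val (r ⋄ j)) ∧
    ∀ i, i < k → val (l ⋄ i) < val (r ⋄ x.2) ∧ val (r ⋄ x.2) < val (r ⋄ i) →
      val (r ⋄ i) ≤ val (r ⋄ j))
  obtain ⟨g', -, hg'⟩ := hg.exists_lam
  obtain ⟨G, hG, hG0, hGs⟩ := exists_rec (X := Unit) (a := fun _ => j₀) inferInstance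
    (h := fun x => g' () ⋄ x.2) inferInstance
  obtain ⟨c, -, hc⟩ := hG.exists_lam
  obtain ⟨c, rfl⟩ : ∃ c' : M.D .one, c = fun _ => c' := ⟨c (), rfl⟩
  have hc0 : c ⋄ 0 = j₀ := (hc () 0).trans (hG0 ())
  have hcs : ∀ i, c ⋄ (i + 1) = g ((), c ⋄ i) := fun i => by
    have h1 := hc () (i + 1)
    have h2 := hc () i
    rw [hGs, ← h2, hg'] at h1
    exact h1
  have hspec : ∀ j, a ≤ val (r ⋄ j) → val (r ⋄ j) ≤ b →
      (g ((), j) < k ∧ val (l ⋄ g ((), j)) < val (r ⋄ j) ∧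
        val (r ⋄ j) < val (r ⋄ g ((), j))) ∧
      ∀ i, i < k → val (l ⋄ i) < val (r ⋄ j) ∧ val (r ⋄ j) < val (r ⋄ i) →
        val (r ⋄ i) ≤ val (r ⋄ g ((), j)) := fun j h1 h2 =>
    hgP ((), j) (exists_max_of_dec (M := M)
      (P := fun i => val (l ⋄ i) < val (r ⋄ j) ∧ val (r ⋄ j) < val (r ⋄ i)) inferInstance r
      (hcov _ inferInstance h1 h2))
  have hle : ∀ n, (∀ i, i < n → val (r ⋄ (c ⋄ i)) ≤ b) → a < val (r ⋄ (c ⋄ n)) ∧ c ⋄ n < k := by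
    intro n
    induction n using induction with
    | h => infer_instance
    | h0 => intro _; rw [hc0]; exact ⟨hr₀, hj₀⟩
    | hs n ih =>
      intro h
      have h1 := (ih fun i hi => h i (hi.trans (lt_add_one n))).1
      have h2 := (hspec _ h1.le (h n (lt_add_one n))).1
      rw [hcs]
      exact ⟨h1.trans h2.2.2, h2.1⟩
  have hstep : ∀ n, (∀ i, i ≤ n → val (r ⋄ (c ⋄ i)) ≤ b) →
      (c ⋄ (n + 1) < k ∧ val (l ⋄ (c ⋄ (n + 1))) < val (r ⋄ (c ⋄ n)) ∧
        val (r ⋄ (c ⋄ n)) < val (r ⋄ (c ⋄ (n + 1)))) ∧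
      ∀ i, i < k → val (l ⋄ i) < val (r ⋄ (c ⋄ n)) ∧ val (r ⋄ (c ⋄ n)) < val (r ⋄ i) →
        val (r ⋄ i) ≤ val (r ⋄ (c ⋄ (n + 1))) := fun n h => by
    rw [hcs]
    exact hspec _ (hle n fun i hi => h i hi.le).1.le (h n le_rfl)
  -- If `b` were never passed, some visited index would have the greatest right end, as all of them
  -- lie below `k`; but the right end of its successor is greater.
  have hend : ∃ n, b < val (r ⋄ (c ⋄ n)) := by
    by_contra! hno
    obtain ⟨j, ⟨-, n, rfl⟩, hmax⟩ := exists_max_of_dec (M := M) (P := fun j => ∃ n, c ⋄ n = j)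
      inferInstance r (k := k) ⟨_, (hle 0 fun i _ => hno i).2, 0, rfl⟩
    have := (hstep n fun i _ => hno i).1
    exact (hmax _ this.1 ⟨_, rfl⟩).not_gt this.2.2
  obtain ⟨n, hn, hmin⟩ := exists_least hend
  have hmin : ∀ i, i < n → val (r ⋄ (c ⋄ i)) ≤ b := fun i hi => not_lt.1 (hmin i hi)
  have hst : ∀ i, i < n → _ := fun i hi => hstep i fun j hj => hmin j (hj.trans_lt hi)
  refine ⟨n, c, fun i hi => (hle i fun j hj => hmin j (hj.trans_le hi)).2, ?_, ?_, ?_, hn,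
    fun i hi => ⟨?_, (hst i hi).1.2.2, (hst i hi).1.2.1⟩⟩
  · rw [hc0]; exact hl₀
  · rw [hc0]; exact hr₀
  · rcases zero_or_succ n with rfl | ⟨m, rfl⟩
    · rw [hc0]; exact hl₀.trans_le hab
    · exact (hst m (lt_add_one m)).1.2.1.trans_le (hmin m (lt_add_one m))
  -- Left ends increase by greediness: an interval whose left end is not beyond the previous point
  -- of choice would have been a candidate one step earlier, reaching further than the one chosen.
  · have h1 := (hst i hi).1
    rcases zero_or_succ i with rfl | ⟨j, rfl⟩
    · rw [hc0] at h1 ⊢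
      refine hl₀.trans_le (not_lt.1 fun hlt => ?_)
      exact (hmax₀ _ h1.1 ⟨hlt, hr₀.trans h1.2.2⟩).not_gt h1.2.2
    · have h2 := hst j ((lt_add_one j).trans hi)
      refine h2.1.2.1.trans_le (not_lt.1 fun hlt => ?_)
      exact (h2.2 _ h1.1 ⟨hlt, h2.1.2.2.trans h1.2.2⟩).not_gt h1.2.2

end Model

end HigherOrderArithmetic

namespace HigherOrderArithmetic

local infixr:60 " ⇒ " => Ty.arr

namespace Model

set_option synthInstance.maxSize 4000
set_option synthInstance.maxHeartbeats 400000

variable {M : Model}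

local infixl:100 " ⋄ " => PreStr.app (Model.toPreStr _)

/-! ### Fine partitions -/

theorem exists_gauge {z : M.D .one → M.R} (hz : M.RealRep fun x : Unit × M.D .one => z x.2)
    (h0 : ∀ x, IsReal x → 0 < z x)
    (hc : ∀ x y, IsReal x → IsReal y → val x = val y → z x = z y) :
    ∃ Ψ : M.D (.one ⇒ .one), IsGauge Ψ ∧ ∀ x, val (Ψ ⋄ x) = z x := by
  obtain ⟨g, -, hg⟩ := hz.exists_lam
  refine ⟨g (), ⟨fun x _ => (hg () x).1, fun x hx => ?_, fun x y hx hy hxy => ?_⟩,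
    fun x => (hg () x).2⟩
  · rw [(hg () x).2]; exact h0 x hx
  · rw [(hg () x).2, (hg () y).2]; exact hc x y hx hy hxy

/-- The centres of a chain of overlapping cover intervals become the tags, and the cut points are
taken in the overlaps between consecutive centres. Shrinking the gauge beforehand makes the mesh
small and forces the first and last tags to be `a` and `1`. -/
theorem exists_fine (hC : M.Cousin) {δ : M.D (.one ⇒ .one)} (hδ : IsGauge δ) {a d : M.R}
    [M.IsVal a] [M.IsVal d] (h0 : 0 ≤ a) (h1 : a < 1) (hd : 0 < d) :
    ∃ k p t, IsPart a 1 k p t ∧ Fine δ k p t ∧ Mesh d k p := by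
  classical
  -- A centre other than `a` gets a radius at most its distance from `a`, so `a` can be covered only
  -- by an interval centred there; likewise for `1`. The bound `d / 2` controls the mesh.
  obtain ⟨Ψ, hΨ, hΨz⟩ := exists_gauge (M := M)
    (z := fun x => min (min (val (δ ⋄ x)) (d / 2)) (min (if val x = a then 1 else |val x - a|)
      (if val x = 1 then 1 else |val x - 1|))) inferInstance (fun x hx => by
        refine lt_min (lt_min (hδ.pos x hx) (half_pos hd)) (lt_min ?_ ?_)
        all_goals
          split_ifs with h
          · exact zero_lt_one
          · exact abs_pos.2 (sub_ne_zero.2 h)) (fun x y hx hy hxy => by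
        rw [hδ.congr x y hx hy hxy, hxy])
  obtain ⟨k, y, hy, hcov⟩ := hC Ψ hΨ
  obtain ⟨l, hl⟩ := RealRep.exists_seq (M := M) (z := fun i => val (y ⋄ i) - val (Ψ ⋄ (y ⋄ i)))
    inferInstance
  obtain ⟨r, hr⟩ := RealRep.exists_seq (M := M) (z := fun i => val (y ⋄ i) + val (Ψ ⋄ (y ⋄ i)))
    inferInstance
  obtain ⟨n, c, hck, hl0, hr0, hln, hrn, hch⟩ := exists_chain (M := M) h1.le l r (k := k)
    fun u hu hau hub => by
      obtain ⟨x, hx, rfl⟩ := hu.out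
      obtain ⟨j, hj, h⟩ := hcov x hx (h0.trans hau) hub
      rw [abs_lt] at h
      refine ⟨j, hj, ?_, ?_⟩
      · rw [(hl j).2]; linarith
      · rw [(hr j).2]; linarith
  simp only [(hl _).2, (hr _).2] at hl0 hr0 hln hrn hch
  set Y : M.N → M.R := fun i => val (y ⋄ (c ⋄ i)) with hY
  set Z : M.N → M.R := fun i => val (Ψ ⋄ (y ⋄ (c ⋄ i))) with hZ
  have hZδ : ∀ i, Z i ≤ val (δ ⋄ (y ⋄ (c ⋄ i))) := fun i => by
    simp only [hZ, hΨz]; exact (min_le_left _ _).trans (min_le_left _ _)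
  have hZd : ∀ i, Z i ≤ d / 2 := fun i => by
    simp only [hZ, hΨz]; exact (min_le_left _ _).trans (min_le_right _ _)
  have hZpos : ∀ i, i ≤ n → 0 < Z i := fun i hi => hΨ.pos _ (hy _ (hck i hi))
  have hYa : Y 0 = a := by
    by_contra hne
    have h2 : Z 0 ≤ |Y 0 - a| := by
      simp only [hZ, hΨz]
      refine (min_le_right _ _).trans ((min_le_left _ _).trans ?_)
      rw [if_neg hne]
    exact h2.not_gt (abs_lt.2 ⟨by linarith, by linarith⟩)
  have hY1 : Y n = 1 := by
    by_contra hne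
    have h2 : Z n ≤ |Y n - 1| := by
      simp only [hZ, hΨz]
      refine (min_le_right _ _).trans ((min_le_right _ _).trans ?_)
      rw [if_neg hne]
    exact h2.not_gt (abs_lt.2 ⟨by linarith, by linarith⟩)
  -- The term `s i` will be the partition point `i + 1`: the midpoint of the part of the overlap
  -- between the centres `i` and `i + 1`. The last one is the end point `1`.
  obtain ⟨s, hs⟩ := RealRep.exists_seq (M := M) (z := fun i => if i = n then 1 else
    (max (val (y ⋄ (c ⋄ i))) (val (y ⋄ (c ⋄ (i + 1))) - val (Ψ ⋄ (y ⋄ (c ⋄ (i + 1))))) +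
      min (val (y ⋄ (c ⋄ (i + 1)))) (val (y ⋄ (c ⋄ i)) + val (Ψ ⋄ (y ⋄ (c ⋄ i))))) / 2)
    inferInstance
  obtain ⟨t, ht⟩ := RealRep.exists_seq (M := M) (z := fun i => val (y ⋄ (c ⋄ i))) inferInstance
  obtain ⟨p, hpr, hp0, hps⟩ := exists_shift a s
  have hpn : val (p ⋄ (n + 1)) = 1 := by rw [hps, (hs n).2, if_pos rfl]
  have hq : ∀ i, i < n → Y i < val (p ⋄ (i + 1)) ∧ Y (i + 1) - Z (i + 1) < val (p ⋄ (i + 1)) ∧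
      val (p ⋄ (i + 1)) < Y (i + 1) ∧ val (p ⋄ (i + 1)) < Y i + Z i := fun i hi => by
    obtain ⟨h2, h3, h4⟩ := hch i hi
    have h5 := hZpos i hi.le
    have h6 := hZpos (i + 1) (succ_le_iff'.2 hi)
    -- Both ends of the intervals increase, hence so do the centres, as one sees by adding the two
    -- inequalities.
    have h7 : max (Y i) (Y (i + 1) - Z (i + 1)) < min (Y (i + 1)) (Y i + Z i) :=
      max_lt (lt_min (by simp only [hY, hZ] at *; linarith) (by linarith))
        (lt_min (by linarith) h4)
    have h8 : val (p ⋄ (i + 1)) =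
        (max (Y i) (Y (i + 1) - Z (i + 1)) + min (Y (i + 1)) (Y i + Z i)) / 2 := by
      rw [hps, (hs i).2, if_neg hi.ne]
    rw [h8]
    refine ⟨?_, ?_, ?_, ?_⟩
    · linarith [le_max_left (Y i) (Y (i + 1) - Z (i + 1))]
    · linarith [le_max_right (Y i) (Y (i + 1) - Z (i + 1))]
    · linarith [min_le_left (Y (i + 1)) (Y i + Z i)]
    · linarith [min_le_right (Y (i + 1)) (Y i + Z i)]
  have hA : ∀ i, i ≤ n → val (p ⋄ i) ≤ Y i ∧ (i ≠ 0 → val (p ⋄ i) < Y i) ∧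
      Y i - Z i ≤ val (p ⋄ i) := fun i hi => by
    rcases zero_or_succ i with rfl | ⟨j, rfl⟩
    · rw [hp0, hYa]
      exact ⟨le_rfl, fun h => (h rfl).elim, by linarith [hZpos 0 hi]⟩
    · have := hq j (succ_le_iff'.1 hi)
      exact ⟨this.2.2.1.le, fun _ => this.2.2.1, this.2.1.le⟩
  have hB : ∀ i, i ≤ n → Y i ≤ val (p ⋄ (i + 1)) ∧ (i ≠ n → Y i < val (p ⋄ (i + 1))) ∧
      val (p ⋄ (i + 1)) ≤ Y i + Z i := fun i hi => by
    rcases hi.eq_or_lt with rfl | hi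
    · rw [hpn, hY1]
      exact ⟨le_rfl, fun h => (h rfl).elim, by linarith [hZpos i le_rfl]⟩
    · have := hq i hi
      exact ⟨this.1.le, fun _ => this.1, this.2.2.2.le⟩
  refine ⟨n + 1, p, t, ⟨fun i _ => hpr i, fun i _ => (ht i).1, hp0, hpn, fun i hi => ?_,
    fun i hi => ?_, fun i hi => ?_⟩, fun i hi => ?_, fun i hi => ?_⟩
  all_goals
    have hi := lt_add_one_iff'.1 hi
    have h2 := hA i hi
    have h3 := hB i hi
  · by_cases hi0 : i = 0
    · subst hi0
      by_cases hn0 : (0 : M.N) = n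
      · subst hn0; rw [hp0, hpn]; exact h1
      · exact h2.1.trans_lt (h3.2.1 hn0)
    · exact (h2.2.1 hi0).trans_le h3.1
  · rw [(ht i).2]; exact h2.1
  · rw [(ht i).2]; exact h3.1
  · have h4 : val (δ ⋄ (t ⋄ i)) = val (δ ⋄ (y ⋄ (c ⋄ i))) :=
      hδ.congr _ _ (ht i).1 (hy _ (hck i hi)) (ht i).2
    rw [h4, (ht i).2]
    have h5 := hZδ i
    exact ⟨by linarith, by linarith⟩
  · have h5 := hZd i
    linarith

/-! ### Hake's theorem from the Cousin lemma -/

/-- The second partition is the first with one more interval in front. By induction the partial sums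
differ by the constant first term, so the two estimates can be combined. -/
theorem SumNear.abs_sub_add_lt {f : M.D (.one ⇒ .one)} {k : M.N}
    {p t p' t' : M.D (.nat ⇒ .one)} {A B e e' : M.R} (h : SumNear f k p t B e)
    (h' : SumNear f (k + 1) p' t' A e') (hp : ∀ i, val (p' ⋄ (i + 1)) = val (p ⋄ i))
    (ht : ∀ i, i < k → val (f ⋄ (t' ⋄ (i + 1))) = val (f ⋄ (t ⋄ i))) :
    |B - A + val (f ⋄ (t' ⋄ 0)) * (val (p' ⋄ (0 + 1)) - val (p' ⋄ 0))| < e + e' := by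
  obtain ⟨S, hS, hS0, hSs, hSk⟩ := h
  obtain ⟨S', hS', hS0', hSs', hSk'⟩ := h'
  set w := val (f ⋄ (t' ⋄ 0)) * (val (p' ⋄ (0 + 1)) - val (p' ⋄ 0)) with hw
  have key : ∀ i, i ≤ k → val (S' ⋄ (i + 1)) = val (S ⋄ i) + w := fun i => by
    have : M.IsVal w := by rw [hw]; infer_instance
    clear_value w
    induction i using induction with
    | h => infer_instance
    | h0 => intro _; rw [hSs' 0 (zero_lt_iff.2 (M.succ_ne_zero k)), hS0', hS0, hw]
    | hs i ih =>
      intro hi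
      have hi := succ_le_iff'.1 hi
      rw [hSs' (i + 1) (add_lt_add_left hi 1), ih hi.le, hSs i hi, ht i hi, hp, hp]
      ring
  rw [key k le_rfl] at hSk'
  rw [abs_lt] at *
  constructor <;> linarith

/-- One partition of `[x, 1]`, both `δ`-fine and of small mesh, has a sum near `B`. Adding `[0, x]`
with tag `0` makes it a `δ`-fine partition of `I`, whose sum is near `A`. -/
theorem hake_of_cousin (hC : M.Cousin) : M.Hake := by
  intro f hf _ hR A hA hG e he he0
  obtain ⟨δ, hδ, hGδ⟩ := hG (e / 4) inferInstance (by linarith)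
  have hz0 : IsReal M.zeroC := isReal_zeroC
  have hδ0 := hδ.pos _ hz0
  set f0 := val (f ⋄ M.zeroC) with hf0
  have hf0v : M.IsVal f0 := inferInstance
  have hpos : 0 < 4 * (|f0| + 1) := by positivity
  -- The three bounds make `[0, x]` fine for the tag `0`, make the term `f(0) x` less than `e / 4`,
  -- and ensure `x < 1`. The total error then stays below `3 e / 4`.
  refine ⟨min (min (val (δ ⋄ M.zeroC)) (e / (4 * (|f0| + 1)))) 1, inferInstance,
    lt_min (lt_min hδ0 (div_pos he0 hpos)) zero_lt_one, fun x hx hx0 hxη hx1 B hB hRB => ?_⟩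
  obtain ⟨hxη, hx1⟩ := lt_min_iff.1 hxη
  obtain ⟨hxδ, hxe⟩ := lt_min_iff.1 hxη
  obtain ⟨d, hd, hd0, hRd⟩ := hRB (e / 4) inferInstance (by linarith)
  obtain ⟨k, p, t, hP, hF, hm⟩ := exists_fine hC hδ hx0.le hx1 hd0
  have hs := hRd k p t hP hm
  obtain ⟨p', hpr, hp0, hps⟩ := exists_shift 0 p
  obtain ⟨t', htr, ht0, hts⟩ := exists_shift 0 t
  have hP' : IsPart 0 1 (k + 1) p' t' := by
    refine ⟨fun i _ => hpr i, fun i _ => htr i, hp0, by rw [hps, hP.right], fun i hi => ?_,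
      fun i hi => ?_, fun i hi => ?_⟩
    all_goals
      rcases zero_or_succ i with rfl | ⟨j, rfl⟩
    · rw [hp0, hps, hP.left]; exact hx0
    · rw [hps, hps]; exact hP.lt j (lt_of_add_lt_add_right hi)
    · rw [hp0, ht0]
    · rw [hps, hts]; exact hP.le_tag j (lt_of_add_lt_add_right hi)
    · rw [hps, ht0, hP.left]; exact hx0.le
    · rw [hps, hts]; exact hP.tag_le j (lt_of_add_lt_add_right hi)
  have hF' : Fine δ (k + 1) p' t' := by
    intro i hi
    rcases zero_or_succ i with rfl | ⟨j, rfl⟩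
    · rw [hδ.congr _ _ (htr 0) hz0 (by rw [ht0, val_zeroC]), ht0, hp0, hps, hP.left]
      exact ⟨by linarith, by linarith⟩
    · have hj := lt_of_add_lt_add_right hi
      rw [hδ.congr _ _ (htr (j + 1)) (hP.real_t j hj) (hts j), hts, hps, hps]
      exact hF j hj
  have hs' := hGδ _ _ _ hP' hF'
  have hft : ∀ i, i < k → val (f ⋄ (t' ⋄ (i + 1))) = val (f ⋄ (t ⋄ i)) := fun i hi =>
    hf.congr _ _ (htr _) (hP.real_t i hi)
      (by rw [hts]; exact hx0.le.trans ((hP.left_le hi.le).trans (hP.le_tag i hi)))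
      (by rw [hts]; exact (hP.tag_le i hi).trans (hP.le_right (succ_le_iff'.2 hi))) (hts i)
  have key := hs.abs_sub_add_lt hs' hps hft
  have hft0 : val (f ⋄ (t' ⋄ 0)) = f0 :=
    hf.congr _ _ (htr 0) hz0 ht0.ge (ht0.le.trans zero_le_one) (ht0.trans val_zeroC.symm)
  rw [hft0, hps, hp0, hP.left, sub_zero] at key
  have hfx : |f0 * x| < e / 4 := by
    rw [abs_mul, abs_of_pos hx0]
    rw [lt_div_iff₀ hpos] at hxe
    nlinarith [abs_nonneg f0]
  rw [abs_lt] at *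
  constructor <;> linarith

theorem GMod.gInt {f : M.D (.one ⇒ .one)} {A : M.R} {Φ : M.D (.one ⇒ .one ⇒ .one)}
    (h : GMod f A Φ) : GInt f A := by
  rintro e ⟨x, hx, rfl⟩ he0
  exact ⟨Φ ⋄ x, h.gauge x hx, h.sumNear x hx he0⟩

theorem weakHake_of_hake (h : M.Hake) : M.WeakHake := by
  rintro f hf ⟨A, hA, Φ, hΦ⟩ hR
  exact ⟨A, hA, h f hf ⟨A, hA, Φ, hΦ⟩ hR A hA hΦ.gInt⟩

/-! ### Integrability of all functions without the Cousin lemma -/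

/-- The first partition point not below `x` exists by the least number principle, and `x` lies in
the interval ending there, or in the first interval if that point is the left end. -/
theorem IsPart.exists_mem {a b : M.R} {k : M.N} {p t : M.D (.nat ⇒ .one)} (h : IsPart a b k p t)
    (hab : a < b) {x : M.R} [M.IsVal x] (hax : a ≤ x) (hxb : x ≤ b) :
    ∃ i, i < k ∧ val (p ⋄ i) ≤ x ∧ x ≤ val (p ⋄ (i + 1)) := by
  obtain ⟨i, ⟨hik, hi⟩, hmin⟩ := exists_least (M := M) (P := fun i => i ≤ k ∧ x ≤ val (p ⋄ i))
    ⟨k, le_rfl, hxb.trans h.right.ge⟩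
  rcases zero_or_succ i with rfl | ⟨j, rfl⟩
  · have hk : 0 < k := (zero_le' k).lt_of_ne (by
      rintro rfl
      exact hab.ne (h.left.symm.trans h.right))
    exact ⟨0, hk, h.left.le.trans hax, hi.trans (h.lt 0 hk).le⟩
  · have hj := succ_le_iff'.1 hik
    exact ⟨j, hj, (not_le.1 fun hx => hmin j (lt_add_one j) ⟨hj.le, hx⟩).le, hi⟩

/-- If the balls given by `Ψ` have no finite subcover of `I`, then no partition is fine for `Ψ / 2`,
because its tags would give one. So the constant modulus `Ψ / 2` works vacuously for any claimed
integral, here `0`. -/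
theorem gIntegrable_of_not_cousin (hC : ¬ M.Cousin) (f : M.D (.one ⇒ .one)) : GIntegrable f := by
  simp only [Cousin, not_forall] at hC
  obtain ⟨Ψ, hΨ, hno⟩ := hC
  -- Fineness concerns closed intervals and covering concerns open ones; halving bridges the
  -- difference.
  obtain ⟨g, hg, hgΨ⟩ := RealRep.exists_lam (M := M) (X := Unit × M.D .one) (σ := .one)
    (z := fun x => val (Ψ ⋄ x.2) / 2) inferInstance
  obtain ⟨Φ, -, hΦ⟩ := hg.exists_lam
  have hv : ∀ e x, IsReal (Φ () ⋄ e ⋄ x) ∧ val (Φ () ⋄ e ⋄ x) = val (Ψ ⋄ x) / 2 := fun e x => by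
    rw [hΦ]; exact hgΨ _ _
  refine ⟨0, inferInstance, Φ (), ⟨fun e _ => ⟨fun x _ => (hv e x).1, fun x hx => ?_,
    fun x y hx hy hxy => ?_⟩, fun e e' _ _ _ x _ => ?_, fun e _ _ k p t hP hF => ?_⟩⟩
  · rw [(hv e x).2]; exact half_pos (hΨ.pos x hx)
  · rw [(hv e x).2, (hv e y).2, hΨ.congr x y hx hy hxy]
  · rw [(hv e x).2, (hv e' x).2]
  · refine (hno ⟨k, t, hP.real_t, fun x hx hx0 hx1 => ?_⟩).elim
    obtain ⟨i, hi, h1, h2⟩ := hP.exists_mem zero_lt_one hx0 hx1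
    obtain ⟨h3, h4⟩ := hF i hi
    rw [(hv e _).2] at h3 h4
    have := hΨ.pos _ (hP.real_t i hi)
    exact ⟨i, hi, abs_lt.2 ⟨by linarith, by linarith⟩⟩

end Model

end HigherOrderArithmetic

namespace HigherOrderArithmetic

local infixr:60 " ⇒ " => Ty.arr

namespace Model

set_option synthInstance.maxSize 4000
set_option synthInstance.maxHeartbeats 400000

variable {M : Model}

local infixl:100 " ⋄ " => PreStr.app (Model.toPreStr _)

/-! ### A function without improper integral -/

/-- Both `1 / s²` and `1 / (u v)` lie between `1 / v²` and `1 / u²`, whose difference is `(v - u)(v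
+ u) / (u² v²)`. -/
theorem abs_inv_sq_mul_sub_le {u v s x d : M.R} (hx : 0 < x) (hxu : x ≤ u) (hus : u ≤ s)
    (hsv : s ≤ v) (hv1 : v ≤ 1) (huv : v ≤ u + d) :
    |s⁻¹ * s⁻¹ * (v - u) - (u⁻¹ - v⁻¹)| ≤ 2 * d / x ^ 4 * (v - u) := by
  have hu : 0 < u := hx.trans_le hxu
  have hs : 0 < s := hu.trans_le hus
  have hv : 0 < v := hs.trans_le hsv
  have h1 : u⁻¹ - v⁻¹ = u⁻¹ * v⁻¹ * (v - u) := by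
    field_simp
  have h2 : v⁻¹ ≤ s⁻¹ := inv_anti₀ hs hsv
  have h3 : s⁻¹ ≤ u⁻¹ := inv_anti₀ hu hus
  have h4 : 0 < v⁻¹ := inv_pos.2 hv
  have h5 : u⁻¹ * u⁻¹ - v⁻¹ * v⁻¹ ≤ 2 * d / x ^ 4 := by
    have h6 : u⁻¹ * u⁻¹ - v⁻¹ * v⁻¹ = (v - u) * (v + u) / (u ^ 2 * v ^ 2) := by
      field_simp
      ring
    rw [h6]
    have hd : 0 ≤ d := by linarith
    have h7 : x ^ 4 ≤ u ^ 2 * v ^ 2 := by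
      have : x ^ 4 = x ^ 2 * x ^ 2 := by ring
      rw [this]
      gcongr
      exact hxu.trans (hus.trans hsv)
    refine div_le_div₀ (by positivity) ?_ (by positivity) h7
    have h8 : v + u ≤ 2 := by linarith
    calc (v - u) * (v + u) ≤ d * 2 := mul_le_mul (by linarith) h8 (by positivity) hd
      _ = 2 * d := _root_.mul_comm _ _
  rw [h1, ← sub_mul, abs_mul, abs_of_nonneg (by linarith : 0 ≤ v - u)]
  refine mul_le_mul_of_nonneg_right (le_trans (abs_le.2 ⟨?_, ?_⟩) h5) (by linarith)
  · nlinarith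
  · nlinarith

/-- Each term of the Riemann sum is compared with the increment of `-1 / y`, and these increments
telescope. The error grows at most in proportion to the length covered, which is proved by induction
inside the model. -/
theorem rInt_inv_sq {f : M.D (.one ⇒ .one)}
    (hfv : ∀ y, IsReal y → 0 < val y → val (f ⋄ y) = (val y)⁻¹ * (val y)⁻¹) {x : M.R}
    [hx : M.IsVal x] (hx0 : 0 < x) : RInt f x 1 (x⁻¹ - 1) := by
  intro e he he0
  -- With the mesh `e x⁴ / 4` the error per unit length is `e / 2`.
  refine ⟨e * (x * x * (x * x)) / 4, inferInstance, by positivity, fun k p t hP hm => ?_⟩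
  obtain ⟨S, hS, hS0, hSs⟩ := exists_sum (M := M)
    (c := fun i => val (f ⋄ (t ⋄ i)) * (val (p ⋄ (i + 1)) - val (p ⋄ i))) inferInstance
  refine ⟨S, fun i _ => hS i, hS0, fun i _ => hSs i, ?_⟩
  have key : ∀ i, i ≤ k → |val (S ⋄ i) - (x⁻¹ - (val (p ⋄ i))⁻¹)| ≤ e / 2 * (val (p ⋄ i) - x) := by
    intro i
    induction i using induction with
    | h => infer_instance
    | h0 => intro _; rw [hS0, hP.left]; simp
    | hs i ih =>
      intro hi
      have hi := succ_le_iff'.1 hi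
      have h1 := ih hi.le
      have hxp := hP.left_le hi.le
      have h2 := abs_inv_sq_mul_sub_le hx0 hxp (hP.le_tag i hi) (hP.tag_le i hi)
        (hP.le_right (succ_le_iff'.2 hi)) (hm i hi)
      have h3 : 2 * (e * (x * x * (x * x)) / 4) / x ^ 4 = e / 2 := by
        field_simp
        ring
      rw [h3] at h2
      rw [hSs, hfv _ (hP.real_t i hi) (hx0.trans_le (hxp.trans (hP.le_tag i hi)))]
      rw [abs_le] at *
      constructor <;> linarith
  have h1 := key k le_rfl
  rw [hP.right, inv_one] at h1
  refine h1.trans_lt ?_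
  nlinarith

/-- The function `1 / y²`, extended by `0`, has the unbounded integrals `1 / x - 1`. The case
distinction at `0` is arithmetical, so the function exists in the model. -/
theorem exists_not_tends : ∃ f : M.D (.one ⇒ .one), IsFunOnI f ∧ RIntegrableOffZero f ∧
    ∀ L, M.IsVal L → ¬ Tends f L := by
  classical
  obtain ⟨g, -, hg⟩ := RealRep.exists_lam (M := M) (X := Unit) (σ := .one)
    (z := fun x => if val x.2 ≤ 0 then 0 else (val x.2)⁻¹ * (val x.2)⁻¹) inferInstance
  have hf : IsFunOnI (g ()) := by
    refine ⟨fun x _ _ _ => (hg () x).1, fun x y _ _ _ _ hxy => ?_⟩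
    rw [(hg () x).2, (hg () y).2]
    simp only [hxy]
  have hfv : ∀ y, IsReal y → 0 < val y → val (g () ⋄ y) = (val y)⁻¹ * (val y)⁻¹ :=
    fun y _ h0 => (hg () y).2.trans (if_neg h0.not_ge)
  refine ⟨g (), hf, fun x hx hx0 _ => ⟨x⁻¹ - 1, inferInstance, rInt_inv_sq hfv hx0⟩,
    fun L hL hT => ?_⟩
  obtain ⟨η, hη, hη0, h⟩ := hT 1 inferInstance zero_lt_one
  have hL0 : 0 < |L| + 3 := by positivity
  -- The last bound gives `x⁻¹ - 1 ≥ |L| + 2`, which is at distance more than `1` from `L`.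
  have hx0 : 0 < min (min (η / 2) 1) (|L| + 3)⁻¹ :=
    lt_min (lt_min (half_pos hη0) zero_lt_one) (inv_pos.2 hL0)
  set x := min (min (η / 2) 1) (|L| + 3)⁻¹ with hx
  have hxv : M.IsVal x := by rw [hx]; infer_instance
  have hxη : x ≤ η / 2 := (min_le_left _ _).trans (min_le_left _ _)
  have hx1 : x ≤ 1 := (min_le_left _ _).trans (min_le_right _ _)
  have hxL : |L| + 3 ≤ x⁻¹ := (le_inv_comm₀ hL0 hx0).2 (min_le_right _ _)
  have h1 := h x hxv hx0 (hxη.trans_lt (half_lt_self hη0)) hx1 _ inferInstance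
    (rInt_inv_sq hfv hx0)
  linarith [(abs_lt.1 h1).2, le_abs_self L]

/-! ### The equivalences in a model -/

theorem cousin_of_weakHake (h : M.WeakHake) : M.Cousin := by
  by_contra hC
  obtain ⟨f, hf, hR, hT⟩ := M.exists_not_tends
  obtain ⟨L, hL, hL'⟩ := h f hf (gIntegrable_of_not_cousin hC f) hR
  exact hT L hL hL'

theorem cousin_iff_hake : M.Cousin ↔ M.Hake :=
  ⟨hake_of_cousin, fun h => cousin_of_weakHake (weakHake_of_hake h)⟩

theorem cousin_iff_weakHake : M.Cousin ↔ M.WeakHake :=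
  ⟨fun h => weakHake_of_hake (hake_of_cousin h), cousin_of_weakHake⟩

/-- Under HBU, weak Hake rules out a gauge integral with a modulus for `1 / y²`; without HBU every
function has one. -/
theorem cousin_iff_notAllGaugeIntegrable : M.Cousin ↔ M.NotAllGaugeIntegrable := by
  refine ⟨fun h => ?_, fun ⟨f, _, hf⟩ => ?_⟩
  · obtain ⟨f, hf, hR, hT⟩ := M.exists_not_tends
    refine ⟨f, hf, fun hG => ?_⟩
    obtain ⟨L, hL, hL'⟩ := cousin_iff_weakHake.1 h f hf hG hR
    exact hT L hL hL'
  · by_contra hC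
    exact hf (gIntegrable_of_not_cousin hC f)

end Model

theorem ACAProves_iff_of_model {A B : Form} {P Q : Model → Prop}
    [hA : ∀ (M : Model) (c : Ctx M.toPreStr), A.Den c (P M)]
    [hB : ∀ (M : Model) (c : Ctx M.toPreStr), B.Den c (Q M)] (h : ∀ M, P M ↔ Q M) :
    ACAProves (iff A B) :=
  ACAProves_of_model fun M v => (sat_toFm (P := P M ↔ Q M) v).2 (h M)

end HigherOrderArithmetic

theorem mainTheorem4 :
    HigherOrderArithmetic.ACAProves
      (HigherOrderArithmetic.iff HigherOrderArithmetic.HBU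
        HigherOrderArithmetic.notAllGaugeIntegrable) ∧
    HigherOrderArithmetic.ACAProves
      (HigherOrderArithmetic.iff HigherOrderArithmetic.HBU HigherOrderArithmetic.hake) ∧
    HigherOrderArithmetic.ACAProves
      (HigherOrderArithmetic.iff HigherOrderArithmetic.HBU HigherOrderArithmetic.weakHake) :=
  ⟨HigherOrderArithmetic.ACAProves_iff_of_model
      fun M => M.cousin_iff_notAllGaugeIntegrable,
    HigherOrderArithmetic.ACAProves_iff_of_model fun M => M.cousin_iff_hake,
    HigherOrderArithmetic.ACAProves_iff_of_model fun M => M.cousin_iff_weakHake⟩
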